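/- Let $e\ge 2$. All groups are finite. For a $3$-group $D$ let $P_0(D)=D$, $P_{n+1}(D)=P_n(D)^3[P_n(D),D]$ be the lower exponent-$3$ central series. $D$ is called an immediate descendant of step size $s$ of $P$ if $D/P_c(D)\simeq P$ for the last non-trivial term $P_c(D)$ and $|D|=3^s|P|$. For an abelian $3$-group $P$ which, up to isomorphism, has exactly one abelian and exactly one non-abelian immediate descendant of step size $1$, these are denoted by $P-\#1;1$ (abelian) and $P-\#1;2$ (non-abelian), and $P(-\#1;1)^n$ denotes the $n$-fold iteration of $-\#1;1$. Write $\mathrm{lo}(G)=\log_3|G|$, and write $(3^a,3^b)$, or logarithmically $(a\,b)$, for the type of $C_{3^a}\times C_{3^b}$. If $G/G'\simeq(3^e,3)$ is generated by the cosets of $x$ (of order $3^e$) and $y$ (of order $3$), let $H_1=\langle x,G'\rangle$, $H_2=\langle xy,G'\rangle$, $H_3=\langle xy^2,G'\rangle$, $H_4=\langle x^3,y,G'\rangle$ be the maximal subgroups and, with $z=x^{3^{e-1}}$, let $U_0=\langle z,y,G'\rangle$, $U_1=\langle y,G'\rangle$, $U_2=\langle zy,G'\rangle$, $U_3=\langle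 zy^2,G'\rangle$, $U_4=\langle z,G'\rangle$. We write $\varkappa(G)\sim(k_1k_2k_3;k_4)$ if for some such choice of $x,y$ the transfer $G\to H_i/H_i'$ has kernel $U_{k_i}$ for $1\le i\le 4$, and $\alpha_1(G)\sim(\tau_1,\tau_2,\tau_3;\tau_4)$ if for some such choice $H_i/H_i'$ has logarithmic type $\tau_i$ for $1\le i\le 4$. Type a.1 means $\varkappa\sim(000;0)$ and type A.1 means $\varkappa\sim(111;1)$. A $3$-group is a Schur group if its generator rank equals its relation rank $\dim H^2(G,\mathbb F_3)$ (balanced presentation); a $\sigma$-group is a group with an automorphism inducing inversion on $G/G'$; metabelian means $G''=1$. (1) The abelian group $T_e$ of type $(3^e,3)$ is given by $T_e\simeq \mathrm{SmallGroup}(27,2)(-\#1;1)^{e-2}$, where $\mathrm{SmallGroup}(27,2)\simeq C_9\times C_3$. It has $\mathrm{lo}(T_e)=1+e$, transfer kernel type a.1, and $\alpha_1(T_e)\sim(e,e,e;(e-1)\,1)$. (2) $T_e$ has, up to isomorphism, exactly two immediate descendants, both of step size $1$: the group $T_{e+1}=T_e-\#1;1$ and a single further group $$G_e\simeq\mathrm{SmallGroup}(27,2)(-\#1;1)^{e-2}-\#1;2,$$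 and $G_e$ has no immediate descendants. Thus the groups $T_e$ form the infinite main trunk of a descendant tree whose finite twigs are the singlets $G_e$. (3) $G_e$ is, up to isomorphism, the unique metabelian Schur $3$-group with commutator quotient of type $(3^e,3)$ and transfer kernel type A.1. It has $\alpha_1(G_e)\sim(e+1,e+1,e+1;e\,1)$ and $\mathrm{lo}(G_e)=2+e$, and it is not a $\sigma$-group. -/

import Mathlib

/-- The finite abelian `3`-group `C_{3^a} × C_{3^b}` of logarithmic type `(a, b)`;
`b = 0` gives the cyclic group of order `3^a`. -/
abbrev AbType (a b : ℕ) : Type :=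
  Multiplicative (ZMod (3 ^ a)) × Multiplicative (ZMod (3 ^ b))

/-- The group with identifier `⟨27, 2⟩` of the SmallGroups library, that is `C_9 × C_3`. -/
abbrev SmallGroup27_2 : Type := Multiplicative (ZMod 9) × Multiplicative (ZMod 3)

/-! ### Lower exponent-`p` central series and `p`-descendants -/

/-- `K^p [K, G]` for a subgroup `K` of `G`. -/
def pStep {G : Type*} [Group G] (p : ℕ) (K : Subgroup G) : Subgroup G :=
  ⁅K, (⊤ : Subgroup G)⁆ ⊔ Subgroup.closure {g | ∃ k ∈ K, g = k ^ p}

/-- The lower exponent-`p` central series `P_0(G) = G`, `P_{n+1}(G) = P_n(G)^p [P_n(G), G]`. -/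
def lowerPCentral (p : ℕ) (G : Type*) [Group G] : ℕ → Subgroup G
  | 0 => ⊤
  | n + 1 => pStep p (lowerPCentral p G n)

/-- `D` is an immediate `p`-descendant of step size `s` of its `p`-parent `P`: the quotient of `D`
by the last non-trivial term `P_c(D)` of its lower exponent-`p` central series is isomorphic
to `P`, and `|D| = p^s |P|`. -/
def IsImmediateDescendant (p s : ℕ) (P D : Type) [Group P] [Group D] : Prop :=
  (∃ c : ℕ, lowerPCentral p D c ≠ ⊥ ∧ lowerPCentral p D (c + 1) = ⊥ ∧
    ∃ f : D →* P, Function.Surjective f ∧ f.ker = lowerPCentral p D c) ∧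
  Nat.card D = p ^ s * Nat.card P

/-- `D ≃ P -#1;i`.  The relative counter `i` numbers the immediate `3`-descendants of step size `1`
of an abelian `3`-group `P` having, up to isomorphism, one abelian and one non-abelian such
descendant: the abelian one has number `1`, the non-abelian one has number `2`. -/
def IsStepOneDescendant (i : ℕ) (P D : Type) [Group P] [Group D] : Prop :=
  IsImmediateDescendant 3 1 P D ∧
    ((i = 1 ∧ ∀ a b : D, a * b = b * a) ∨ (i = 2 ∧ ¬ ∀ a b : D, a * b = b * a))

/-- `D ≃ SmallGroup(27,2)(-#1;1)^n`. -/
def IsTrunkVertex : ℕ → (D : Type) → [Group D] → Prop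
  | 0, D, _ => Nonempty (D ≃* SmallGroup27_2)
  | n + 1, D, _ => ∃ (Q : Type) (_ : Group Q), IsTrunkVertex n Q ∧ IsStepOneDescendant 1 Q D

/-- `D ≃ SmallGroup(27,2)(-#1;1)^n -#1;2`. -/
def IsTwigVertex (n : ℕ) (D : Type) [Group D] : Prop :=
  ∃ (Q : Type) (_ : Group Q), IsTrunkVertex n Q ∧ IsStepOneDescendant 2 Q D

/-! ### Metabelian groups, Schur groups, `σ`-groups -/

/-- `G'' = 1`. -/
def IsMetabelian (G : Type) [Group G] : Prop := derivedSeries G 2 = ⊥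

/-- A Schur group (for finite `p`-groups): the generator rank `d(G)` coincides with the relation
rank `r(G)`.  Here `r(G) = dim H²(G, 𝔽_p)` is the rank of the `p`-multiplicator `R / R^p [R, F]`,
where `1 → R → F → G → 1` with `F` free on `d(G)` generators. -/
def IsSchurGroup (p : ℕ) (G : Type) [Group G] [Finite G] : Prop :=
  ∃ φ : FreeGroup (Fin (Group.rank G)) →* G, Function.Surjective φ ∧
    (pStep p φ.ker).relIndex φ.ker = p ^ Group.rank G

/-- `G` has a generator-inverting automorphism, that is, an automorphism which
induces the inversion on `G / G'`. -/
def IsSigmaGroup (G : Type) [Group G] : Prop :=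
  ∃ σ : G ≃* G, ∀ g : G, σ g * g ∈ commutator G

/-! ### Artin transfers to the four maximal subgroups -/

/-- The commutator quotient `G / G'` is of type `(3^e, 3)`. -/
def HasAbelianization (e : ℕ) (G : Type) [Group G] : Prop :=
  Nonempty (Abelianization G ≃* AbType e 1)

/-- `x, y` is a marking of `G`: `G / G' = ⟨xG'⟩ × ⟨yG'⟩` with `xG'` of order `3^e`
and `yG'` of order `3`. -/
def IsMarking {G : Type} [Group G] (e : ℕ) (x y : G) : Prop :=
  HasAbelianization e G ∧ x ^ 3 ^ e ∈ commutator G ∧ y ^ 3 ∈ commutator G ∧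
    Subgroup.closure {x, y} ⊔ commutator G = ⊤

/-- The four maximal subgroups `⟨x, G'⟩`, `⟨xy, G'⟩`, `⟨xy², G'⟩` and (the distinguished one)
`⟨x³, y, G'⟩`. -/
def maxSub {G : Type} [Group G] (x y : G) : Fin 4 → Subgroup G :=
  ![Subgroup.closure {x} ⊔ commutator G,
    Subgroup.closure {x * y} ⊔ commutator G,
    Subgroup.closure {x * y ^ 2} ⊔ commutator G,
    Subgroup.closure {x ^ 3, y} ⊔ commutator G]

/-- The possible transfer kernels, as subgroups of `G` containing `G'`.  Label `0` is the full
`3`-torsion `⟨x^{3^{e-1}}, y, G'⟩` of `G / G'`; the labels `1, 2, 3, 4` are its four subgroups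
of order `3`, where `4` is the distinguished one `⟨x^{3^{e-1}}, G'⟩`. -/
def kernelSub {G : Type} [Group G] (e : ℕ) (x y : G) : Fin 5 → Subgroup G :=
  ![Subgroup.closure {x ^ 3 ^ (e - 1), y} ⊔ commutator G,
    Subgroup.closure {y} ⊔ commutator G,
    Subgroup.closure {x ^ 3 ^ (e - 1) * y} ⊔ commutator G,
    Subgroup.closure {x ^ 3 ^ (e - 1) * y ^ 2} ⊔ commutator G,
    Subgroup.closure {x ^ 3 ^ (e - 1)} ⊔ commutator G]

/-- The Artin transfer `G → H / H'`. -/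
noncomputable def artinTransfer {G : Type} [Group G] [Finite G] (H : Subgroup G) :
    G →* Abelianization H :=
  MonoidHom.transfer (Abelianization.of : H →* Abelianization H)

/-- `G` has punctured transfer kernel type `ϰ(G) ∼ (κ₁ κ₂ κ₃; κ₄)`. -/
def HasPTKT (e : ℕ) (κ : Fin 4 → Fin 5) (G : Type) [Group G] [Finite G] : Prop :=
  ∃ x y : G, IsMarking e x y ∧
    ∀ i, (artinTransfer (maxSub x y i)).ker = kernelSub e x y (κ i)

/-- `G` has first abelian quotient invariants `α₁(G) ∼ (τ₁, τ₂, τ₃; τ₄)`, in logarithmic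
notation, where `(a, 0)` stands for the cyclic type `(a)`. -/
def HasAQI (e : ℕ) (τ : Fin 4 → ℕ × ℕ) (G : Type) [Group G] : Prop :=
  ∃ x y : G, IsMarking e x y ∧
    ∀ i, Nonempty (Abelianization (maxSub x y i) ≃* AbType (τ i).1 (τ i).2)

/-!
Write `z = x^(3^e)` and let `M(e, k)` be the group of order `3^(e+2)` with generators `x`, `y` and
relations `x^(3^(e+1)) = y^3 = 1`, `y x y⁻¹ = x^(1 + 3^e k)`. A pair of generators of this kind is a
`StandardPair`, and it determines the group. For `k = 0` the group is `C_{3^(e+1)} × C_3`, for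
`k = 1` it is the modular group `G_e`; it is a semidirect product (`StandardPair.exists_modular`).
In both groups `D'` is central of exponent three, so cubing is an endomorphism, and the maximal
subgroups are abelian. Therefore every transfer to a maximal subgroup is `g ↦ g^3`
(`mem_ker_artinTransfer_iff`), which gives the transfer kernels `⟨z, y⟩`; for `k = 1` this is
`⟨y, D'⟩`. An automorphism inverting `G / G'` would fix `[y, x] = z` and invert `x^(3^e) = z`.

*Descendants.* In an immediate descendant of `C_{3^e} × C_3` the last term `N` of the lower exponent
series is central of exponent three and contains `D'` and `y^3`. It consists of `3^e`-th powers, so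
`N = ⟨z⟩` has order three, and after a change of `y` the group is `M(e, 0)` or `M(e, 1)`
(`exists_standardPair`). In a descendant of `M(e, 1)` the relations hold up to central factors of
exponent three. Conjugation by `y^3` is then both trivial on `x` and the third iterate of
`x ↦ x^(1+3^e) w`, so that the order of `x` divides `3^(e+1)` and `N` is trivial
(`pStep_commutator_of_conj_eq`, `StandardPair.not_isImmediateDescendant`).

*`G_e` is a Schur group.* Let `F` be free on `x`, `y` and `R` the kernel of `F → G_e`. Modulo
`R^3 [R, F]` and the two relators `y^3` and `x^(-1-3^e) y x y⁻¹`, the computation just mentioned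
bounds the order by that of `G_e`, so these relators generate `R / R^3 [R, F]`. They are
independent, since they remain so in `C_{3^(e+1)} × C_9` (`StandardPair.exists_presentation`).

*Uniqueness.* Let `D` be a Schur group all of whose transfer kernels are `⟨y, D'⟩`, and put
`N = D'^3 [D', D]` and `K = N^3 [N, D]`, so that `D' / N` is generated by `c = [x, y]`. The first
transfer kernel gives `y^3 ∈ N`. If `z ∉ N`, then `c` is a power of `z` modulo `N`; the computation
above, done in `D / K`, shows `N = K`, so `N` is trivial and `D` is modular
(`IsMarking.exists_standardPair`). Suppose `z ∈ N`. Then there is room for too many relations: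
the subgroup of `(C_{3^(e+1)} × C_9 × UT_4(𝔽_3)^2) × D` generated by suitable pairs `(X, x)`, `(Y, y)`
is an extension of `D` by non-generators. The image of the preimage of `N` in the first factor is
elementary abelian of order `81`, while relation rank two leaves at most `9` for the image of the
kernel. Hence `N / K` has order at least `9` (`IsSchurGroup.nine_dvd_relIndex`). On the other hand,
in `D / K` the subgroup `N` is generated by `[x, c]` and `[y, c]`, and the kernels of three of the
transfers produce a relation between these two elements, so that `N / K` has order at most three
(`card_pStep_commutator_le_three`).
-/

open scoped commutatorElement

/-! ### The operator `K ↦ K^p [K, G]` and the lower exponent-`p` central series -/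

section PStep

variable {G H : Type*} [Group G] [Group H] {p : ℕ}

theorem pStep_le_iff {K M : Subgroup G} :
    pStep p K ≤ M ↔ (∀ k ∈ K, ∀ g, ⁅k, g⁆ ∈ M) ∧ ∀ k ∈ K, k ^ p ∈ M := by
  rw [pStep, sup_le_iff, Subgroup.commutator_le, Subgroup.closure_le]
  constructor
  · rintro ⟨h1, h2⟩
    exact ⟨fun k hk g => h1 k hk g (Subgroup.mem_top g), fun k hk => h2 ⟨k, hk, rfl⟩⟩
  · rintro ⟨h1, h2⟩
    refine ⟨fun k hk g _ => h1 k hk g, ?_⟩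
    rintro _ ⟨k, hk, rfl⟩
    exact h2 k hk

theorem commutatorElement_mem_pStep {K : Subgroup G} {k : G} (hk : k ∈ K) (g : G) :
    ⁅k, g⁆ ∈ pStep p K := (pStep_le_iff.1 le_rfl).1 k hk g

theorem pow_mem_pStep {K : Subgroup G} {k : G} (hk : k ∈ K) : k ^ p ∈ pStep p K :=
  (pStep_le_iff.1 le_rfl).2 k hk

theorem pStep_mono {K L : Subgroup G} (h : K ≤ L) : pStep p K ≤ pStep p L :=
  pStep_le_iff.2 ⟨fun _ hk g => commutatorElement_mem_pStep (h hk) g,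
    fun _ hk => pow_mem_pStep (h hk)⟩

theorem pStep_eq_bot_iff {K : Subgroup G} :
    pStep p K = ⊥ ↔ K ≤ Subgroup.center G ∧ ∀ k ∈ K, k ^ p = 1 := by
  rw [eq_bot_iff, pStep_le_iff]
  simp only [Subgroup.mem_bot, commutatorElement_eq_one_iff_mul_comm]
  refine and_congr_left fun _ => ⟨fun h k hk => Subgroup.mem_center_iff.2 fun g => (h k hk g).symm,
    fun h k hk g => (Subgroup.mem_center_iff.1 (h hk) g).symm⟩

theorem map_pStep_le (f : G →* H) (K : Subgroup G) :
    (pStep p K).map f ≤ pStep p (K.map f) := by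
  rw [Subgroup.map_le_iff_le_comap, pStep_le_iff]
  refine ⟨fun k hk g => ?_, fun k hk => ?_⟩
  · rw [Subgroup.mem_comap, map_commutatorElement]
    exact commutatorElement_mem_pStep (Subgroup.mem_map_of_mem f hk) _
  · rw [Subgroup.mem_comap, map_pow]
    exact pow_mem_pStep (Subgroup.mem_map_of_mem f hk)

theorem map_pStep {f : G →* H} (hf : Function.Surjective f) (K : Subgroup G) :
    (pStep p K).map f = pStep p (K.map f) := by
  refine le_antisymm (map_pStep_le f K) (pStep_le_iff.2 ⟨?_, ?_⟩)
  · rintro _ ⟨k, hk, rfl⟩ g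
    obtain ⟨g, rfl⟩ := hf g
    rw [← map_commutatorElement]
    exact Subgroup.mem_map_of_mem f (commutatorElement_mem_pStep hk g)
  · rintro _ ⟨k, hk, rfl⟩
    rw [← map_pow]
    exact Subgroup.mem_map_of_mem f (pow_mem_pStep hk)

theorem pStep_le_self {K : Subgroup G} (hK : K.Normal) : pStep p K ≤ K :=
  pStep_le_iff.2 ⟨fun k hk g => by
    rw [commutatorElement_def, mul_assoc, mul_assoc]
    exact K.mul_mem hk (by simpa [mul_assoc] using hK.conj_mem _ (K.inv_mem hk) g),
    fun k hk => K.pow_mem hk p⟩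

theorem pStep_normal {K : Subgroup G} (hK : K.Normal) : (pStep p K).Normal := by
  refine ⟨fun n hn g => ?_⟩
  have h1 : (pStep p K).map (MulAut.conj g).toMonoidHom ≤ pStep p K := by
    refine (map_pStep_le _ _).trans (pStep_mono ?_)
    rintro _ ⟨k, hk, rfl⟩
    exact hK.conj_mem k hk g
  exact h1 ⟨n, hn, rfl⟩

theorem lowerPCentral_normal (n : ℕ) : (lowerPCentral p G n).Normal := by
  induction n with
  | zero => exact inferInstanceAs (⊤ : Subgroup G).Normal
  | succ n ih => exact pStep_normal ih

theorem lowerPCentral_antitone : Antitone (lowerPCentral p G) :=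
  antitone_nat_of_succ_le fun n => pStep_le_self (lowerPCentral_normal n)

theorem map_lowerPCentral {f : G →* H} (hf : Function.Surjective f) (n : ℕ) :
    (lowerPCentral p G n).map f = lowerPCentral p H n := by
  induction n with
  | zero => exact Subgroup.map_top_of_surjective f hf
  | succ n ih => rw [lowerPCentral, lowerPCentral, map_pStep hf, ih]

theorem pow_mem_lowerPCentral (g : G) (n : ℕ) : g ^ p ^ n ∈ lowerPCentral p G n := by
  induction n with
  | zero => exact Subgroup.mem_top _
  | succ n ih => rw [pow_succ, pow_mul]; exact pow_mem_pStep ih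

/-- The last non-trivial term `P_c(D)` of the lower exponent-`p` central series of an immediate
descendant `D` of `P` has index `c` equal to the first index `m` at which the series of `P`
vanishes. -/
theorem lowerPCentral_last_index {f : G →* H} (hf : Function.Surjective f) {c m : ℕ}
    (hc : lowerPCentral p G c ≠ ⊥) (hc1 : lowerPCentral p G (c + 1) = ⊥)
    (hk : f.ker = lowerPCentral p G c) (hm : lowerPCentral p H (m + 1) = ⊥)
    (hm1 : lowerPCentral p H m ≠ ⊥) : c = m + 1 := by
  apply le_antisymm
  · by_contra! hlt
    have h1 : lowerPCentral p G (m + 1) ≤ lowerPCentral p G c := by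
      rw [← hk, ← Subgroup.map_eq_bot_iff, map_lowerPCentral hf, hm]
    -- the series would become stationary before reaching its last non-trivial term
    have h2 : ∀ j, lowerPCentral p G (m + 1 + j) ≤ lowerPCentral p G (m + 1 + j + 1) := by
      intro j
      induction j with
      | zero => exact h1.trans (lowerPCentral_antitone hlt)
      | succ j ih => exact pStep_mono ih
    have h3 := h2 (c - (m + 1))
    rw [show m + 1 + (c - (m + 1)) = c by omega, hc1] at h3
    exact hc (le_bot_iff.1 h3)
  · by_contra! hlt
    apply hm1
    rw [eq_bot_iff, ← map_lowerPCentral hf]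
    refine (Subgroup.map_mono (lowerPCentral_antitone (show c ≤ m by omega))).trans ?_
    rw [← hk, le_bot_iff, Subgroup.map_eq_bot_iff]

end PStep

/-! ### Finite `p`-groups and generators -/

section PGroups

variable {G : Type*} [Group G] {p : ℕ}

/-- In a finite `p`-group, `G^p [G, G]` consists of non-generators. -/
theorem eq_top_of_sup_pStep_top [Fact p.Prime] [Finite G] (hG : IsPGroup p G) {L : Subgroup G}
    (hL : L ⊔ pStep p (⊤ : Subgroup G) = ⊤) : L = ⊤ := by
  apply frattini_nongenerating
  rw [eq_top_iff, ← hL]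
  refine sup_le_sup_left ?_ L
  simp only [frattini, Order.radical, le_iInf_iff]
  intro M (hM : IsCoatom M)
  have : Group.IsNilpotent G := hG.isNilpotent
  have hn : M.Normal := Subgroup.NormalizerCondition.normal_of_coatom M
    Group.normalizerCondition_of_isNilpotent hM
  have hnt : Nontrivial (G ⧸ M) := (QuotientGroup.nontrivial_iff).2 hM.1
  have hp : p ∣ Nat.card (G ⧸ M) := by
    obtain ⟨n, hn⟩ := IsPGroup.iff_card.1 (hG.to_quotient M)
    have h1 := Finite.one_lt_card (α := G ⧸ M)
    rw [hn] at h1 ⊢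
    exact dvd_pow_self p (by rintro rfl; simp at h1)
  obtain ⟨z, hz⟩ := exists_prime_orderOf_dvd_card' p hp
  have hz1 : z ≠ 1 := by
    rintro rfl
    exact (Fact.out : p.Prime).one_lt.ne (by simpa using hz)
  -- by maximality of `M`, the element `z` of order `p` generates `G / M`
  have htop : (Subgroup.zpowers z).comap (QuotientGroup.mk' M) = ⊤ := by
    apply hM.2
    refine lt_of_le_of_ne (fun m hm => ?_) fun h => ?_
    · rw [Subgroup.mem_comap, QuotientGroup.mk'_apply, (QuotientGroup.eq_one_iff m).2 hm]
      exact one_mem _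
    · obtain ⟨g, rfl⟩ := QuotientGroup.mk'_surjective M z
      have : g ∈ (Subgroup.zpowers (QuotientGroup.mk' M g)).comap (QuotientGroup.mk' M) :=
        Subgroup.mem_zpowers _
      rw [← h] at this
      exact hz1 ((QuotientGroup.eq_one_iff g).2 this)
  have hall : ∀ g : G, ∃ i : ℤ, z ^ i = (g : G ⧸ M) := fun g => by
    have : g ∈ (Subgroup.zpowers z).comap (QuotientGroup.mk' M) := htop ▸ Subgroup.mem_top g
    exact Subgroup.mem_zpowers_iff.1 this
  refine pStep_le_iff.2 ⟨fun k _ g => ?_, fun k _ => ?_⟩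
  · rw [← QuotientGroup.eq_one_iff, ← QuotientGroup.mk'_apply, map_commutatorElement,
      commutatorElement_eq_one_iff_mul_comm]
    obtain ⟨i, hi⟩ := hall k
    obtain ⟨j, hj⟩ := hall g
    rw [QuotientGroup.mk'_apply, QuotientGroup.mk'_apply, ← hi, ← hj, ← zpow_add, ← zpow_add,
      add_comm]
  · obtain ⟨i, hi⟩ := hall k
    rw [← QuotientGroup.eq_one_iff, QuotientGroup.mk_pow, ← hi, ← zpow_natCast, ← zpow_mul,
      mul_comm, zpow_mul, zpow_natCast, ← hz, pow_orderOf_eq_one, one_zpow]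

/-- In a finite `p`-group, `K^p [K, G]` is a proper subgroup of `K` unless `K` is trivial. -/
theorem eq_bot_of_le_pStep [Fact p.Prime] [Finite G] (hG : IsPGroup p G) {K : Subgroup G}
    (hK : K ≤ pStep p K) : K = ⊥ := by
  induction h : Nat.card G using Nat.strong_induction_on generalizing G with
  | _ n ih =>
  rcases subsingleton_or_nontrivial G with hs | hnt
  · exact Subsingleton.elim _ _
  have hZ := hG.center_nontrivial
  have hlt : Nat.card (G ⧸ Subgroup.center G) < n := by
    rw [← h, Subgroup.card_eq_card_quotient_mul_card_subgroup (Subgroup.center G)]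
    exact lt_mul_of_one_lt_right Nat.card_pos Finite.one_lt_card
  -- by induction `K` is central
  have hbot : K.map (QuotientGroup.mk' (Subgroup.center G)) = ⊥ := by
    refine ih _ hlt (hG.to_quotient _) ?_ rfl
    rw [← map_pStep (QuotientGroup.mk'_surjective _)]
    exact Subgroup.map_mono hK
  rw [Subgroup.map_eq_bot_iff, QuotientGroup.ker_mk'] at hbot
  -- so `K` consists of `p`-th powers of its own elements, hence of `p^m`-th powers for all `m`
  have hstep : ∀ k ∈ K, ∃ l ∈ K, l ^ p = k := by
    intro k hk
    have hle : pStep p K ≤ Subgroup.closure {g | ∃ k ∈ K, g = k ^ p} := by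
      refine pStep_le_iff.2 ⟨fun k hk g => ?_, fun k hk => Subgroup.subset_closure ⟨k, hk, rfl⟩⟩
      rw [commutatorElement_eq_one_iff_mul_comm.2 (Subgroup.mem_center_iff.1 (hbot hk) g).symm]
      exact one_mem _
    have := hle (hK hk)
    induction this using Subgroup.closure_induction with
    | mem x hx => obtain ⟨l, hl, rfl⟩ := hx; exact ⟨l, hl, rfl⟩
    | one => exact ⟨1, one_mem _, one_pow _⟩
    | mul x y hx hy ihx ihy =>
      have hKn : Subgroup.closure {g | ∃ k ∈ K, g = k ^ p} ≤ K := by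
        rw [Subgroup.closure_le]
        rintro _ ⟨l, hl, rfl⟩
        exact K.pow_mem hl p
      obtain ⟨a, ha, rfl⟩ := ihx (hKn hx)
      obtain ⟨b, hb, rfl⟩ := ihy (hKn hy)
      exact ⟨a * b, K.mul_mem ha hb,
        Commute.mul_pow (Subgroup.mem_center_iff.1 (hbot hb) a) p⟩
    | inv x hx ihx =>
      obtain ⟨a, ha, h⟩ := ihx (by simpa using K.inv_mem hk)
      exact ⟨a⁻¹, K.inv_mem ha, by rw [inv_pow, h]⟩
  have hpow : ∀ m : ℕ, ∀ k ∈ K, ∃ l ∈ K, l ^ p ^ m = k := by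
    intro m
    induction m with
    | zero => exact fun k hk => ⟨k, hk, by simp⟩
    | succ m ihm =>
      intro k hk
      obtain ⟨l, hl, rfl⟩ := hstep k hk
      obtain ⟨j, hj, rfl⟩ := ihm l hl
      exact ⟨j, hj, by rw [pow_succ, pow_mul]⟩
  obtain ⟨m, hm⟩ := IsPGroup.iff_card.1 hG
  rw [eq_bot_iff]
  intro k hk
  obtain ⟨l, _, rfl⟩ := hpow m k hk
  rw [Subgroup.mem_bot, ← hm, pow_card_eq_one']

/-- If the generators in `S` commute modulo the normal subgroup `M`, so do all elements of the
subgroup generated by `S`. -/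
theorem commutator_closure_le {S : Set G} {M : Subgroup G} (hM : M.Normal)
    (h : ∀ s ∈ S, ∀ t ∈ S, ⁅s, t⁆ ∈ M) :
    ⁅Subgroup.closure S, Subgroup.closure S⁆ ≤ M := by
  have key : ∀ a b : G, ⁅a, b⁆ ∈ M ↔ Commute (a : G ⧸ M) (b : G ⧸ M) := fun a b => by
    rw [← QuotientGroup.eq_one_iff, ← QuotientGroup.mk'_apply, map_commutatorElement,
      commutatorElement_eq_one_iff_commute]
    rfl
  have h1 : ∀ s ∈ S, ∀ b ∈ Subgroup.closure S, Commute (s : G ⧸ M) (b : G ⧸ M) := by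
    intro s hs b hb
    induction hb using Subgroup.closure_induction with
    | mem t ht => exact (key s t).1 (h s hs t ht)
    | one => exact Commute.one_right _
    | mul a b _ _ ha hb => exact ha.mul_right hb
    | inv a _ ha => exact ha.inv_right
  rw [Subgroup.commutator_le]
  intro a ha b hb
  rw [key]
  induction ha using Subgroup.closure_induction with
  | mem t ht => exact h1 t ht b hb
  | one => exact Commute.one_left _
  | mul a b _ _ ha hb => exact ha.mul_left hb
  | inv a _ ha => exact ha.inv_left

theorem commutator_le_of_closure_pair {x y : G} (hgen : Subgroup.closure {x, y} = ⊤)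
    {M : Subgroup G} (hM : M.Normal) (h : ⁅x, y⁆ ∈ M) : commutator G ≤ M := by
  rw [commutator_def, ← hgen]
  apply commutator_closure_le hM
  rintro s (rfl | rfl) t (rfl | rfl)
  · simp
  · exact h
  · rw [← commutatorElement_inv]; exact M.inv_mem h
  · simp

/-- A two-generator group satisfies `G' = ⟨[x, y]⟩ (G')^p [G', G]`. -/
theorem commutator_le_zpowers_sup_pStep {x y : G} (hgen : Subgroup.closure {x, y} = ⊤) :
    commutator G ≤ Subgroup.zpowers ⁅x, y⁆ ⊔ pStep p (commutator G) := by
  refine commutator_le_of_closure_pair hgen ?_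
    (Subgroup.mem_sup_left (Subgroup.mem_zpowers _))
  rw [← Subgroup.commutator_top_right_le_iff, Subgroup.commutator_le]
  intro k hk g _
  refine Subgroup.mem_sup_right (commutatorElement_mem_pStep ?_ g)
  have : Subgroup.zpowers ⁅x, y⁆ ⊔ pStep p (commutator G) ≤ commutator G := by
    refine sup_le ?_ (pStep_le_self inferInstance)
    rw [Subgroup.zpowers_le]
    exact Subgroup.commutator_mem_commutator (Subgroup.mem_top _) (Subgroup.mem_top _)
  exact this hk

/-- An integral power of an element of finite order as a natural power with small exponent. -/
theorem exists_pow_eq_zpow {x : G} {A : ℕ} (hA : 0 < A) (hx : x ^ A = 1) (i : ℤ) :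
    ∃ m < A, x ^ m = x ^ i := by
  have h0 : 0 ≤ i % A := Int.emod_nonneg _ (by omega)
  refine ⟨(i % A).toNat, ?_, ?_⟩
  · have := Int.emod_lt_of_pos i (show (0 : ℤ) < A by omega)
    omega
  · rw [← zpow_natCast, Int.toNat_of_nonneg h0]
    conv_rhs => rw [← Int.emod_add_mul_ediv i A, zpow_add, zpow_mul, zpow_natCast, hx, one_zpow,
      mul_one]

/-- Normal form in a group generated by `x` and `y` in which `⟨x⟩` is normal. -/
theorem exists_pow_mul_pow {x y : G} (hgen : Subgroup.closure {x, y} = ⊤)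
    (hxy : y * x * y⁻¹ ∈ Subgroup.zpowers x) {A B : ℕ} (hA : 0 < A) (hB : 0 < B)
    (hx : x ^ A = 1) (hy : y ^ B = 1) (g : G) : ∃ i < A, ∃ j < B, g = x ^ i * y ^ j := by
  have hconj : ∀ n : ℕ, ∀ h ∈ Subgroup.zpowers x, y ^ n * h * (y ^ n)⁻¹ ∈ Subgroup.zpowers x := by
    intro n
    induction n with
    | zero => intro h hh; simpa using hh
    | succ n ih =>
      intro h hh
      obtain ⟨k, hk⟩ := Subgroup.mem_zpowers_iff.1 (ih h hh)
      rw [pow_succ', mul_inv_rev, show y * y ^ n * h * ((y ^ n)⁻¹ * y⁻¹)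
        = y * (y ^ n * h * (y ^ n)⁻¹) * y⁻¹ by group, ← hk, ← conj_zpow]
      exact Subgroup.zpow_mem _ hxy k
  have hinv : y⁻¹ = y ^ (B - 1) := by
    rw [inv_eq_iff_mul_eq_one, ← pow_succ', Nat.sub_add_cancel hB, hy]
  have hN : (Subgroup.zpowers x).Normal := by
    rw [← Subgroup.normalizer_eq_top_iff, eq_top_iff, ← hgen, Subgroup.closure_le]
    rintro s (rfl | rfl)
    · exact Subgroup.le_normalizer (Subgroup.mem_zpowers _)
    · rw [SetLike.mem_coe, Subgroup.mem_normalizer_iff]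
      refine fun h => ⟨fun hh => by simpa using hconj 1 h hh, fun hh => ?_⟩
      have := hconj (B - 1) _ hh
      rw [← hinv] at this
      simpa [mul_assoc] using this
  have hg : g ∈ Subgroup.zpowers x ⊔ Subgroup.zpowers y := by
    have : Subgroup.closure {x, y} ≤ Subgroup.zpowers x ⊔ Subgroup.zpowers y := by
      rw [Subgroup.closure_le]
      rintro s (rfl | rfl)
      · exact Subgroup.mem_sup_left (Subgroup.mem_zpowers _)
      · exact Subgroup.mem_sup_right (Subgroup.mem_zpowers _)
    exact this (hgen ▸ Subgroup.mem_top g)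
  obtain ⟨a, ha, b, hb, rfl⟩ := Subgroup.mem_sup_of_normal_left.1 hg
  obtain ⟨i, rfl⟩ := Subgroup.mem_zpowers_iff.1 ha
  obtain ⟨j, rfl⟩ := Subgroup.mem_zpowers_iff.1 hb
  obtain ⟨m, hm, hm'⟩ := exists_pow_eq_zpow hA hx i
  obtain ⟨n, hn, hn'⟩ := exists_pow_eq_zpow hB hy j
  exact ⟨m, hm, n, hn, by rw [hm', hn']⟩

theorem card_le_of_normal_zpowers {x y : G} (hgen : Subgroup.closure {x, y} = ⊤)
    (hxy : y * x * y⁻¹ ∈ Subgroup.zpowers x) {A B : ℕ} (hA : 0 < A) (hB : 0 < B)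
    (hx : x ^ A = 1) (hy : y ^ B = 1) : Finite G ∧ Nat.card G ≤ A * B := by
  let f : Fin A × Fin B → G := fun q => x ^ (q.1 : ℕ) * y ^ (q.2 : ℕ)
  have hf : Function.Surjective f := fun g => by
    obtain ⟨i, hi, j, hj, rfl⟩ := exists_pow_mul_pow hgen hxy hA hB hx hy g
    exact ⟨(⟨i, hi⟩, ⟨j, hj⟩), rfl⟩
  refine ⟨Finite.of_surjective f hf, ?_⟩
  simpa using Nat.card_le_card_of_surjective f hf

end PGroups

/-! ### Groups whose commutator subgroup is central of exponent three -/

section CentralCommutator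

variable {G : Type*} [Group G]

theorem commutatorElement_comm_and_pow_three (h : pStep 3 (commutator G) = ⊥) (a b : G) :
    (∀ g, ⁅a, b⁆ * g = g * ⁅a, b⁆) ∧ ⁅a, b⁆ ^ 3 = 1 := by
  have hm : ⁅a, b⁆ ∈ commutator G :=
    Subgroup.commutator_mem_commutator (Subgroup.mem_top _) (Subgroup.mem_top _)
  obtain ⟨h1, h2⟩ := pStep_eq_bot_iff.1 h
  exact ⟨fun g => (Subgroup.mem_center_iff.1 (h1 hm) g).symm, h2 _ hm⟩

theorem mul_pow_three (h : pStep 3 (commutator G) = ⊥) (a b : G) :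
    (a * b) ^ 3 = a ^ 3 * b ^ 3 := by
  obtain ⟨hz, hz3⟩ := commutatorElement_comm_and_pow_three h b a
  set z := ⁅b, a⁆ with hzdef
  have hba : b * a = a * (b * z) := by
    rw [← hz b, ← mul_assoc, ← hz a, hzdef]
    simp [commutatorElement_def, mul_assoc]
  have hba' : ∀ g, b * (a * g) = a * (b * (z * g)) := fun g => by
    rw [← mul_assoc, hba]; simp [mul_assoc]
  have e1 : (a * b) ^ 3 = a * (a * (a * (b * (b * (b * z ^ 3))))) := by
    have za : ∀ g, z * (a * g) = a * (z * g) := fun g => by rw [← mul_assoc, hz a, mul_assoc]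
    have zb : ∀ g, z * (b * g) = b * (z * g) := fun g => by rw [← mul_assoc, hz b, mul_assoc]
    simp only [pow_succ, pow_zero, one_mul, mul_assoc, hba', za, zb, hz b]
  rw [e1, hz3]
  simp [pow_succ, mul_assoc]

theorem mul_pow_three_pow (h : pStep 3 (commutator G) = ⊥) (a b : G) (n : ℕ) :
    (a * b) ^ 3 ^ n = a ^ 3 ^ n * b ^ 3 ^ n := by
  induction n with
  | zero => simp
  | succ n ih => rw [pow_succ, pow_mul, ih, mul_pow_three h, ← pow_mul, ← pow_mul]

/-- The endomorphism `g ↦ g^(3^n)`. -/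
def threePowHom (h : pStep 3 (commutator G) = ⊥) (n : ℕ) : G →* G where
  toFun g := g ^ 3 ^ n
  map_one' := one_pow _
  map_mul' a b := mul_pow_three_pow h a b n

theorem pow_three_comm (h : pStep 3 (commutator G) = ⊥) (a g : G) : a ^ 3 * g = g * a ^ 3 := by
  obtain ⟨hz, hz3⟩ := commutatorElement_comm_and_pow_three h g a
  have h1 : g * a * g⁻¹ = ⁅g, a⁆ * a := by simp [commutatorElement_def, mul_assoc]
  have h2 : g * a ^ 3 * g⁻¹ = a ^ 3 := by
    rw [← conj_pow, h1, Commute.mul_pow (hz a), hz3, one_mul]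
  rw [← mul_inv_eq_iff_eq_mul.1 h2]

/-- From the second step on, the lower exponent-`3` central series consists of powers, as cubes are
central and cubing kills the commutators. -/
theorem lowerPCentral_eq_range (h : pStep 3 (commutator G) = ⊥) (n : ℕ) :
    lowerPCentral 3 G (n + 2) = (threePowHom h (n + 2)).range := by
  apply le_antisymm
  · induction n with
    | zero =>
      have hle : pStep 3 (⊤ : Subgroup G) ≤
          Subgroup.center G ⊓ (threePowHom h 2).range.comap (threePowHom h 1) := by
        refine pStep_le_iff.2 ⟨fun k _ g => ⟨?_, ?_⟩, fun k _ => ⟨?_, k, ?_⟩⟩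
        · exact Subgroup.mem_center_iff.2 fun a =>
            ((commutatorElement_comm_and_pow_three h k g).1 a).symm
        · have : threePowHom h 1 ⁅k, g⁆ = 1 := by
            exact (commutatorElement_comm_and_pow_three h k g).2
          exact Subgroup.mem_comap.2 (this ▸ one_mem _)
        · exact Subgroup.mem_center_iff.2 fun a => (pow_three_comm h k a).symm
        · simp [threePowHom, ← pow_mul]
      refine pStep_le_iff.2 ⟨fun k hk g => ?_, fun k hk => ?_⟩
      · rw [commutatorElement_eq_one_iff_mul_comm.2
          (Subgroup.mem_center_iff.1 (hle hk).1 g).symm]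
        exact one_mem _
      · exact (hle hk).2
    | succ n ih =>
      refine pStep_le_iff.2 ⟨fun k hk g => ?_, fun k hk => ?_⟩
      · obtain ⟨a, rfl⟩ := ih hk
        have : (threePowHom h (n + 2)) a = (a ^ 3 ^ (n + 1)) ^ 3 := by
          simp [threePowHom, ← pow_mul, ← pow_succ]
        rw [this, commutatorElement_eq_one_iff_mul_comm.2 (pow_three_comm h _ g)]
        exact one_mem _
      · obtain ⟨a, rfl⟩ := ih hk
        exact ⟨a, by simp [threePowHom, ← pow_mul, ← pow_succ]⟩
  · rintro _ ⟨a, rfl⟩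
    exact pow_mem_lowerPCentral a _

theorem lowerPCentral_eq_closure (h : pStep 3 (commutator G) = ⊥) {x y : G}
    (hgen : Subgroup.closure {x, y} = ⊤) {n : ℕ} (hn : 2 ≤ n) :
    lowerPCentral 3 G n = Subgroup.closure {x ^ 3 ^ n, y ^ 3 ^ n} := by
  obtain ⟨m, rfl⟩ := Nat.exists_eq_add_of_le' hn
  rw [lowerPCentral_eq_range h, MonoidHom.range_eq_map, ← hgen, MonoidHom.map_closure,
    Set.image_pair]
  rfl

end CentralCommutator

/-! ### Groups of type `(3^a, 3^b)` -/

section AbType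

variable {A : Type*} [Group A] {a b : ℕ}

theorem card_abType (a b : ℕ) : Nat.card (AbType a b) = 3 ^ (a + b) := by
  rw [Nat.card_prod, Nat.card_congr Multiplicative.toAdd, Nat.card_congr Multiplicative.toAdd,
    Nat.card_zmod, Nat.card_zmod, pow_add]

/-- The homomorphism from `C_{3^a} × C_{3^b}` sending the two standard generators to the commuting
elements `u` and `v`. -/
def abHom (u v : A) (h : Commute u v) (hu : u ^ 3 ^ a = 1) (hv : v ^ 3 ^ b = 1) :
    AbType a b →* A where
  toFun q := u ^ q.1.toAdd.val * v ^ q.2.toAdd.val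
  map_one' := by simp
  map_mul' q r := by
    have key : ∀ {n : ℕ} (w : A), w ^ 3 ^ n = 1 → ∀ i j : ZMod (3 ^ n),
        w ^ (i + j).val = w ^ i.val * w ^ j.val := fun {n} w hw i j => by
      rw [ZMod.val_add, ← pow_add]
      conv_rhs => rw [← Nat.mod_add_div (i.val + j.val) (3 ^ n), pow_add, pow_mul, hw, one_pow,
        mul_one]
    rw [Prod.fst_mul, Prod.snd_mul, toAdd_mul, toAdd_mul, key u hu, key v hv]
    simp only [mul_assoc]
    congr 1
    rw [← mul_assoc, ← mul_assoc (v ^ _), (h.pow_pow _ _).eq]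

theorem abHom_apply (u v : A) (h : Commute u v) (hu : u ^ 3 ^ a = 1) (hv : v ^ 3 ^ b = 1)
    (i j : ℕ) : abHom u v h hu hv (Multiplicative.ofAdd (i : ZMod (3 ^ a)),
      Multiplicative.ofAdd (j : ZMod (3 ^ b))) = u ^ i * v ^ j := by
  have key : ∀ {n : ℕ} (w : A), w ^ 3 ^ n = 1 → ∀ i : ℕ, w ^ (i : ZMod (3 ^ n)).val = w ^ i :=
    fun {n} w hw i => by
      rw [ZMod.val_natCast]
      conv_rhs => rw [← Nat.mod_add_div i (3 ^ n), pow_add, pow_mul, hw, one_pow, mul_one]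
  simp only [abHom, MonoidHom.coe_mk, OneHom.coe_mk, toAdd_ofAdd, key u hu, key v hv]

theorem range_abHom (u v : A) (h : Commute u v) (hu : u ^ 3 ^ a = 1) (hv : v ^ 3 ^ b = 1) :
    (abHom u v h hu hv).range = Subgroup.closure {u, v} := by
  apply le_antisymm
  · rintro _ ⟨q, rfl⟩
    exact mul_mem (pow_mem (Subgroup.subset_closure (by simp)) _)
      (pow_mem (Subgroup.subset_closure (by simp)) _)
  · rw [Subgroup.closure_le]
    rintro s (rfl | rfl)
    · exact ⟨_, (abHom_apply s v h hu hv 1 0).trans (by simp)⟩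
    · exact ⟨_, (abHom_apply u s h hu hv 0 1).trans (by simp)⟩

theorem card_closure_pair_le (u v : A) (h : Commute u v) (hu : u ^ 3 ^ a = 1)
    (hv : v ^ 3 ^ b = 1) : Nat.card (Subgroup.closure {u, v}) ≤ 3 ^ (a + b) := by
  rw [← range_abHom u v h hu hv, ← card_abType a b]
  exact Nat.card_le_card_of_surjective _ (abHom u v h hu hv).rangeRestrict_surjective

theorem nonempty_mulEquiv_abType {u v : A} (h : Commute u v) (hu : u ^ 3 ^ a = 1)
    (hv : v ^ 3 ^ b = 1) {H : Subgroup A} (hH : H = Subgroup.closure {u, v})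
    (hc : Nat.card H = 3 ^ (a + b)) : Nonempty (H ≃* AbType a b) := by
  subst hH
  have hr := range_abHom u v h hu hv
  refine ⟨(MulEquiv.ofBijective ((MulEquiv.subgroupCongr hr).toMonoidHom.comp
    (abHom u v h hu hv).rangeRestrict) ?_).symm⟩
  rw [Nat.bijective_iff_surjective_and_card]
  exact ⟨(MulEquiv.subgroupCongr hr).surjective.comp
    (abHom u v h hu hv).rangeRestrict_surjective, by rw [hc, card_abType]⟩

/-- The first standard generator of `C_{3^a} × C_{3^b}`. -/
def abGenX (a b : ℕ) : AbType a b := (Multiplicative.ofAdd 1, 1)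

/-- The second standard generator of `C_{3^a} × C_{3^b}`. -/
def abGenY (a b : ℕ) : AbType a b := (1, Multiplicative.ofAdd 1)

theorem abHom_abGenX (u v : A) (h : Commute u v) (hu : u ^ 3 ^ a = 1) (hv : v ^ 3 ^ b = 1) :
    abHom u v h hu hv (abGenX a b) = u := by
  have := abHom_apply u v h hu hv 1 0
  simpa [abGenX] using this

theorem abHom_abGenY (u v : A) (h : Commute u v) (hu : u ^ 3 ^ a = 1) (hv : v ^ 3 ^ b = 1) :
    abHom u v h hu hv (abGenY a b) = v := by
  have := abHom_apply u v h hu hv 0 1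
  simpa [abGenY] using this

/-- An abelian group of the right order with generators `u`, `v` of the right exponents is
`C_{3^a} × C_{3^b}`, with `u` and `v` as its standard generators. -/
theorem exists_mulEquiv_abType {u v : A} (h : Commute u v) (hu : u ^ 3 ^ a = 1)
    (hv : v ^ 3 ^ b = 1) (hgen : Subgroup.closure {u, v} = ⊤) (hc : Nat.card A = 3 ^ (a + b)) :
    ∃ f : A ≃* AbType a b, f u = abGenX a b ∧ f v = abGenY a b := by
  have hb : Function.Bijective (abHom u v h hu hv) := by
    rw [Nat.bijective_iff_surjective_and_card]
    refine ⟨?_, by rw [hc, card_abType]⟩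
    rw [← MonoidHom.range_eq_top, range_abHom, hgen]
  refine ⟨(MulEquiv.ofBijective _ hb).symm, ?_, ?_⟩
  · rw [MulEquiv.symm_apply_eq, MulEquiv.ofBijective_apply, abHom_abGenX]
  · rw [MulEquiv.symm_apply_eq, MulEquiv.ofBijective_apply, abHom_abGenY]

end AbType

/-! ### Transfers to normal subgroups of index three -/

section Transfer

open Subgroup.leftTransversals

variable {G A : Type*} [Group G] [CommGroup A] {H : Subgroup G}

/-- The powers `1, t, t^2` of an element outside a normal subgroup of index three represent its
cosets. -/
theorem bijective_pow_of_index_three (hn : H.Normal) (hi : H.index = 3) {t : G} (ht : t ∉ H) :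
    Function.Bijective (fun i : Fin 3 => ((t ^ (i : ℕ) : G) : G ⧸ H)) := by
  have hcard : Nat.card (G ⧸ H) = 3 := hi
  have : Finite (G ⧸ H) := Nat.finite_of_card_ne_zero (by omega)
  have ho : orderOf (t : G ⧸ H) = 3 := by
    have : orderOf (t : G ⧸ H) ∣ 3 := hcard ▸ orderOf_dvd_natCard _
    rcases (Nat.dvd_prime Nat.prime_three).1 this with h | h
    · rw [orderOf_eq_one_iff, QuotientGroup.eq_one_iff] at h
      exact absurd h ht
    · exact h
  rw [Nat.bijective_iff_injective_and_card]
  refine ⟨fun i j hij => ?_, by simp [hcard]⟩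
  simp only [QuotientGroup.mk_pow] at hij
  exact Fin.ext (pow_injOn_Iio_orderOf (by simp [ho]) (by simp [ho]) hij)

theorem pow_three_mem_of_index_three (hn : H.Normal) (hi : H.index = 3) (g : G) : g ^ 3 ∈ H := by
  rw [← hi]; exact H.pow_index_mem g

/-- A normal subgroup of index three has the left transversal `{1, t, t^2}`. -/
theorem exists_leftTransversal (hn : H.Normal) (hi : H.index = 3) {t : G} (ht : t ∉ H) :
    ∃ T : H.LeftTransversal, ∀ i : Fin 3,
      (T.2.leftQuotientEquiv ((t ^ (i : ℕ) : G) : G ⧸ H) : G) = t ^ (i : ℕ) := by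
  let E := Equiv.ofBijective _ (bijective_pow_of_index_three hn hi ht)
  have hf : ∀ q : G ⧸ H, ((t ^ ((E.symm q : Fin 3) : ℕ) : G) : G ⧸ H) = q :=
    fun q => E.apply_symm_apply q
  refine ⟨⟨_, Subgroup.isComplement_range_left hf⟩, fun i => ?_⟩
  rw [Subgroup.IsComplement.leftQuotientEquiv_apply hf]
  congr 2
  exact E.symm_apply_apply i

variable [H.FiniteIndex] (φ : H →* A)

/-- An element of a normal subgroup of index three fixes all cosets, so that its transfer is the
product of its conjugates by a transversal. -/
theorem transfer_of_mem (hn : H.Normal) (hi : H.index = 3) {t g : G} (ht : t ∉ H) (hg : g ∈ H) :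
    MonoidHom.transfer φ g = φ ⟨g, hg⟩ * φ ⟨t⁻¹ * g * t, by simpa using hn.conj_mem g hg t⁻¹⟩ *
      φ ⟨(t ^ 2)⁻¹ * g * t ^ 2, by simpa using hn.conj_mem g hg (t ^ 2)⁻¹⟩ := by
  obtain ⟨T, hT⟩ := exists_leftTransversal hn hi ht
  let := H.fintypeQuotientOfFiniteIndex
  have hfix : ∀ q : G ⧸ H, g⁻¹ • q = q := fun q => by
    induction q using QuotientGroup.induction_on with
    | H a =>
      refine (QuotientGroup.eq (a := g⁻¹ * a)).2 ?_
      simpa [mul_assoc] using hn.conj_mem g hg a⁻¹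
  rw [MonoidHom.transfer_def φ T g, diff,
    ← (Equiv.ofBijective _ (bijective_pow_of_index_three hn hi ht)).prod_comp, Fin.prod_univ_three]
  have key : ∀ i : Fin 3, (((g • T).2.leftQuotientEquiv ((t ^ (i : ℕ) : G) : G ⧸ H)) : G)
      = g * t ^ (i : ℕ) := fun i => by
    rw [Subgroup.smul_apply_eq_smul_apply_inv_smul, hfix, hT, smul_eq_mul]
  simp only [Equiv.ofBijective_apply, key, hT]
  simp [mul_assoc]

/-- An element outside a normal subgroup of index three permutes the cosets cyclically. -/
theorem transfer_of_notMem (hn : H.Normal) (hi : H.index = 3) {g : G} (hg : g ∉ H) :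
    MonoidHom.transfer φ g = φ ⟨g ^ 3, pow_three_mem_of_index_three hn hi g⟩ := by
  obtain ⟨T, hT⟩ := exists_leftTransversal hn hi hg
  let := H.fintypeQuotientOfFiniteIndex
  rw [MonoidHom.transfer_def φ T g, diff,
    ← (Equiv.ofBijective _ (bijective_pow_of_index_three hn hi hg)).prod_comp,
    Fin.prod_univ_three]
  have hs : ∀ a : G, g⁻¹ • (a : G ⧸ H) = ((g⁻¹ * a : G) : G ⧸ H) := fun a => rfl
  have key : ∀ i j : Fin 3, ((g⁻¹ * g ^ (i : ℕ) : G) : G ⧸ H) = ((g ^ (j : ℕ) : G) : G ⧸ H) →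
      (((g • T).2.leftQuotientEquiv ((g ^ (i : ℕ) : G) : G ⧸ H)) : G) = g * g ^ (j : ℕ) :=
    fun i j hij => by
      rw [Subgroup.smul_apply_eq_smul_apply_inv_smul, hs, hij, hT, smul_eq_mul]
  have k0 := key 0 2 (by
    rw [QuotientGroup.eq]
    simpa [← pow_succ'] using pow_three_mem_of_index_three hn hi g)
  have k1 := key 1 0 (by simp)
  have k2 := key 2 1 (by simp [pow_two])
  simp only [Equiv.ofBijective_apply, k0, k1, k2, hT]
  simp only [Fin.val_zero, Fin.val_one, Fin.val_two, pow_zero, pow_one, mul_one, inv_one, one_mul,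
    inv_mul_cancel, ← pow_succ', ← pow_two]
  have h1 : φ ⟨1, one_mem H⟩ = 1 := map_one φ
  simp [h1]

end Transfer

/-! ### The abelian group of type `(3^(e+1), 3)` and its modular companion -/

/-- `x`, `y` is a pair of generators of `D` subject to the relations `x^(3^(e+1)) = y^3 = 1`,
`y x y⁻¹ = x^(1 + 3^e k)`, and `D` has the order `3^(e+2)` of the group so presented. For `k = 0`
this is the abelian group of type `(3^(e+1), 3)`; for `k = 1` it is the non-abelian group which
turns out to be the twig vertex `G_e`. -/
structure StandardPair (e k : ℕ) {D : Type*} [Group D] (x y : D) : Prop where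
  gen : Subgroup.closure {x, y} = ⊤
  pow_x : x ^ 3 ^ (e + 1) = 1
  pow_y : y ^ 3 = 1
  conj : y * x * y⁻¹ = x ^ (1 + 3 ^ e * k)
  card : Nat.card D = 3 ^ (e + 2)

/-- Generators of a subgroup, seen inside the subgroup. -/
theorem closure_pair_subtype {G : Type*} [Group G] {u v : G} {H : Subgroup G}
    (hH : H = Subgroup.closure {u, v}) (hu : u ∈ H) (hv : v ∈ H) :
    Subgroup.closure {(⟨u, hu⟩ : H), ⟨v, hv⟩} = ⊤ := by
  apply Subgroup.map_injective H.subtype_injective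
  rw [MonoidHom.map_closure, Set.image_pair, ← MonoidHom.range_eq_map, H.range_subtype]
  exact hH.symm

theorem surjective_of_closure_pair {G H : Type*} [Group G] [Group H] {a b : H}
    (hgen : Subgroup.closure {a, b} = ⊤) (f : G →* H) {u v : G} (hu : f u = a) (hv : f v = b) :
    Function.Surjective f := by
  rw [← MonoidHom.range_eq_top, eq_top_iff, ← hgen, Subgroup.closure_le]
  rintro s (rfl | rfl)
  exacts [⟨u, hu⟩, ⟨v, hv⟩]

theorem abGenX_pow (a b : ℕ) : abGenX a b ^ 3 ^ a = 1 := by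
  refine Prod.ext ?_ (one_pow _)
  show Multiplicative.ofAdd ((3 ^ a) • (1 : ZMod (3 ^ a))) = 1
  rw [nsmul_one, ZMod.natCast_self, ofAdd_zero]

theorem abGenY_pow (a b : ℕ) : abGenY a b ^ 3 ^ b = 1 := by
  refine Prod.ext (one_pow _) ?_
  show Multiplicative.ofAdd ((3 ^ b) • (1 : ZMod (3 ^ b))) = 1
  rw [nsmul_one, ZMod.natCast_self, ofAdd_zero]

theorem exists_eq_abGen_pow {a b : ℕ} (q : AbType a b) :
    ∃ i j : ℕ, q = abGenX a b ^ i * abGenY a b ^ j := by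
  obtain ⟨i, j⟩ := q
  obtain ⟨i, rfl⟩ := Multiplicative.ofAdd.surjective i
  obtain ⟨j, rfl⟩ := Multiplicative.ofAdd.surjective j
  obtain ⟨i, rfl⟩ := ZMod.natCast_zmod_surjective i
  obtain ⟨j, rfl⟩ := ZMod.natCast_zmod_surjective j
  refine ⟨i, j, Prod.ext ?_ ?_⟩
  · apply Multiplicative.toAdd.injective; simp [abGenX, abGenY]
  · apply Multiplicative.toAdd.injective; simp [abGenX, abGenY]

theorem closure_abGen (a b : ℕ) : Subgroup.closure {abGenX a b, abGenY a b} = ⊤ := by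
  rw [eq_top_iff]
  rintro q -
  obtain ⟨i, j, rfl⟩ := exists_eq_abGen_pow q
  exact mul_mem (pow_mem (Subgroup.subset_closure (by simp)) _)
    (pow_mem (Subgroup.subset_closure (by simp)) _)

namespace StandardPair

variable {D : Type*} [Group D] {e k : ℕ} {x y : D}

theorem finite (h : StandardPair e k x y) : Finite D :=
  Nat.finite_of_card_ne_zero (by rw [h.card]; positivity)

theorem commutator_eq (h : StandardPair e k x y) : ⁅y, x⁆ = (x ^ 3 ^ e) ^ k := by
  rw [commutatorElement_def, h.conj, ← pow_mul, pow_add, pow_one]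
  exact mul_inv_eq_iff_eq_mul.2 ((Commute.self_pow x _).eq)

theorem conj_mem (h : StandardPair e k x y) : y * x * y⁻¹ ∈ Subgroup.zpowers x := by
  rw [h.conj]; exact Subgroup.npow_mem_zpowers _ _

/-- A smaller order of `x` would make the group too small. -/
theorem orderOf_eq (h : StandardPair e k x y) : orderOf x = 3 ^ (e + 1) := by
  refine Nat.dvd_antisymm (orderOf_dvd_of_pow_eq_one h.pow_x) ?_
  have := h.finite
  obtain ⟨m, hm, hm'⟩ := (Nat.dvd_prime_pow Nat.prime_three).1 (orderOf_dvd_of_pow_eq_one h.pow_x)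
  have h1 := (card_le_of_normal_zpowers h.gen h.conj_mem (orderOf_pos x) (by norm_num)
    (pow_orderOf_eq_one x) h.pow_y).2
  rw [h.card, hm', ← pow_succ, Nat.pow_le_pow_iff_right (by norm_num)] at h1
  rw [hm']
  exact pow_dvd_pow 3 (by omega)

theorem pow_mem_center (h : StandardPair e k x y) (he : 1 ≤ e) :
    x ^ 3 ^ e ∈ Subgroup.center D := by
  have hy : y * x ^ 3 ^ e * y⁻¹ = x ^ 3 ^ e := by
    obtain ⟨d, rfl⟩ := Nat.exists_eq_add_of_le' he
    rw [← conj_pow, h.conj, ← pow_mul, add_mul, one_mul, pow_add,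
      show 3 ^ (d + 1) * k * 3 ^ (d + 1) = 3 ^ (d + 1 + 1) * (k * 3 ^ d) by ring, pow_mul, h.pow_x,
      one_pow, mul_one]
  have : Subgroup.closure {x, y} ≤ Subgroup.centralizer {x ^ 3 ^ e} := by
    rw [Subgroup.closure_le]
    rintro s (rfl | rfl)
    · exact Subgroup.mem_centralizer_singleton_iff.2 (Commute.self_pow s _).eq
    · exact Subgroup.mem_centralizer_singleton_iff.2 (mul_inv_eq_iff_eq_mul.1 hy)
  rw [h.gen] at this
  exact Subgroup.mem_center_iff.2 fun g =>
    Subgroup.mem_centralizer_singleton_iff.1 (this (Subgroup.mem_top g))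

theorem commutator_le (h : StandardPair e k x y) (he : 1 ≤ e) :
    commutator D ≤ Subgroup.zpowers ((x ^ 3 ^ e) ^ k) := by
  refine commutator_le_of_closure_pair h.gen ?_ ?_
  · rw [← Subgroup.commutator_top_right_le_iff, Subgroup.commutator_top_right_eq_bot_iff_le_center.2]
    · exact bot_le
    · rw [Subgroup.zpowers_le]
      exact pow_mem (h.pow_mem_center he) k
  · rw [← commutatorElement_inv, h.commutator_eq]
    exact inv_mem (Subgroup.mem_zpowers _)

theorem commutator_eq_zpowers (h : StandardPair e k x y) (he : 1 ≤ e) :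
    commutator D = Subgroup.zpowers ((x ^ 3 ^ e) ^ k) := by
  refine le_antisymm (h.commutator_le he) ?_
  rw [Subgroup.zpowers_le, ← h.commutator_eq]
  exact Subgroup.commutator_mem_commutator (Subgroup.mem_top _) (Subgroup.mem_top _)

theorem pow_pow_three (h : StandardPair e k x y) : (x ^ 3 ^ e) ^ 3 = 1 := by
  rw [← pow_mul, ← pow_succ, h.pow_x]

theorem commutator_le_zpowers (h : StandardPair e k x y) (he : 1 ≤ e) :
    commutator D ≤ Subgroup.zpowers (x ^ 3 ^ e) :=
  (h.commutator_le he).trans (Subgroup.zpowers_le.2 (Subgroup.npow_mem_zpowers _ _))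

theorem pStep_commutator (h : StandardPair e k x y) (he : 1 ≤ e) :
    pStep 3 (commutator D) = ⊥ := by
  refine pStep_eq_bot_iff.2 ⟨(h.commutator_le_zpowers he).trans
    (Subgroup.zpowers_le.2 (h.pow_mem_center he)), fun g hg => ?_⟩
  obtain ⟨i, rfl⟩ := Subgroup.mem_zpowers_iff.1 (h.commutator_le_zpowers he hg)
  rw [← zpow_natCast, ← zpow_mul, mul_comm, zpow_mul, zpow_natCast, h.pow_pow_three, one_zpow]

theorem map {E : Type*} [Group E] (h : StandardPair e k x y) (f : D ≃* E) :
    StandardPair e k (f x) (f y) where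
  gen := by
    have := congr_arg (Subgroup.map f.toMonoidHom) h.gen
    rwa [MonoidHom.map_closure, Set.image_pair, Subgroup.map_top_of_surjective _ f.surjective]
      at this
  pow_x := by rw [← map_pow, h.pow_x, map_one]
  pow_y := by rw [← map_pow, h.pow_y, map_one]
  conj := by rw [← map_mul, ← map_inv, ← map_mul, h.conj, map_pow]
  card := by rw [← Nat.card_congr f.toEquiv, h.card]

/-- The parameters `e` and `k` determine the group: the subgroup of the direct product generated
by the pairs of corresponding generators satisfies the same relations, hence is no larger than
either factor, onto which it projects. -/
theorem nonempty_mulEquiv {E : Type*} [Group E] {x' y' : E} (h : StandardPair e k x y)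
    (h' : StandardPair e k x' y') : Nonempty (D ≃* E) := by
  have := h.finite
  have := h'.finite
  let Γ : Subgroup (D × E) := Subgroup.closure {(x, x'), (y, y')}
  have hx : (x, x') ∈ Γ := Subgroup.subset_closure (by simp)
  have hy : (y, y') ∈ Γ := Subgroup.subset_closure (by simp)
  have hgen := closure_pair_subtype (H := Γ) rfl hx hy
  have hcard : Nat.card Γ ≤ 3 ^ (e + 2) := by
    have hc : (⟨(y, y'), hy⟩ : Γ) * ⟨(x, x'), hx⟩ * (⟨(y, y'), hy⟩ : Γ)⁻¹ =
        ⟨(x, x'), hx⟩ ^ (1 + 3 ^ e * k) :=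
      Subtype.ext (Prod.ext h.conj h'.conj)
    refine (card_le_of_normal_zpowers (A := 3 ^ (e + 1)) (B := 3) hgen
      (hc ▸ Subgroup.npow_mem_zpowers _ _) (by positivity) (by norm_num)
      (Subtype.ext (Prod.ext h.pow_x h'.pow_x))
      (Subtype.ext (Prod.ext h.pow_y h'.pow_y))).2.trans (le_of_eq (by ring))
  have s1 := surjective_of_closure_pair h.gen ((MonoidHom.fst D E).comp Γ.subtype)
    (u := ⟨_, hx⟩) (v := ⟨_, hy⟩) rfl rfl
  have s2 := surjective_of_closure_pair h'.gen ((MonoidHom.snd D E).comp Γ.subtype)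
    (u := ⟨_, hx⟩) (v := ⟨_, hy⟩) rfl rfl
  have b1 := (Nat.bijective_iff_surjective_and_card _).2 ⟨s1,
    le_antisymm (hcard.trans h.card.ge) (Nat.card_le_card_of_surjective _ s1)⟩
  have b2 := (Nat.bijective_iff_surjective_and_card _).2 ⟨s2,
    le_antisymm (hcard.trans h'.card.ge) (Nat.card_le_card_of_surjective _ s2)⟩
  exact ⟨(MulEquiv.ofBijective _ b1).symm.trans (MulEquiv.ofBijective _ b2)⟩

theorem abType (e : ℕ) : StandardPair e 0 (abGenX (e + 1) 1) (abGenY (e + 1) 1) where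
  gen := closure_abGen _ _
  pow_x := abGenX_pow _ _
  pow_y := abGenY_pow (e + 1) 1
  conj := by rw [mul_comm, inv_mul_cancel_left]; simp
  card := by rw [card_abType]

theorem nonempty_mulEquiv_abType_iff {E : Type*} [Group E] :
    Nonempty (E ≃* AbType (e + 1) 1) ↔ ∃ x y : E, StandardPair e 0 x y :=
  ⟨fun ⟨f⟩ => ⟨_, _, (abType e).map f.symm⟩, fun ⟨_, _, h⟩ => h.nonempty_mulEquiv (abType e)⟩

/-- The modular group exists, as the semidirect product of `C_{3^(e+1)}` by the automorphism
`a ↦ (1 + 3^e) a` of order three. -/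
theorem exists_modular (he : 1 ≤ e) : ∃ (G : Type) (_ : Group G) (x y : G),
    StandardPair e 1 x y := by
  obtain ⟨d, rfl⟩ := Nat.exists_eq_add_of_le' he
  let R := ZMod (3 ^ (d + 1 + 1))
  -- the automorphism is the multiplication by the unit `w = 1 + 3^e`, where `e = d + 1`
  have h0 : (3 : R) ^ (d + 2) = 0 := by exact_mod_cast ZMod.natCast_self (3 ^ (d + 1 + 1))
  have hw : (1 + 3 ^ (d + 1) : R) ^ 3 = 1 := by
    linear_combination (1 + 3 ^ (d + 1) + 3 ^ (2 * d + 1)) * h0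
  let w : Rˣ := Units.ofPowEqOne (1 + 3 ^ (d + 1)) 3 hw (by norm_num)
  have hw' : w ^ 3 = 1 := Units.ext hw
  let α : MulAut (Multiplicative R) := (MulAutMultiplicative R).symm (AddAut.mulLeft w)
  have hα : α ^ 3 ^ 1 = 1 := by rw [pow_one, ← map_pow, ← map_pow, hw', map_one, map_one]
  let φ : AbType 1 0 →* MulAut (Multiplicative R) := abHom α 1 (Commute.one_right _) hα (one_pow _)
  have hφ : φ (abGenX 1 0) = α := abHom_abGenX _ _ _ _ _
  have hy0 : abGenY 1 0 = 1 := by simpa using abGenY_pow 1 0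
  have hx1 : ∀ i : ℕ, (Multiplicative.ofAdd (i : R)) = Multiplicative.ofAdd (1 : R) ^ i :=
    fun i => by rw [← ofAdd_nsmul, nsmul_one]
  refine ⟨Multiplicative R ⋊[φ] AbType 1 0, inferInstance,
    SemidirectProduct.inl (Multiplicative.ofAdd 1), SemidirectProduct.inr (abGenX 1 0),
    ⟨?_, ?_, ?_, ?_, ?_⟩⟩
  · rw [eq_top_iff]
    rintro g -
    rw [← SemidirectProduct.inl_left_mul_inr_right g]
    refine mul_mem ?_ ?_
    · obtain ⟨i, hi⟩ := Multiplicative.ofAdd.surjective g.left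
      obtain ⟨i, rfl⟩ := ZMod.natCast_zmod_surjective i
      rw [← hi, hx1, map_pow]
      exact pow_mem (Subgroup.subset_closure (by simp)) _
    · obtain ⟨i, j, hij⟩ := exists_eq_abGen_pow g.right
      rw [hij, hy0, one_pow, mul_one, map_pow]
      exact pow_mem (Subgroup.subset_closure (by simp)) _
  · rw [← map_pow, ← hx1, ZMod.natCast_self, ofAdd_zero, map_one]
  · exact (map_pow _ _ 3).symm.trans ((congr_arg _ (abGenX_pow 1 0)).trans (map_one _))
  · rw [← map_inv, ← SemidirectProduct.inl_aut, hφ, ← map_pow, ← hx1]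
    congr 1
    apply Multiplicative.toAdd.injective
    show (w : R) * 1 = _
    simp [w]
  · rw [SemidirectProduct.card, card_abType, Nat.card_congr Multiplicative.toAdd, Nat.card_zmod]
    ring

end StandardPair

/-! ### Markings and the four maximal subgroups -/

section Marking

variable {D : Type} [Group D] {e : ℕ} {x y : D}

/-- A marking identifies `G / G'` with `C_{3^e} × C_3` in such a way that `x` and `y` go to the
standard generators. -/
theorem IsMarking.exists_hom (h : IsMarking e x y) : ∃ π : D →* AbType e 1,
    Function.Surjective π ∧ π.ker = commutator D ∧ π x = abGenX e 1 ∧ π y = abGenY e 1 := by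
  obtain ⟨⟨f⟩, hx, hy, hgen⟩ := h
  have hker : ∀ g : D, g ∈ commutator D → Abelianization.of g = 1 := fun g hg => by
    rw [← MonoidHom.mem_ker, Abelianization.ker_of]; exact hg
  have hs : Function.Surjective (Abelianization.of : D →* Abelianization D) :=
    QuotientGroup.mk_surjective
  obtain ⟨ψ, h1, h2⟩ := exists_mulEquiv_abType (A := Abelianization D) (a := e) (b := 1)
    (u := Abelianization.of x) (v := Abelianization.of y) (Commute.all _ _)
    (by rw [← map_pow]; exact hker _ hx) (by rw [← map_pow]; exact hker _ hy)
    (by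
      have := congr_arg (Subgroup.map Abelianization.of) hgen
      rw [Subgroup.map_sup, Subgroup.map_top_of_surjective _ hs, MonoidHom.map_closure,
        Set.image_pair, (Subgroup.map_eq_bot_iff (commutator D)).2 (Abelianization.ker_of D).ge,
        sup_bot_eq] at this
      exact this)
    (by rw [Nat.card_congr f.toEquiv, card_abType])
  refine ⟨ψ.toMonoidHom.comp Abelianization.of, ψ.surjective.comp hs, ?_, h1, h2⟩
  rw [← Abelianization.ker_of]
  ext g
  simp

theorem IsMarking.exists_eq_mul (h : IsMarking e x y) (g : D) :
    ∃ i j : ℕ, ∃ d ∈ commutator D, g = x ^ i * y ^ j * d := by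
  obtain ⟨π, -, hker, hx, hy⟩ := h.exists_hom
  obtain ⟨i, j, hij⟩ := exists_eq_abGen_pow (π g)
  refine ⟨i, j, (x ^ i * y ^ j)⁻¹ * g, ?_, by group⟩
  rw [← hker, MonoidHom.mem_ker, map_mul, map_inv, hij, map_mul, map_pow, map_pow, hx, hy]
  group

/-- The exponents of a word lying in `G'`. -/
theorem IsMarking.dvd_of_mem (h : IsMarking e x y) {i j : ℕ}
    (hm : x ^ i * y ^ j ∈ commutator D) : 3 ^ e ∣ i ∧ 3 ∣ j := by
  obtain ⟨π, -, hker, hx, hy⟩ := h.exists_hom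
  rw [← hker, MonoidHom.mem_ker, map_mul, map_pow, map_pow, hx, hy] at hm
  constructor
  · rw [← ZMod.natCast_eq_zero_iff]
    simpa [abGenX, abGenY] using congr_arg (fun q => q.1.toAdd) hm
  · have : ((j : ℕ) : ZMod (3 ^ 1)) = 0 := by
      simpa [abGenX, abGenY] using congr_arg (fun q => q.2.toAdd) hm
    simpa using (ZMod.natCast_eq_zero_iff j (3 ^ 1)).1 this

theorem isMarking_of_gen (hgen : Subgroup.closure {x, y} = ⊤) (hx : x ^ 3 ^ e ∈ commutator D)
    (hy : y ^ 3 ∈ commutator D) (hc : (commutator D).index = 3 ^ (e + 1)) : IsMarking e x y := by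
  refine ⟨?_, hx, hy, by rw [hgen, top_sup_eq]⟩
  have hker : ∀ g : D, g ∈ commutator D → Abelianization.of g = 1 := fun g hg => by
    rw [← MonoidHom.mem_ker, Abelianization.ker_of]; exact hg
  have hs : Function.Surjective (Abelianization.of : D →* Abelianization D) :=
    QuotientGroup.mk_surjective
  obtain ⟨ψ, -⟩ := exists_mulEquiv_abType (A := Abelianization D) (a := e) (b := 1)
    (u := Abelianization.of x) (v := Abelianization.of y) (Commute.all _ _)
    (by rw [← map_pow]; exact hker _ hx) (by rw [← map_pow]; exact hker _ hy)
    (by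
      have := congr_arg (Subgroup.map Abelianization.of) hgen
      rw [Subgroup.map_top_of_surjective _ hs, MonoidHom.map_closure, Set.image_pair] at this
      exact this) hc
  exact ⟨ψ⟩

theorem commutator_le_maxSub (x y : D) (i : Fin 4) : commutator D ≤ maxSub x y i := by
  fin_cases i <;> exact le_sup_right

/-- The exponents `(u, v)` such that the maximal subgroup number `i` consists of the elements
`x^a y^b d`, `d ∈ G'`, with `u a + v b` divisible by three. -/
def maxSubWeight : Fin 4 → ℕ × ℕ := ![(0, 1), (2, 1), (1, 1), (1, 0)]

/-- Each of the four maximal subgroups is the kernel of a character of order three. -/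
theorem IsMarking.exists_character (he : 1 ≤ e) (h : IsMarking e x y) (i : Fin 4) :
    ∃ χ : D →* Multiplicative (ZMod 3), χ.ker = maxSub x y i ∧
      χ x = Multiplicative.ofAdd ((maxSubWeight i).1 : ZMod 3) ∧
      χ y = Multiplicative.ofAdd ((maxSubWeight i).2 : ZMod 3) := by
  obtain ⟨π, -, hker, hx, hy⟩ := h.exists_hom
  have h3 : ∀ w : Multiplicative (ZMod 3), w ^ 3 = 1 := by decide
  have h3e : ∀ w : Multiplicative (ZMod 3), w ^ 3 ^ e = 1 := fun w => by
    obtain ⟨d, rfl⟩ := Nat.exists_eq_add_of_le' he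
    rw [pow_succ, mul_comm, pow_mul, h3, one_pow]
  let χ : D →* Multiplicative (ZMod 3) := (abHom
    (Multiplicative.ofAdd ((maxSubWeight i).1 : ZMod 3))
    (Multiplicative.ofAdd ((maxSubWeight i).2 : ZMod 3)) (Commute.all _ _) (h3e _) (h3 _)).comp π
  have hχx : χ x = Multiplicative.ofAdd ((maxSubWeight i).1 : ZMod 3) := by
    rw [MonoidHom.comp_apply, hx, abHom_abGenX]
  have hχy : χ y = Multiplicative.ofAdd ((maxSubWeight i).2 : ZMod 3) := by
    rw [MonoidHom.comp_apply, hy, abHom_abGenY]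
  have hχd : commutator D ≤ χ.ker := fun d hd => by
    rw [← hker, MonoidHom.mem_ker] at hd
    rw [MonoidHom.mem_ker, MonoidHom.comp_apply, hd, map_one]
  refine ⟨χ, le_antisymm (fun g hg => ?_) ?_, hχx, hχy⟩
  · obtain ⟨a, b, d, hd, rfl⟩ := h.exists_eq_mul g
    refine mul_mem ?_ (commutator_le_maxSub x y i hd)
    have hab : 3 ∣ (maxSubWeight i).1 * a + (maxSubWeight i).2 * b := by
      rw [MonoidHom.mem_ker, map_mul, (MonoidHom.mem_ker).1 (hχd hd), mul_one, map_mul, map_pow,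
        map_pow, hχx, hχy, ← ofAdd_nsmul, ← ofAdd_nsmul, ← ofAdd_add, ofAdd_eq_one] at hg
      rw [← ZMod.natCast_eq_zero_iff]
      push_cast
      simpa [mul_comm] using hg
    have hN : (maxSub x y i).Normal := Subgroup.Normal.of_commutator_le _ (commutator_le_maxSub x y i)
    have hy3 : ((y : D ⧸ maxSub x y i)) ^ 3 = 1 := by
      rw [← QuotientGroup.mk_pow, QuotientGroup.eq_one_iff]
      exact commutator_le_maxSub x y i h.2.2.1
    -- for `i < 3` the coset of `x` is the power of the coset of `y` with exponent the first weight
    have key : ∀ w m, maxSubWeight i = (w, 1) → w + m = 0 ∨ w + m = 3 →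
        x * y ^ m ∈ maxSub x y i → x ^ a * y ^ b ∈ maxSub x y i := by
      intro w m hw hm hxy
      rw [hw] at hab
      obtain ⟨c, hc⟩ := hab
      have hwm : (y : D ⧸ maxSub x y i) ^ (m + w) = 1 := by
        rcases hm with hm | hm <;> rw [add_comm, hm]
        exacts [pow_zero _, hy3]
      have hxw : (x : D ⧸ maxSub x y i) = (y : D ⧸ maxSub x y i) ^ w := by
        rw [← mul_one (x : D ⧸ maxSub x y i), ← hwm, pow_add, ← mul_assoc, ← QuotientGroup.mk_pow,
          ← QuotientGroup.mk_mul, (QuotientGroup.eq_one_iff _).2 hxy, one_mul]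
      rw [← QuotientGroup.eq_one_iff, QuotientGroup.mk_mul, QuotientGroup.mk_pow,
        QuotientGroup.mk_pow, hxw, ← pow_mul, ← pow_add,
        show w * a + b = 3 * c by simpa using hc, pow_mul, hy3, one_pow]
    fin_cases i
    · exact key 0 0 rfl (Or.inl rfl)
        (Subgroup.mem_sup_left (Subgroup.subset_closure (by simp)))
    · exact key 2 1 rfl (Or.inr rfl)
        (Subgroup.mem_sup_left (Subgroup.subset_closure (by simp)))
    · exact key 1 2 rfl (Or.inr rfl)
        (Subgroup.mem_sup_left (Subgroup.subset_closure (by simp)))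
    · obtain ⟨c, hc⟩ := hab
      have hc' : a = 3 * c := by simpa [maxSubWeight] using hc
      rw [hc', pow_mul]
      exact Subgroup.mem_sup_left (mul_mem (pow_mem (Subgroup.subset_closure (by simp)) _)
        (pow_mem (Subgroup.subset_closure (by simp)) _))
  · have hle : ∀ S : Set D, (∀ s ∈ S, χ s = 1) → Subgroup.closure S ⊔ commutator D ≤ χ.ker :=
      fun S hS => sup_le ((Subgroup.closure_le _).2 fun s hs => hS s hs) hχd
    fin_cases i <;> apply hle
    · rintro s rfl; rw [hχx]; rfl
    · rintro s rfl; rw [map_mul, hχx, hχy]; decide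
    · rintro s rfl; rw [map_mul, map_pow, hχx, hχy]; decide
    · rintro s (rfl | rfl)
      · rw [map_pow]; exact h3 _
      · rw [hχy]; rfl

theorem maxSub_normal (x y : D) (i : Fin 4) : (maxSub x y i).Normal :=
  Subgroup.Normal.of_commutator_le _ (commutator_le_maxSub x y i)

theorem IsMarking.index_maxSub (he : 1 ≤ e) (h : IsMarking e x y) (i : Fin 4) :
    (maxSub x y i).index = 3 := by
  obtain ⟨χ, hker, hx, hy⟩ := h.exists_character he i
  rw [← hker, Subgroup.index_ker]
  have hdvd : Nat.card χ.range ∣ 3 := by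
    have := Subgroup.card_subgroup_dvd_card χ.range
    rwa [Nat.card_congr Multiplicative.toAdd, Nat.card_zmod] at this
  rcases (Nat.dvd_prime Nat.prime_three).1 hdvd with h1 | h1
  · exfalso
    have hbot := (Subgroup.card_eq_one).1 h1
    have htriv : ∀ g, χ g = 1 := fun g => by
      have : χ g ∈ χ.range := ⟨g, rfl⟩
      rwa [hbot, Subgroup.mem_bot] at this
    rw [htriv] at hx hy
    fin_cases i <;> revert hx hy <;> decide
  · exact h1

theorem IsMarking.notMem_maxSub (he : 1 ≤ e) (h : IsMarking e x y) :
    y ∉ maxSub x y 0 ∧ y ∉ maxSub x y 1 ∧ x ∉ maxSub x y 3 := by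
  refine ⟨?_, ?_, ?_⟩
  · obtain ⟨χ, hker, hx, hy⟩ := h.exists_character he 0
    rw [← hker, MonoidHom.mem_ker, hy]; decide
  · obtain ⟨χ, hker, hx, hy⟩ := h.exists_character he 1
    rw [← hker, MonoidHom.mem_ker, hy]; decide
  · obtain ⟨χ, hker, hx, hy⟩ := h.exists_character he 3
    rw [← hker, MonoidHom.mem_ker, hx]; decide

end Marking

/-! ### Invariants of the standard groups -/

/-- If `G'` is central of exponent three and `H` is an abelian normal subgroup of index three, then
the transfer from `G` to `H` is `g ↦ g^3`. -/
theorem mem_ker_artinTransfer_iff {D : Type} [Group D] [Finite D] {H : Subgroup D} (hn : H.Normal)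
    (hi : H.index = 3) (hD : pStep 3 (commutator D) = ⊥) (hc : ∀ a b : H, a * b = b * a) (g : D) :
    g ∈ (artinTransfer H).ker ↔ g ^ 3 = 1 := by
  have hinj : ∀ a : H, (Abelianization.of a = 1 ↔ a = 1) := fun a => by
    have : commutator H = ⊥ := (commutator_eq_bot_iff H).2 ⟨⟨hc⟩⟩
    rw [← MonoidHom.mem_ker, Abelianization.ker_of, this, Subgroup.mem_bot]
  obtain ⟨t, ht⟩ : ∃ t, t ∉ H := by
    by_contra! hall
    rw [(Subgroup.eq_top_iff' H).2 hall, Subgroup.index_top] at hi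
    omega
  rw [MonoidHom.mem_ker, artinTransfer]
  by_cases hg : g ∈ H
  · rw [transfer_of_mem _ hn hi ht hg, ← map_mul, ← map_mul, hinj, ← OneMemClass.coe_eq_one]
    obtain ⟨hz, hz3⟩ := commutatorElement_comm_and_pow_three hD g⁻¹ t⁻¹
    set u := ⁅g⁻¹, t⁻¹⁆ with hu
    have h1 : t⁻¹ * g * t = g * u := by rw [hu, commutatorElement_def]; group
    have h2 : (t ^ 2)⁻¹ * g * t ^ 2 = g * u * u := by
      have : (t ^ 2)⁻¹ * g * t ^ 2 = t⁻¹ * (t⁻¹ * g * t) * t := by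
        simp [pow_two, mul_assoc]
      rw [this, h1, show t⁻¹ * (g * u) * t = t⁻¹ * g * (u * t) by group, hz t,
        show t⁻¹ * g * (t * u) = t⁻¹ * g * t * u by group, h1]
    have h3 : g * (t⁻¹ * g * t) * ((t ^ 2)⁻¹ * g * t ^ 2) = g ^ 3 := by
      rw [h1, h2]
      calc g * (g * u) * (g * u * u) = g * g * (u * g) * u * u := by group
        _ = g * g * g * u ^ 3 := by rw [hz g]; simp [pow_succ, mul_assoc]
        _ = g ^ 3 := by rw [hz3]; simp [pow_succ]
    simp only [Subgroup.coe_mul, h3]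
  · rw [transfer_of_notMem _ hn hi hg, hinj, ← OneMemClass.coe_eq_one]

namespace StandardPair

section

variable {D : Type} [Group D] {e k : ℕ} {x y : D}

theorem pow_y_three_pow (h : StandardPair e k x y) {n : ℕ} (hn : 1 ≤ n) : y ^ 3 ^ n = 1 := by
  obtain ⟨d, rfl⟩ := Nat.exists_eq_add_of_le' hn
  rw [pow_succ', pow_mul, h.pow_y, one_pow]

theorem isMarking_abelian (h : StandardPair e 0 x y) (he : 1 ≤ e) : IsMarking (e + 1) x y := by
  refine isMarking_of_gen h.gen ?_ ?_ ?_
  · rw [h.pow_x]; exact one_mem _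
  · rw [h.pow_y]; exact one_mem _
  · rw [h.commutator_eq_zpowers he, pow_zero, Subgroup.zpowers_one_eq_bot, Subgroup.index_bot,
      h.card]

theorem orderOf_pow (h : StandardPair e k x y) : orderOf (x ^ 3 ^ e) = 3 := by
  rw [orderOf_pow_of_dvd (by positivity) (h.orderOf_eq ▸ pow_dvd_pow 3 (by omega)), h.orderOf_eq,
    pow_succ, Nat.mul_div_cancel_left _ (by positivity)]

theorem isMarking_modular (h : StandardPair e 1 x y) (he : 1 ≤ e) : IsMarking e x y := by
  have hD := h.commutator_eq_zpowers he
  rw [pow_one] at hD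
  refine isMarking_of_gen h.gen ?_ ?_ ?_
  · rw [hD]; exact Subgroup.mem_zpowers _
  · rw [h.pow_y]; exact one_mem _
  · have h1 := Subgroup.card_mul_index (commutator D)
    rw [h.card, hD, Nat.card_zpowers, h.orderOf_pow, show e + 2 = (e + 1) + 1 by omega,
      pow_succ', ← hD] at h1
    exact Nat.eq_of_mul_eq_mul_left (by norm_num) h1

/-- The maximal subgroups are abelian, the first three of them being cyclic. -/
theorem nonempty_maxSub_mulEquiv (h : StandardPair e k x y) (he : 1 ≤ e) {m : ℕ} (hm : 1 ≤ m)
    (hmark : IsMarking m x y) (i : Fin 4) :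
    Nonempty (maxSub x y i ≃* AbType (![(e + 1, 0), (e + 1, 0), (e + 1, 0), (e, 1)] i).1
      (![(e + 1, 0), (e + 1, 0), (e + 1, 0), (e, 1)] i).2) := by
  have hD := h.pStep_commutator he
  have hcard : Nat.card (maxSub x y i) = 3 ^ (e + 1) := by
    have h1 := Subgroup.card_mul_index (maxSub x y i)
    rw [hmark.index_maxSub hm, h.card, show e + 2 = (e + 1) + 1 by omega, pow_succ] at h1
    exact Nat.eq_of_mul_eq_mul_right (by norm_num) h1
  -- the subgroups other than the last one are generated by `u = x y^j`, with `u^(3^e) = x^(3^e)`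
  have cyc : ∀ j, maxSub x y i = Subgroup.closure {x * y ^ j} ⊔ commutator D →
      Nonempty (maxSub x y i ≃* AbType (e + 1) 0) := by
    intro j hj
    have hu : (x * y ^ j) ^ 3 ^ e = x ^ 3 ^ e := by
      rw [mul_pow_three_pow hD, ← pow_mul, mul_comm j, pow_mul, h.pow_y_three_pow he, one_pow,
        mul_one]
    refine nonempty_mulEquiv_abType (u := x * y ^ j) (v := 1) (Commute.one_right _) ?_
      (one_pow _) (hj.trans (le_antisymm (sup_le ?_ ?_) ?_)) hcard
    · rw [pow_succ, pow_mul, hu, h.pow_pow_three]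
    · exact Subgroup.closure_mono (by simp)
    · refine (h.commutator_le_zpowers he).trans ?_
      rw [Subgroup.zpowers_le, ← hu]
      exact pow_mem (Subgroup.subset_closure (by simp)) _
    · rw [Subgroup.closure_le]
      rintro s (rfl | rfl)
      · exact Subgroup.mem_sup_left (Subgroup.subset_closure rfl)
      · exact one_mem _
  fin_cases i
  · exact cyc 0 (by simp [maxSub])
  · exact cyc 1 (by simp [maxSub])
  · exact cyc 2 rfl
  · change Nonempty (maxSub x y 3 ≃* AbType e 1)
    refine nonempty_mulEquiv_abType (u := x ^ 3) (v := y) (pow_three_comm hD x y) ?_ h.pow_y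
      (le_antisymm (sup_le le_rfl ?_) le_sup_left) hcard
    · rw [← pow_mul, ← pow_succ', h.pow_x]
    · refine (h.commutator_le_zpowers he).trans ?_
      obtain ⟨d, rfl⟩ := Nat.exists_eq_add_of_le' he
      rw [Subgroup.zpowers_le, pow_succ' 3 d, pow_mul]
      exact pow_mem (Subgroup.subset_closure (by simp)) _

theorem hasAQI (h : StandardPair e k x y) (he : 1 ≤ e) {m : ℕ} (hm : 1 ≤ m)
    (hmark : IsMarking m x y) : HasAQI m ![(e + 1, 0), (e + 1, 0), (e + 1, 0), (e, 1)] D := by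
  refine ⟨x, y, hmark, fun i => ?_⟩
  obtain ⟨f⟩ := h.nonempty_maxSub_mulEquiv he hm hmark i
  exact ⟨f.abelianizationCongr.trans Abelianization.equivOfComm.symm⟩

theorem pow_three_eq_one_iff (h : StandardPair e k x y) (he : 1 ≤ e) (g : D) :
    g ^ 3 = 1 ↔ g ∈ Subgroup.closure {x ^ 3 ^ e, y} := by
  have hD := h.pStep_commutator he
  constructor
  · intro hg
    obtain ⟨i, -, j, -, rfl⟩ := exists_pow_mul_pow h.gen h.conj_mem (A := 3 ^ (e + 1)) (B := 3)
      (by positivity) (by norm_num) h.pow_x h.pow_y g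
    rw [mul_pow_three hD, ← pow_mul, ← pow_mul, mul_comm j, pow_mul y, h.pow_y, one_pow, mul_one,
      ← orderOf_dvd_iff_pow_eq_one, h.orderOf_eq, pow_succ] at hg
    obtain ⟨c, rfl⟩ := Nat.dvd_of_mul_dvd_mul_right (by norm_num) hg
    rw [pow_mul]
    exact mul_mem (pow_mem (Subgroup.subset_closure (by simp)) _)
      (pow_mem (Subgroup.subset_closure (by simp)) _)
  · intro hg
    have : Subgroup.closure {x ^ 3 ^ e, y} ≤ (threePowHom hD 1).ker := by
      rw [Subgroup.closure_le]
      rintro s (rfl | rfl)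
      exacts [h.pow_pow_three, h.pow_y]
    exact this hg

/-- All four transfer kernels consist of the elements of order dividing three. -/
theorem ker_artinTransfer [Finite D] (h : StandardPair e k x y) (he : 1 ≤ e) {m : ℕ} (hm : 1 ≤ m)
    (hmark : IsMarking m x y) (i : Fin 4) :
    (artinTransfer (maxSub x y i)).ker = Subgroup.closure {x ^ 3 ^ e, y} := by
  obtain ⟨f⟩ := h.nonempty_maxSub_mulEquiv he hm hmark i
  ext g
  rw [mem_ker_artinTransfer_iff (maxSub_normal x y i) (hmark.index_maxSub hm i)
    (h.pStep_commutator he) (fun a b => f.injective (by rw [map_mul, map_mul, mul_comm])),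
    h.pow_three_eq_one_iff he]

theorem hasPTKT_abelian [Finite D] (h : StandardPair e 0 x y) (he : 1 ≤ e) :
    HasPTKT (e + 1) ![0, 0, 0, 0] D := by
  have hmark := h.isMarking_abelian he
  refine ⟨x, y, hmark, fun i => ?_⟩
  rw [h.ker_artinTransfer he (by omega) hmark,
    show (![0, 0, 0, 0] : Fin 4 → Fin 5) i = 0 by fin_cases i <;> rfl]
  refine le_antisymm le_sup_left (sup_le le_rfl ((h.commutator_le_zpowers he).trans ?_))
  rw [Subgroup.zpowers_le]
  exact Subgroup.subset_closure (by simp)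

theorem hasPTKT_modular [Finite D] (h : StandardPair e 1 x y) (he : 1 ≤ e) :
    HasPTKT e ![1, 1, 1, 1] D := by
  have hmark := h.isMarking_modular he
  refine ⟨x, y, hmark, fun i => ?_⟩
  rw [h.ker_artinTransfer he he hmark,
    show (![1, 1, 1, 1] : Fin 4 → Fin 5) i = 1 by fin_cases i <;> rfl]
  show _ = Subgroup.closure {y} ⊔ commutator D
  rw [h.commutator_eq_zpowers he, pow_one, Subgroup.zpowers_eq_closure, ← Subgroup.closure_union,
    Set.singleton_union, Set.pair_comm]

/-- An automorphism `σ` inverting `G / G'` fixes `[y, x]`, as `G` has class two, and inverts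
`x^(3^e)`, as `G'` has exponent three; but `[y, x] = x^(3^e)` has order three. -/
theorem not_isSigmaGroup (h : StandardPair e 1 x y) (he : 1 ≤ e) : ¬ IsSigmaGroup D := by
  rintro ⟨σ, hσ⟩
  have hD := h.pStep_commutator he
  obtain ⟨hcen, h3⟩ := pStep_eq_bot_iff.1 hD
  have hinv : ∀ g, ∃ d ∈ commutator D, σ g = d * g⁻¹ := fun g => ⟨_, hσ g, by group⟩
  obtain ⟨a, ha, hax⟩ := hinv x
  obtain ⟨b, hb, hby⟩ := hinv y
  have hac := fun g => Subgroup.mem_center_iff.1 (hcen ha) g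
  have hbc := fun g => Subgroup.mem_center_iff.1 (hcen hb) g
  have hz : ⁅y, x⁆ = x ^ 3 ^ e := by rw [h.commutator_eq, pow_one]
  have h1 : σ (x ^ 3 ^ e) = (x ^ 3 ^ e)⁻¹ := by
    obtain ⟨d, rfl⟩ := Nat.exists_eq_add_of_le' he
    rw [map_pow, hax, mul_pow_three_pow hD, pow_succ' 3 d, pow_mul a, h3 a ha, one_pow, one_mul,
      inv_pow]
  have h2 : σ ⁅y, x⁆ = ⁅y, x⁆ := by
    obtain ⟨hc, -⟩ := commutatorElement_comm_and_pow_three hD y x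
    rw [map_commutatorElement, hax, hby, commutatorElement_def, mul_inv_rev, mul_inv_rev, inv_inv,
      inv_inv]
    calc b * y⁻¹ * (a * x⁻¹) * (y * b⁻¹) * (x * a⁻¹)
        = b * y⁻¹ * (a * (x⁻¹ * y * b⁻¹ * x)) * a⁻¹ := by group
      _ = b * y⁻¹ * (x⁻¹ * y * b⁻¹ * x) := by rw [← hac]; group
      _ = b * (y⁻¹ * x⁻¹ * y) * b⁻¹ * x := by group
      _ = y⁻¹ * x⁻¹ * y * x := by rw [← hbc]; group
      _ = y⁻¹ * x⁻¹ * (⁅y, x⁆ * (x * y)) := by rw [commutatorElement_def]; group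
      _ = ⁅y, x⁆ := by rw [← mul_assoc, ← hc]; group
  rw [hz, h1, inv_eq_iff_mul_eq_one, ← pow_two, ← orderOf_dvd_iff_pow_eq_one, h.orderOf_pow] at h2
  norm_num at h2

end

end StandardPair

/-! ### Recognition of the standard groups -/

section Recognition

variable {D : Type*} [Group D] {e : ℕ} {x y : D}

theorem pStep_commutator_of_central (hgen : Subgroup.closure {x, y} = ⊤)
    (hc : ⁅y, x⁆ ∈ Subgroup.center D) (h3 : ⁅y, x⁆ ^ 3 = 1) : pStep 3 (commutator D) = ⊥ := by
  have hle : commutator D ≤ Subgroup.zpowers ⁅y, x⁆ := by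
    refine commutator_le_of_closure_pair hgen ?_ ?_
    · rw [← Subgroup.commutator_top_right_le_iff,
        Subgroup.commutator_top_right_eq_bot_iff_le_center.2 (Subgroup.zpowers_le.2 hc)]
      exact bot_le
    · rw [← commutatorElement_inv y x]
      exact inv_mem (Subgroup.mem_zpowers _)
  refine pStep_eq_bot_iff.2 ⟨hle.trans (Subgroup.zpowers_le.2 hc), fun g hg => ?_⟩
  obtain ⟨i, rfl⟩ := Subgroup.mem_zpowers_iff.1 (hle hg)
  rw [← zpow_natCast, ← zpow_mul, mul_comm, zpow_mul, zpow_natCast, h3, one_zpow]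

/-- Suppose that the relations `y x y⁻¹ = x^(1 + 3^e k)` with `k` prime to three and
`y^3 = x^(3^e l)` hold up to central factors `w` and `w'`, with `w^3 = 1`. Conjugation by `y^3`,
which fixes `x`, sends `x` to `x^((1 + 3^e k)^3)`, where `(1 + 3^e k)^3 - 1` is exactly divisible by
`3^(e+1)`. Hence `x^(3^(e+1)) = 1`, and `[y, x]` is central of exponent three. -/
theorem pStep_commutator_of_conj_eq (he : 1 ≤ e) (hgen : Subgroup.closure {x, y} = ⊤) {w w' : D}
    {k l : ℤ} (hk : ¬ (3 : ℤ) ∣ k) {n : ℕ} (hn : x ^ 3 ^ n = 1) (hw : w ∈ Subgroup.center D)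
    (hw3 : w ^ 3 = 1) (hw' : w' ∈ Subgroup.center D)
    (hxy : y * x * y⁻¹ = x ^ (1 + 3 ^ e * k) * w) (hy : y ^ 3 = x ^ (3 ^ e * l) * w') :
    x ^ 3 ^ (e + 1) = 1 ∧ pStep 3 (commutator D) = ⊥ := by
  have hwc : ∀ g, Commute g w := fun g => Subgroup.mem_center_iff.1 hw g
  have hw3' : ∀ i : ℤ, w ^ (3 * i) = 1 := fun i => by
    rw [zpow_mul, show w ^ (3 : ℤ) = 1 by exact_mod_cast hw3, one_zpow]
  set m : ℤ := 1 + 3 ^ e * k with hm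
  have hconj : ∀ i j : ℤ, y * (x ^ i * w ^ j) * y⁻¹ = x ^ (m * i) * w ^ (i + j) := fun i j => by
    rw [show y * (x ^ i * w ^ j) * y⁻¹ = (y * x ^ i * y⁻¹) * (y * w ^ j * y⁻¹) by group,
      ← conj_zpow, hxy, (((hwc y).zpow_right j)).eq, mul_inv_cancel_right,
      (hwc _).mul_zpow, ← zpow_mul, zpow_add, mul_assoc]
  have hfix : y ^ 3 * x * (y ^ 3)⁻¹ = x := by
    have : Commute x (y ^ 3) := by
      rw [hy]
      exact (Commute.self_zpow x _).mul_right (Subgroup.mem_center_iff.1 hw' x)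
    rw [← this.eq, mul_inv_cancel_right]
  -- conjugation by `y` iterated three times; the exponent of `w` is divisible by three
  have hcube : y ^ 3 * x * (y ^ 3)⁻¹ = x ^ (m * (m * m)) * w ^ (m * m + (m + 1)) := by
    calc y ^ 3 * x * (y ^ 3)⁻¹ = y * (y * (y * (x ^ (1 : ℤ) * w ^ (0 : ℤ)) * y⁻¹) * y⁻¹) * y⁻¹ := by
          simp [pow_succ, mul_assoc]
      _ = _ := by rw [hconj, hconj, hconj]; congr 2 <;> ring
  obtain ⟨d, rfl⟩ := Nat.exists_eq_add_of_le' he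
  -- `q` is the cofactor prime to three in `(1 + 3^e k)^3 - 1 = 3^(e+1) k q`
  set q : ℤ := 1 + 3 * (3 ^ d * k + 3 ^ (2 * d) * k ^ 2) with hq
  have hx1 : x ^ ((3 : ℤ) ^ (d + 1 + 1) * (k * q)) = 1 := by
    have h1 : x ^ (m * (m * m)) * w ^ (m * m + (m + 1)) = x := hcube.symm.trans hfix
    rw [show m * m + (m + 1) = 3 * (1 + 3 ^ (d + 1) * k + 3 ^ (2 * d + 1) * k ^ 2) by
      rw [hm]; ring, hw3', mul_one] at h1
    rw [show (3 : ℤ) ^ (d + 1 + 1) * (k * q) = m * (m * m) - 1 by rw [hm, hq]; ring, zpow_sub_one,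
      h1, mul_inv_cancel]
  have hx : x ^ 3 ^ (d + 1 + 1) = 1 := by
    have hcop : IsCoprime ((3 : ℤ) ^ n) (k * q) := by
      have h3 : Prime (3 : ℤ) := Int.prime_three
      refine IsCoprime.pow_left ((Prime.coprime_iff_not_dvd h3).2 fun hdvd => ?_)
      rcases h3.dvd_or_dvd hdvd with h | h
      · exact hk h
      · rw [hq, Int.dvd_add_left (Dvd.intro _ rfl)] at h
        norm_num at h
    obtain ⟨a, b, hab⟩ := hcop
    have hn' : x ^ ((3 : ℤ) ^ n) = 1 := by exact_mod_cast hn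
    have h1 : x ^ ((3 : ℤ) ^ (d + 1 + 1)) = 1 := by
      conv_lhs => rw [← mul_one ((3 : ℤ) ^ (d + 1 + 1)), ← hab]
      rw [show (3 : ℤ) ^ (d + 1 + 1) * (a * 3 ^ n + b * (k * q)) =
        3 ^ n * (3 ^ (d + 1 + 1) * a) + (3 ^ (d + 1 + 1) * (k * q)) * b by ring, zpow_add,
        zpow_mul, hn', zpow_mul x _ b, hx1, one_zpow, one_zpow, one_mul]
    exact_mod_cast h1
  have hx' : ∀ i : ℤ, x ^ ((3 : ℤ) ^ (d + 1 + 1) * i) = 1 := fun i => by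
    rw [zpow_mul, show x ^ ((3 : ℤ) ^ (d + 1 + 1)) = 1 by exact_mod_cast hx, one_zpow]
  have hc : ⁅y, x⁆ = x ^ ((3 : ℤ) ^ (d + 1) * k) * w ^ (1 : ℤ) := by
    rw [commutatorElement_def, hxy, mul_assoc, ← (hwc x⁻¹).eq, ← mul_assoc, ← zpow_sub_one, hm,
      zpow_one]
    congr 2
    ring
  refine ⟨hx, pStep_commutator_of_central hgen ?_ ?_⟩
  · have hy' : y * ⁅y, x⁆ * y⁻¹ = ⁅y, x⁆ := by
      rw [hc, hconj, hm, show ((1 : ℤ) + 3 ^ (d + 1) * k) * (3 ^ (d + 1) * k) =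
        3 ^ (d + 1) * k + 3 ^ (d + 1 + 1) * (3 ^ d * k ^ 2) by ring, zpow_add, hx', mul_one,
        show (3 : ℤ) ^ (d + 1) * k + 1 = 3 * (3 ^ d * k) + 1 by ring, zpow_add, hw3', one_mul]
    have : Subgroup.closure {x, y} ≤ Subgroup.centralizer {⁅y, x⁆} := by
      rw [Subgroup.closure_le]
      rintro s (rfl | rfl)
      · refine Subgroup.mem_centralizer_singleton_iff.2 ?_
        rw [hc]
        exact ((Commute.self_zpow s _).mul_right ((hwc s).zpow_right _)).eq
      · exact Subgroup.mem_centralizer_singleton_iff.2 (mul_inv_eq_iff_eq_mul.1 hy')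
    rw [hgen] at this
    exact Subgroup.mem_center_iff.2 fun g =>
      Subgroup.mem_centralizer_singleton_iff.1 (this (Subgroup.mem_top g))
  · rw [hc, zpow_one, (hwc _).mul_pow, hw3, mul_one, ← zpow_natCast, ← zpow_mul,
      show (3 : ℤ) ^ (d + 1) * k * ((3 : ℕ) : ℤ) = 3 ^ (d + 1 + 1) * k by push_cast; ring, hx']

/-- A group of order `3^(e+2)` generated by `x` and `y` in which `x^(3^e)` generates a subgroup of
order at most three containing `G'` and `y^3` is one of the two standard groups. -/
theorem exists_standardPair (he : 1 ≤ e) (hgen : Subgroup.closure {x, y} = ⊤)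
    (hD : pStep 3 (commutator D) = ⊥) (hx : x ^ 3 ^ (e + 1) = 1)
    (hc : commutator D ≤ Subgroup.zpowers (x ^ 3 ^ e)) (hy : y ^ 3 ∈ Subgroup.zpowers (x ^ 3 ^ e))
    (hcard : Nat.card D = 3 ^ (e + 2)) :
    ∃ y' : D, StandardPair e 0 x y' ∨ StandardPair e 1 x y' := by
  have hz3 : (x ^ 3 ^ e) ^ 3 = 1 := by rw [← pow_mul, ← pow_succ, hx]
  have hpow : ∀ g ∈ Subgroup.zpowers (x ^ 3 ^ e), ∃ i < 3, (x ^ 3 ^ e) ^ i = g := fun g hg => by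
    obtain ⟨i, rfl⟩ := Subgroup.mem_zpowers_iff.1 hg
    exact exists_pow_eq_zpow (by norm_num) hz3 i
  have hgen' : ∀ b : D, y ∈ Subgroup.closure {x, b} → Subgroup.closure {x, b} = ⊤ := fun b hb => by
    rw [eq_top_iff, ← hgen, Subgroup.closure_le]
    rintro s (rfl | rfl)
    exacts [Subgroup.subset_closure (by simp), hb]
  -- multiply `y` by a power of `x^(3^(e-1))` so as to obtain an element of order three
  obtain ⟨l, -, hl⟩ := hpow _ hy
  obtain ⟨d, rfl⟩ := Nat.exists_eq_add_of_le' he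
  obtain ⟨b, hb⟩ : ∃ b, b = y * x ^ (3 ^ d * (2 * l)) := ⟨_, rfl⟩
  have hb3 : b ^ 3 = 1 := by
    rw [hb, mul_pow_three hD, ← hl, ← pow_mul, ← pow_mul x,
      show 3 ^ d * (2 * l) * 3 = 3 ^ (d + 1) * (2 * l) by ring,
      ← pow_add, show 3 ^ (d + 1) * l + 3 ^ (d + 1) * (2 * l) = 3 ^ (d + 1 + 1) * l by ring,
      pow_mul, hx, one_pow]
  have hyb : y ∈ Subgroup.closure {x, b} := by
    have : y = b * (x ^ (3 ^ d * (2 * l)))⁻¹ := by rw [hb, mul_inv_cancel_right]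
    rw [this]
    exact mul_mem (Subgroup.subset_closure (by simp))
      (inv_mem (pow_mem (Subgroup.subset_closure (by simp)) _))
  obtain ⟨k, hk, hk'⟩ := hpow ⁅b, x⁆
    (hc (Subgroup.commutator_mem_commutator (Subgroup.mem_top _) (Subgroup.mem_top _)))
  have hconj : b * x * b⁻¹ = x ^ (1 + 3 ^ (d + 1) * k) := by
    rw [add_comm, pow_add, pow_mul, hk', pow_one, commutatorElement_def, inv_mul_cancel_right]
  have hk3 : k = 0 ∨ k = 1 ∨ k = 2 := by omega
  rcases hk3 with rfl | rfl | rfl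
  · exact ⟨b, Or.inl ⟨hgen' b hyb, hx, hb3, hconj, hcard⟩⟩
  · exact ⟨b, Or.inr ⟨hgen' b hyb, hx, hb3, hconj, hcard⟩⟩
  -- conjugation by `b^2` is `x ↦ x^((1 + 2 * 3^e)^2)`, and `(1 + 2 * 3^e)^2` is `1 + 3^e` modulo
  -- `3^(e+1)`
  · refine ⟨b ^ 2, Or.inr ⟨hgen' _ ?_, hx, ?_, ?_, hcard⟩⟩
    · have hm : b ^ 2 ∈ Subgroup.closure {x, b ^ 2} :=
        Subgroup.subset_closure (Set.mem_insert_of_mem _ rfl)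
      have hb' : b ∈ Subgroup.closure {x, b ^ 2} := by
        have := pow_mem hm 2
        rwa [← pow_mul, show 2 * 2 = 3 + 1 by norm_num, pow_add, hb3, one_mul, pow_one] at this
      refine (Subgroup.closure_le _).2 ?_ hyb
      rintro s (hs | hs) <;> rw [hs]
      · exact Subgroup.subset_closure (Set.mem_insert _ _)
      · exact hb'
    · rw [← pow_mul, mul_comm, pow_mul, hb3, one_pow]
    · have : b ^ 2 * x * (b ^ 2)⁻¹ = b * (b * x * b⁻¹) * b⁻¹ := by simp [pow_two, mul_assoc]
      rw [this, hconj, ← conj_pow, hconj, ← pow_mul,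
        show (1 + 3 ^ (d + 1) * 2) * (1 + 3 ^ (d + 1) * 2) =
          (1 + 3 ^ (d + 1) * 1) + 3 ^ (d + 1 + 1) * (1 + 4 * 3 ^ d) by ring, pow_add, pow_mul x,
        hx, one_pow, mul_one]

end Recognition

/-! ### The descendant tree -/

section Descendants

theorem closure_eq_top_of_map {G H : Type*} [Group G] [Group H] [Finite G] (hG : IsPGroup 3 G)
    {f : G →* H} (hk : f.ker ≤ pStep 3 ⊤) {x y : G}
    (h : Subgroup.closure {f x, f y} = ⊤) : Subgroup.closure {x, y} = ⊤ := by
  refine eq_top_of_sup_pStep_top hG (top_le_iff.1 (le_trans ?_ (sup_le_sup_left hk _)))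
  rw [← Subgroup.comap_map_eq, MonoidHom.map_closure, Set.image_pair, h, Subgroup.comap_top]

namespace StandardPair

variable {D : Type} [Group D] {e k : ℕ} {x y : D}

theorem lowerPCentral_succ_eq_bot (h : StandardPair e k x y) (he : 1 ≤ e) :
    lowerPCentral 3 D (e + 1) = ⊥ := by
  rw [lowerPCentral_eq_closure (h.pStep_commutator he) h.gen (by omega), h.pow_x,
    h.pow_y_three_pow (by omega), Set.pair_eq_singleton, Subgroup.closure_singleton_one]

theorem lowerPCentral_ne_bot (h : StandardPair e k x y) : lowerPCentral 3 D e ≠ ⊥ := fun hb => by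
  have h1 := pow_mem_lowerPCentral (p := 3) x e
  rw [hb, Subgroup.mem_bot] at h1
  have h2 := h.orderOf_pow
  rw [h1, orderOf_one] at h2
  norm_num at h2

/-- Both standard groups of order `3^(e+2)` are immediate descendants of `C_{3^e} × C_3`. -/
theorem isImmediateDescendant (h : StandardPair e k x y) (he : 2 ≤ e) :
    IsImmediateDescendant 3 1 (AbType e 1) D := by
  have hD := h.pStep_commutator (by omega)
  have hN : lowerPCentral 3 D e = Subgroup.zpowers (x ^ 3 ^ e) := by
    rw [lowerPCentral_eq_closure hD h.gen he, h.pow_y_three_pow (by omega), Set.pair_comm,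
      Subgroup.closure_insert_one, Subgroup.zpowers_eq_closure]
  have := lowerPCentral_normal (p := 3) (G := D) e
  have hmem : x ^ 3 ^ e ∈ lowerPCentral 3 D e := pow_mem_lowerPCentral x e
  have hgen := congr_arg (Subgroup.map (QuotientGroup.mk' (lowerPCentral 3 D e))) h.gen
  rw [MonoidHom.map_closure, Set.image_pair,
    Subgroup.map_top_of_surjective _ (QuotientGroup.mk'_surjective _)] at hgen
  have hcard : Nat.card (D ⧸ lowerPCentral 3 D e) = 3 ^ (e + 1) := by
    have h1 := Subgroup.card_eq_card_quotient_mul_card_subgroup (lowerPCentral 3 D e)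
    rw [h.card, show Nat.card (lowerPCentral 3 D e) = 3 by
      rw [hN, Nat.card_zpowers, h.orderOf_pow], show e + 2 = (e + 1) + 1 by omega, pow_succ] at h1
    exact (Nat.eq_of_mul_eq_mul_right (by norm_num) h1).symm
  have hcomm : Commute (QuotientGroup.mk' (lowerPCentral 3 D e) x)
      (QuotientGroup.mk' (lowerPCentral 3 D e) y) := by
    rw [← commutatorElement_eq_one_iff_commute, ← map_commutatorElement, QuotientGroup.mk'_apply,
      QuotientGroup.eq_one_iff, hN]
    exact h.commutator_le_zpowers (by omega)
      (Subgroup.commutator_mem_commutator (Subgroup.mem_top _) (Subgroup.mem_top _))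
  obtain ⟨ψ, -⟩ := exists_mulEquiv_abType (a := e) (b := 1) hcomm
    (by rw [← map_pow, QuotientGroup.mk'_apply, QuotientGroup.eq_one_iff]; exact hmem)
    (by rw [← map_pow]; exact (congr_arg _ h.pow_y).trans (map_one _)) hgen hcard
  refine ⟨⟨e, h.lowerPCentral_ne_bot, h.lowerPCentral_succ_eq_bot (by omega),
    ψ.toMonoidHom.comp (QuotientGroup.mk' _), ψ.surjective.comp (QuotientGroup.mk'_surjective _),
    ?_⟩, ?_⟩
  · ext g
    simp
  · rw [h.card, card_abType]; ring

/-- The modular group has no immediate descendants: in such a group, the defining relations of the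
modular group would hold up to central elements of order three. -/
theorem not_isImmediateDescendant (h : StandardPair e 1 x y) (he : 1 ≤ e) {E : Type} [Group E]
    [Finite E] {s : ℕ} : ¬ IsImmediateDescendant 3 s D E := by
  rintro ⟨⟨c, hc, hc1, f, hf, hk⟩, hcard⟩
  obtain rfl : c = e + 1 := lowerPCentral_last_index hf hc hc1 hk (h.lowerPCentral_succ_eq_bot he)
    h.lowerPCentral_ne_bot
  have hE : IsPGroup 3 E := IsPGroup.of_card (n := s + (e + 2)) (by rw [hcard, h.card, ← pow_add])
  obtain ⟨u, hu⟩ := hf x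
  obtain ⟨v, hv⟩ := hf y
  have hle : f.ker ≤ pStep 3 ⊤ := by
    rw [hk]; exact lowerPCentral_antitone (show 1 ≤ e + 1 by omega)
  have hgen : Subgroup.closure {u, v} = ⊤ :=
    closure_eq_top_of_map hE hle (by rw [hu, hv, h.gen])
  obtain ⟨hN, hN3⟩ := pStep_eq_bot_iff.1 (show pStep 3 (lowerPCentral 3 E (e + 1)) = ⊥ from hc1)
  rw [← hk] at hN hN3
  obtain ⟨n, hn⟩ := hE u
  have hw : (u ^ (1 + 3 ^ e * 1))⁻¹ * (v * u * v⁻¹) ∈ f.ker := by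
    rw [MonoidHom.mem_ker, map_mul, map_mul, map_mul, map_inv, map_inv, map_pow, hu, hv, h.conj,
      inv_mul_cancel]
  have hv3 : v ^ 3 ∈ f.ker := by rw [MonoidHom.mem_ker, map_pow, hv, h.pow_y]
  obtain ⟨hu1, hD⟩ := pStep_commutator_of_conj_eq he hgen (k := 1) (l := 0) (by norm_num) hn
    (hN hw) (hN3 _ hw) (hN hv3)
    (by rw [← zpow_natCast]; push_cast; rw [mul_inv_cancel_left]) (by simp)
  apply hc
  rw [lowerPCentral_eq_closure hD hgen (by omega), hu1, pow_succ 3 e, mul_comm, pow_mul]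
  obtain ⟨d, rfl⟩ := Nat.exists_eq_add_of_le' he
  rw [pow_succ' 3 d, pow_mul, hN3 _ hv3, one_pow, Set.pair_eq_singleton,
    Subgroup.closure_singleton_one]

end StandardPair

/-- Every immediate descendant of `C_{3^e} × C_3` is one of the two standard groups of order
`3^(e+2)`: the last term of its lower exponent-`3` central series consists of the `3^e`-th
powers, and is generated by `x^(3^e)`. -/
theorem IsImmediateDescendant.exists_standardPair {e s : ℕ} (he : 2 ≤ e) {D : Type} [Group D]
    (h : IsImmediateDescendant 3 s (AbType e 1) D) :
    s = 1 ∧ ∃ x y : D, StandardPair e 0 x y ∨ StandardPair e 1 x y := by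
  obtain ⟨⟨c, hc, hc1, f, hf, hk⟩, hcard⟩ := h
  obtain ⟨d, rfl⟩ := Nat.exists_eq_add_of_le' (show 1 ≤ e by omega)
  have hT := StandardPair.abType d
  obtain rfl : c = d + 1 := lowerPCentral_last_index hf hc hc1 hk
    (hT.lowerPCentral_succ_eq_bot (by omega)) hT.lowerPCentral_ne_bot
  rw [card_abType] at hcard
  have hfin : Finite D := Nat.finite_of_card_ne_zero (by rw [hcard]; positivity)
  have hE : IsPGroup 3 D := IsPGroup.of_card (n := s + (d + 1 + 1)) (by rw [hcard, ← pow_add])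
  obtain ⟨x, hx⟩ := hf (abGenX (d + 1) 1)
  obtain ⟨y, hy⟩ := hf (abGenY (d + 1) 1)
  have hle : f.ker ≤ pStep 3 ⊤ := by
    rw [hk]; exact lowerPCentral_antitone (show 1 ≤ d + 1 by omega)
  have hgen : Subgroup.closure {x, y} = ⊤ :=
    closure_eq_top_of_map hE hle (by rw [hx, hy, closure_abGen])
  have hN3 := (pStep_eq_bot_iff.1 (show pStep 3 (lowerPCentral 3 D (d + 1)) = ⊥ from hc1)).2
  have hDN : commutator D ≤ lowerPCentral 3 D (d + 1) := by
    rw [← hk]; exact Abelianization.commutator_subset_ker f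
  have hD : pStep 3 (commutator D) = ⊥ := le_bot_iff.1 ((pStep_mono hDN).trans hc1.le)
  have hy3 : y ^ 3 ∈ lowerPCentral 3 D (d + 1) := by
    rw [← hk, MonoidHom.mem_ker, map_pow, hy]; exact abGenY_pow _ 1
  have hN : lowerPCentral 3 D (d + 1) = Subgroup.zpowers (x ^ 3 ^ (d + 1)) := by
    rw [lowerPCentral_eq_closure hD hgen he, show y ^ 3 ^ (d + 1) = 1 by
      obtain ⟨a, rfl⟩ := Nat.exists_eq_add_of_le' (show 1 ≤ d by omega)
      rw [pow_succ' 3 (a + 1), pow_mul, pow_succ' 3 a, pow_mul, hN3 _ hy3, one_pow], Set.pair_comm,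
      Subgroup.closure_insert_one, Subgroup.zpowers_eq_closure]
  have hz3 : (x ^ 3 ^ (d + 1)) ^ 3 = 1 := hN3 _ (pow_mem_lowerPCentral x _)
  have hcardN : Nat.card (lowerPCentral 3 D (d + 1)) = 3 := by
    rw [hN, Nat.card_zpowers]
    rcases (Nat.dvd_prime Nat.prime_three).1 (orderOf_dvd_of_pow_eq_one hz3) with h1 | h1
    · rw [orderOf_eq_one_iff] at h1
      rw [hN, h1, Subgroup.zpowers_one_eq_bot] at hc
      exact absurd rfl hc
    · exact h1
  have hcardD : Nat.card D = 3 ^ (d + 1 + 2) := by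
    have h1 := Subgroup.card_mul_index f.ker
    rw [Subgroup.index_ker, MonoidHom.range_eq_top.2 hf, Subgroup.card_top, card_abType, hk,
      hcardN] at h1
    rw [← h1]; ring
  refine ⟨?_, x, _root_.exists_standardPair (by omega) hgen hD (by rw [pow_succ, pow_mul, hz3])
    (hN ▸ hDN) (hN ▸ hy3) hcardD⟩
  rw [hcardD, ← pow_add] at hcard
  have := Nat.pow_right_injective (show 2 ≤ 3 by norm_num) hcard
  omega

theorem StandardPair.not_commutative {e : ℕ} {D : Type} [Group D] {x y : D}
    (h : StandardPair e 1 x y) : ¬ ∀ a b : D, a * b = b * a := fun hab => by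
  have h1 := h.commutator_eq
  rw [commutatorElement_eq_one_iff_mul_comm.2 (hab y x), pow_one] at h1
  have h2 := h.orderOf_pow
  rw [← h1, orderOf_one] at h2
  norm_num at h2

theorem StandardPair.commutative {e : ℕ} (he : 1 ≤ e) {D : Type} [Group D] {x y : D}
    (h : StandardPair e 0 x y) (a b : D) : a * b = b * a := by
  have h1 := h.commutator_eq_zpowers he
  rw [pow_zero, Subgroup.zpowers_one_eq_bot] at h1
  rw [← commutatorElement_eq_one_iff_mul_comm, ← Subgroup.mem_bot, ← h1]
  exact Subgroup.commutator_mem_commutator (Subgroup.mem_top _) (Subgroup.mem_top _)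

theorem IsImmediateDescendant.of_mulEquiv {p s : ℕ} {P Q D : Type} [Group P] [Group Q] [Group D]
    (h : IsImmediateDescendant p s P D) (g : P ≃* Q) : IsImmediateDescendant p s Q D := by
  obtain ⟨⟨c, hc, hc1, f, hf, hk⟩, hcard⟩ := h
  refine ⟨⟨c, hc, hc1, g.toMonoidHom.comp f, g.surjective.comp hf, ?_⟩, ?_⟩
  · rw [← hk]
    ext a
    simp
  · rw [hcard, Nat.card_congr g.toEquiv]

/-- The trunk vertices are the abelian groups of type `(3^e, 3)`. -/
theorem isTrunkVertex_iff (n : ℕ) (T : Type) [Group T] :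
    IsTrunkVertex n T ↔ Nonempty (T ≃* AbType (n + 2) 1) := by
  induction n generalizing T with
  | zero => exact Iff.rfl
  | succ n ih =>
    constructor
    · rintro ⟨Q, _, hQ, hQT, hab⟩
      obtain ⟨g⟩ := (ih Q).1 hQ
      obtain ⟨-, x, y, hxy | hxy⟩ := (hQT.of_mulEquiv g).exists_standardPair (by omega)
      · exact StandardPair.nonempty_mulEquiv_abType_iff.2 ⟨x, y, hxy⟩
      · rcases hab with ⟨-, hab⟩ | ⟨h, -⟩
        · exact absurd hab hxy.not_commutative
        · omega
    · intro hT
      obtain ⟨x, y, hxy⟩ := StandardPair.nonempty_mulEquiv_abType_iff.1 hT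
      exact ⟨AbType (n + 2) 1, inferInstance, (ih _).2 ⟨MulEquiv.refl _⟩,
        hxy.isImmediateDescendant (by omega), Or.inl ⟨rfl, hxy.commutative (by omega)⟩⟩

/-- The twig vertices are the modular groups. -/
theorem isTwigVertex_iff (n : ℕ) (D : Type) [Group D] :
    IsTwigVertex n D ↔ ∃ x y : D, StandardPair (n + 2) 1 x y := by
  constructor
  · rintro ⟨Q, _, hQ, hQT, hab⟩
    obtain ⟨g⟩ := (isTrunkVertex_iff n Q).1 hQ
    obtain ⟨-, x, y, hxy | hxy⟩ := (hQT.of_mulEquiv g).exists_standardPair (by omega)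
    · rcases hab with ⟨h, -⟩ | ⟨-, hab⟩
      · omega
      · exact absurd (hxy.commutative (by omega)) hab
    · exact ⟨x, y, hxy⟩
  · rintro ⟨x, y, hxy⟩
    exact ⟨AbType (n + 2) 1, inferInstance, (isTrunkVertex_iff n _).2 ⟨MulEquiv.refl _⟩,
      hxy.isImmediateDescendant (by omega), Or.inr ⟨rfl, hxy.not_commutative⟩⟩

end Descendants

/-! ### Schur groups -/

section Schur

theorem rank_eq_two {D : Type*} [Group D] [Finite D] {x y : D}
    (hgen : Subgroup.closure {x, y} = ⊤) (hD : ¬ ∀ a b : D, a * b = b * a) :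
    Group.rank D = 2 := by
  classical
  apply le_antisymm
  · refine (Group.rank_le (S := {x, y}) (by simpa using hgen)).trans Finset.card_le_two
  · by_contra! hlt
    obtain ⟨S, hS, hSgen⟩ := Group.rank_spec D
    obtain ⟨a, ha⟩ : ∃ a, (S : Set D) ⊆ {a} := by
      obtain ⟨a, ha⟩ := Finset.card_le_one_iff_subset_singleton.1 (show S.card ≤ 1 by omega)
      exact ⟨a, by exact_mod_cast ha⟩
    have htop : ∀ g : D, g ∈ Subgroup.zpowers a := fun g => by
      have : (⊤ : Subgroup D) ≤ Subgroup.zpowers a := by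
        rw [← hSgen, Subgroup.zpowers_eq_closure]
        exact Subgroup.closure_mono ha
      exact this (Subgroup.mem_top g)
    refine hD fun g h => ?_
    obtain ⟨i, rfl⟩ := Subgroup.mem_zpowers_iff.1 (htop g)
    obtain ⟨j, rfl⟩ := Subgroup.mem_zpowers_iff.1 (htop h)
    rw [← zpow_add, ← zpow_add, add_comm]

/-- The relation rank bounds the number of generators of the kernel of every extension of `D` by
non-generators: such an extension is a quotient of the free group which presents `D`. -/
theorem IsSchurGroup.relIndex_ker_dvd {D : Type} [Group D] [Finite D] (hS : IsSchurGroup 3 D)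
    {Γ : Type*} [Group Γ] [Finite Γ] (hΓ : IsPGroup 3 Γ) {f : Γ →* D}
    (hf : Function.Surjective f) (hk : f.ker ≤ pStep 3 ⊤) :
    (pStep 3 f.ker).relIndex f.ker ∣ 3 ^ Group.rank D := by
  obtain ⟨φ, hφ, hidx⟩ := hS
  choose g hg using fun i => hf (φ (FreeGroup.of i))
  let θ : FreeGroup (Fin (Group.rank D)) →* Γ := FreeGroup.lift g
  have hcomp : f.comp θ = φ := FreeGroup.ext_hom _ _ fun i => by simp [θ, hg]
  have hθ : Function.Surjective θ := by
    rw [← MonoidHom.range_eq_top]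
    refine eq_top_of_sup_pStep_top hΓ (top_le_iff.1 (le_trans ?_ (sup_le_sup_left hk _)))
    rw [← Subgroup.comap_map_eq, MonoidHom.map_range, hcomp, MonoidHom.range_eq_top.2 hφ,
      Subgroup.comap_top]
  have hR : φ.ker.map θ = f.ker := by
    rw [← hcomp, ← MonoidHom.comap_ker, Subgroup.map_comap_eq_self_of_surjective hθ]
  have hle : θ.ker ≤ φ.ker := fun g hg => by
    rw [MonoidHom.mem_ker, ← hcomp, MonoidHom.comp_apply, (MonoidHom.mem_ker).1 hg, map_one]
  rw [← hR, ← map_pStep hθ, Subgroup.relIndex_map_map, sup_eq_left.2 hle, ← hidx]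
  exact Subgroup.relIndex_dvd_of_le_left _ le_sup_left

/-- The canonical projection from `C_{3^(a+1)} × C_{3^(b+1)}` to `C_{3^a} × C_{3^b}`. -/
def abProj (a b : ℕ) : AbType (a + 1) (b + 1) →* AbType a b :=
  abHom (abGenX a b) (abGenY a b) (Commute.all _ _)
    (by rw [pow_succ, pow_mul, abGenX_pow, one_pow]) (by rw [pow_succ, pow_mul, abGenY_pow, one_pow])

theorem abProj_abGenX (a b : ℕ) : abProj a b (abGenX _ _) = abGenX a b := abHom_abGenX _ _ _ _ _

theorem abProj_abGenY (a b : ℕ) : abProj a b (abGenY _ _) = abGenY a b := abHom_abGenY _ _ _ _ _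

theorem abProj_surjective (a b : ℕ) : Function.Surjective (abProj a b) := by
  rw [← MonoidHom.range_eq_top, abProj, range_abHom, closure_abGen]

theorem mem_ker_abProj_iff {a b : ℕ} {q : AbType (a + 1) (b + 1)} : q ∈ (abProj a b).ker ↔
    ∃ i j : ℕ, q = (abGenX (a + 1) (b + 1) ^ 3 ^ a) ^ i * (abGenY (a + 1) (b + 1) ^ 3 ^ b) ^ j := by
  have hX := abProj_abGenX a b
  have hY := abProj_abGenY a b
  constructor
  · intro hq
    obtain ⟨i, j, rfl⟩ := exists_eq_abGen_pow q
    rw [MonoidHom.mem_ker, map_mul, map_pow, map_pow, hX, hY] at hq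
    have hi : 3 ^ a ∣ i := by
      rw [← ZMod.natCast_eq_zero_iff]
      simpa [abGenX, abGenY] using congr_arg (fun q => q.1.toAdd) hq
    have hj : 3 ^ b ∣ j := by
      rw [← ZMod.natCast_eq_zero_iff]
      simpa [abGenX, abGenY] using congr_arg (fun q => q.2.toAdd) hq
    obtain ⟨i, rfl⟩ := hi
    obtain ⟨j, rfl⟩ := hj
    exact ⟨i, j, by rw [pow_mul, pow_mul]⟩
  · rintro ⟨i, j, rfl⟩
    rw [MonoidHom.mem_ker, map_mul, map_pow, map_pow, map_pow, map_pow, hX, hY, abGenX_pow,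
      abGenY_pow, one_pow, one_pow, one_mul]

theorem card_ker_abProj (a b : ℕ) : Nat.card (abProj a b).ker = 9 := by
  have h := Subgroup.card_mul_index (abProj a b).ker
  rw [Subgroup.index_ker, MonoidHom.range_eq_top.2 (abProj_surjective a b), Subgroup.card_top,
    card_abType, card_abType, show a + 1 + (b + 1) = 2 + (a + b) by ring, pow_add 3 2] at h
  exact Nat.eq_of_mul_eq_mul_right (by positivity) h

theorem pow_three_of_mem_ker_abProj {a b : ℕ} {q : AbType (a + 1) (b + 1)}
    (hq : q ∈ (abProj a b).ker) : q ^ 3 = 1 := by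
  obtain ⟨i, j, rfl⟩ := mem_ker_abProj_iff.1 hq
  rw [mul_pow, pow_right_comm _ i, ← pow_mul _ _ 3, ← pow_succ, abGenX_pow, pow_right_comm _ j,
    ← pow_mul _ _ 3, ← pow_succ, abGenY_pow, one_pow, one_pow, one_mul]

theorem inv_pow_mul_conj_eq {A : Type*} [CommGroup A] (u v : A) {m n : ℕ} (h : n = m) :
    ((u ^ (1 + n))⁻¹ * (v * u * v⁻¹))⁻¹ = u ^ m := by
  rw [mul_comm v, mul_inv_cancel_right, mul_inv_rev, inv_inv, pow_add, pow_one,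
    inv_mul_cancel_left, h]

/-- The relators `y^3` and `x^(-1-3^e) y x y⁻¹` form a basis of the `3`-multiplicator of the modular
group. They generate it, since modulo `R^3 [R, F]` they define a group which is no larger than the
modular group. They are independent, as one sees in `C_{3^(e+1)} × C_9`. The rank is a variable `n`
in order that `Fin n` can be replaced by `Fin 2`. -/
theorem StandardPair.exists_presentation {D : Type} [Group D] {e : ℕ} {x y : D}
    (h : StandardPair e 1 x y) (he : 1 ≤ e) {n : ℕ} (hn : n = 2) :
    ∃ φ : FreeGroup (Fin n) →* D, Function.Surjective φ ∧
      (pStep 3 φ.ker).relIndex φ.ker = 3 ^ n := by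
  subst hn
  let a : FreeGroup (Fin 2) := FreeGroup.of 0
  let b : FreeGroup (Fin 2) := FreeGroup.of 1
  have hab : Subgroup.closure {a, b} = ⊤ := by
    rw [← FreeGroup.closure_range_of (Fin 2)]
    congr 1
    ext g
    simp [a, b, Fin.exists_fin_two, eq_comm]
  let φ : FreeGroup (Fin 2) →* D := FreeGroup.lift ![x, y]
  have hφa : φ a = x := by simp [φ, a]
  have hφb : φ b = y := by simp [φ, b]
  have hφ : Function.Surjective φ := surjective_of_closure_pair h.gen φ hφa hφb
  have hr1 : b ^ 3 ∈ φ.ker := by rw [MonoidHom.mem_ker, map_pow, hφb, h.pow_y]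
  have hr2 : (a ^ (1 + 3 ^ e * 1))⁻¹ * (b * a * b⁻¹) ∈ φ.ker := by
    rw [MonoidHom.mem_ker, map_mul, map_mul, map_mul, map_inv, map_inv, map_pow, hφa, hφb, h.conj,
      inv_mul_cancel]
  have hSn : (pStep 3 φ.ker).Normal := pStep_normal inferInstance
  have hup : (pStep 3 φ.ker).relIndex φ.ker ≤ 3 ^ 2 ∧ (pStep 3 φ.ker).relIndex φ.ker ≠ 0 := by
    set q := QuotientGroup.mk' (pStep 3 φ.ker) with hq
    have hqs : Function.Surjective q := QuotientGroup.mk'_surjective _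
    have hqk : q.ker = pStep 3 φ.ker := QuotientGroup.ker_mk' _
    obtain ⟨hcen, h3⟩ := pStep_eq_bot_iff.1 (show pStep 3 (φ.ker.map q) = ⊥ by
      rw [← map_pStep hqs, Subgroup.map_eq_bot_iff, hqk])
    let K := Subgroup.closure {q (b ^ 3), q ((a ^ (1 + 3 ^ e * 1))⁻¹ * (b * a * b⁻¹))}
    have hKle : K ≤ φ.ker.map q := by
      rw [Subgroup.closure_le]
      rintro s (rfl | rfl)
      exacts [Subgroup.mem_map_of_mem q hr1, Subgroup.mem_map_of_mem q hr2]
    have hKn : K.Normal := by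
      rw [← Subgroup.commutator_top_right_le_iff,
        Subgroup.commutator_top_right_eq_bot_iff_le_center.2 (hKle.trans hcen)]
      exact bot_le
    -- modulo the two relators, the group has at most the order of `D`
    let f := (QuotientGroup.mk' K).comp q
    have hfs : Function.Surjective f := (QuotientGroup.mk'_surjective K).comp hqs
    have hf1 : f b ^ 3 = 1 := by
      rw [← map_pow]
      exact (QuotientGroup.eq_one_iff _).2 (Subgroup.subset_closure (by simp))
    have hf2 : f b * f a * (f b)⁻¹ = f a ^ (1 + 3 ^ e * 1) := by
      have : f ((a ^ (1 + 3 ^ e * 1))⁻¹ * (b * a * b⁻¹)) = 1 :=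
        (QuotientGroup.eq_one_iff _).2 (Subgroup.subset_closure (by simp))
      rwa [map_mul, map_inv, inv_mul_eq_one, map_pow, map_mul, map_mul, map_inv, eq_comm] at this
    -- `a^(3^(e+1))` is a relation, and relations have order three modulo `R^3 [R, F]`
    have hf3 : f a ^ 3 ^ (e + 2) = 1 := by
      have : a ^ 3 ^ (e + 1) ∈ φ.ker := by rw [MonoidHom.mem_ker, map_pow, hφa, h.pow_x]
      have := h3 _ (Subgroup.mem_map_of_mem q this)
      rw [← map_pow, ← pow_mul, ← pow_succ] at this
      rw [← map_pow]
      exact (congr_arg (QuotientGroup.mk' K) this).trans (map_one _)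
    have hfgen : Subgroup.closure {f a, f b} = ⊤ := by
      have := congr_arg (Subgroup.map f) hab
      rwa [MonoidHom.map_closure, Set.image_pair, Subgroup.map_top_of_surjective _ hfs] at this
    have hf4 : f a ^ 3 ^ (e + 1) = 1 := (pStep_commutator_of_conj_eq he hfgen (k := 1) (l := 0)
      (w := 1) (by norm_num) hf3 (one_mem _) (one_pow _) (w' := 1) (one_mem _)
      (by rw [mul_one, hf2, ← zpow_natCast]; push_cast; rfl) (by simpa using hf1)).1
    obtain ⟨hfin, hcard⟩ := card_le_of_normal_zpowers (A := 3 ^ (e + 1)) (B := 3) hfgen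
      (hf2 ▸ Subgroup.npow_mem_zpowers _ _) (by positivity) (by norm_num) hf4 hf1
    have hle : f.ker ≤ φ.ker := by
      intro g hg
      obtain ⟨r, hr, hrg⟩ := hKle ((QuotientGroup.eq_one_iff _).1 hg : q g ∈ K)
      have : g * r⁻¹ ∈ q.ker := by rw [MonoidHom.mem_ker, map_mul, map_inv, hrg, mul_inv_cancel]
      rw [hqk] at this
      simpa using mul_mem (pStep_le_self inferInstance this) hr
    have hidx := Subgroup.relIndex_mul_index hle
    rw [Subgroup.index_ker, Subgroup.index_ker, MonoidHom.range_eq_top.2 hφ,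
      MonoidHom.range_eq_top.2 hfs, Subgroup.card_top, Subgroup.card_top, h.card] at hidx
    have h1 : f.ker.relIndex φ.ker = 1 := by
      have h2 : f.ker.relIndex φ.ker ≤ 1 := by
        refine Nat.le_of_mul_le_mul_right ?_ (show 0 < 3 ^ (e + 2) by positivity)
        rw [hidx, one_mul]
        exact hcard.trans (le_of_eq (by ring))
      have h3 : f.ker.relIndex φ.ker ≠ 0 := fun h0 => by
        rw [h0, zero_mul] at hidx
        exact Nat.card_pos.ne hidx
      omega
    have hmap : φ.ker.map q ≤ K := by
      rw [Subgroup.relIndex_eq_one] at h1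
      rintro _ ⟨r, hr, rfl⟩
      exact (QuotientGroup.eq_one_iff _).1 (h1 hr : f r = 1)
    have hcomm : Commute (q (b ^ 3)) (q ((a ^ (1 + 3 ^ e * 1))⁻¹ * (b * a * b⁻¹))) :=
      (Subgroup.mem_center_iff.1 (hcen (Subgroup.mem_map_of_mem q hr1)) _).symm
    have hcardK := card_closure_pair_le (a := 1) (b := 1) _ _ hcomm
      (h3 _ (Subgroup.mem_map_of_mem q hr1)) (h3 _ (Subgroup.mem_map_of_mem q hr2))
    rw [← hqk, Subgroup.relIndex_ker, le_antisymm hmap hKle]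
    have hKfin : Finite K := by
      change Finite (Subgroup.closure _)
      rw [← range_abHom _ _ hcomm (a := 1) (b := 1) (h3 _ (Subgroup.mem_map_of_mem q hr1))
        (h3 _ (Subgroup.mem_map_of_mem q hr2))]
      exact Set.finite_range _
    exact ⟨hcardK, Nat.card_pos.ne'⟩
  refine ⟨φ, hφ, le_antisymm hup.1 ?_⟩
  -- the images of the relations in `C_{3^(e+1)} × C_9` fill the kernel of the projection to
  -- `C_{3^e} × C_3`, the commutator quotient of `D`; this kernel has order nine
  · obtain ⟨π, -, hker, hπx, hπy⟩ := (h.isMarking_modular he).exists_hom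
    let θ : FreeGroup (Fin 2) →* AbType (e + 1) (1 + 1) := FreeGroup.lift ![abGenX _ _, abGenY _ _]
    have hθa : θ a = abGenX _ _ := by simp [θ, a]
    have hθb : θ b = abGenY _ _ := by simp [θ, b]
    have hcomp : (abProj e 1).comp θ = π.comp φ := by
      refine FreeGroup.ext_hom _ _ fun i => ?_
      fin_cases i
      · exact (congr_arg _ hθa).trans ((abProj_abGenX e 1).trans
          (hπx.symm.trans (congr_arg π hφa.symm)))
      · exact (congr_arg _ hθb).trans ((abProj_abGenY e 1).trans
          (hπy.symm.trans (congr_arg π hφb.symm)))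
    have hle : φ.ker.map θ ≤ (abProj e 1).ker := by
      rintro _ ⟨r, hr, rfl⟩
      have := DFunLike.congr_fun hcomp r
      have hr : φ r = 1 := hr
      rw [MonoidHom.mem_ker, ← MonoidHom.comp_apply, this, MonoidHom.comp_apply, hr, map_one]
    have hge : (abProj e 1).ker ≤ φ.ker.map θ := by
      intro q hq
      obtain ⟨i, j, rfl⟩ := mem_ker_abProj_iff.1 hq
      have hX : abGenX (e + 1) (1 + 1) ^ 3 ^ e ∈ φ.ker.map θ :=
        ⟨_, inv_mem hr2, by
          rw [map_inv, map_mul, map_mul, map_mul, map_inv, map_inv, map_pow, hθa, hθb]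
          exact inv_pow_mul_conj_eq _ _ (by rw [mul_one])⟩
      have hY : abGenY (e + 1) (1 + 1) ^ 3 ^ 1 ∈ φ.ker.map θ :=
        ⟨b ^ 3, hr1, by rw [map_pow, hθb]; rfl⟩
      exact mul_mem (pow_mem hX i) (pow_mem hY j)
    have hker' : pStep 3 φ.ker ≤ θ.ker := by
      rw [← Subgroup.map_eq_bot_iff, eq_bot_iff]
      refine (map_pStep_le θ _).trans (le_of_eq (pStep_eq_bot_iff.2 ⟨fun k _ => ?_, fun k hk => ?_⟩))
      · exact Subgroup.mem_center_iff.2 fun g => mul_comm g k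
      · exact pow_three_of_mem_ker_abProj (hle hk)
    have hdvd := Subgroup.relIndex_dvd_of_le_left φ.ker hker'
    rw [Subgroup.relIndex_ker, le_antisymm hle hge, card_ker_abProj] at hdvd
    exact Nat.le_of_dvd (Nat.pos_of_ne_zero hup.2) hdvd

theorem StandardPair.isSchurGroup {D : Type} [Group D] [Finite D] {e : ℕ} {x y : D}
    (h : StandardPair e 1 x y) (he : 1 ≤ e) : IsSchurGroup 3 D :=
  h.exists_presentation he (rank_eq_two h.gen h.not_commutative)

end Schur

/-! ### Unitriangular matrices of size four -/

/-- The group of upper unitriangular `4 × 4` matrices over `R`. The entries above the diagonal are,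
in positions `(row, column)`: `a = (1,2)`, `b = (2,3)`, `c = (3,4)`, `d = (1,3)`, `e = (2,4)` and
`f = (1,4)`. -/
@[ext] structure Unitriangular (R : Type*) where
  a : R
  b : R
  c : R
  d : R
  e : R
  f : R

namespace Unitriangular

variable {R : Type*} [CommRing R]

instance : Mul (Unitriangular R) where
  mul m n := ⟨m.a + n.a, m.b + n.b, m.c + n.c, m.d + n.d + m.a * n.b, m.e + n.e + m.b * n.c,
    m.f + n.f + m.a * n.e + m.d * n.c⟩

instance : One (Unitriangular R) where
  one := ⟨0, 0, 0, 0, 0, 0⟩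

instance : Inv (Unitriangular R) where
  inv m := ⟨-m.a, -m.b, -m.c, -m.d + m.a * m.b, -m.e + m.b * m.c,
    -m.f + m.a * m.e + m.d * m.c - m.a * m.b * m.c⟩

theorem mul_def (m n : Unitriangular R) : m * n = ⟨m.a + n.a, m.b + n.b, m.c + n.c,
  m.d + n.d + m.a * n.b, m.e + n.e + m.b * n.c, m.f + n.f + m.a * n.e + m.d * n.c⟩ := rfl

theorem one_def : (1 : Unitriangular R) = ⟨0, 0, 0, 0, 0, 0⟩ := rfl

theorem inv_def (m : Unitriangular R) : m⁻¹ = ⟨-m.a, -m.b, -m.c, -m.d + m.a * m.b,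
  -m.e + m.b * m.c, -m.f + m.a * m.e + m.d * m.c - m.a * m.b * m.c⟩ := rfl

instance : Group (Unitriangular R) :=
  Group.ofLeftAxioms
    (fun m n k => by ext <;> simp only [mul_def] <;> ring)
    (fun m => by ext <;> simp only [mul_def, one_def] <;> ring)
    (fun m => by ext <;> simp only [mul_def, one_def, inv_def] <;> ring)

/-- The entries of a matrix, as a tuple. -/
def equivProd (R : Type*) : Unitriangular R ≃ R × R × R × R × R × R where
  toFun m := (m.a, m.b, m.c, m.d, m.e, m.f)
  invFun t := ⟨t.1, t.2.1, t.2.2.1, t.2.2.2.1, t.2.2.2.2.1, t.2.2.2.2.2⟩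
  left_inv _ := rfl
  right_inv _ := rfl

instance [Finite R] : Finite (Unitriangular R) := Finite.of_equiv _ (equivProd R).symm

theorem nat_card (R : Type*) : Nat.card (Unitriangular R) = Nat.card R ^ 6 := by
  simp only [Nat.card_congr (equivProd R), Nat.card_prod]
  ring

/-- The matrices with entries `0` next to the diagonal. -/
def second (R : Type*) [CommRing R] : Subgroup (Unitriangular R) where
  carrier := {m | m.a = 0 ∧ m.b = 0 ∧ m.c = 0}
  mul_mem' := by
    rintro m n ⟨h1, h2, h3⟩ ⟨h4, h5, h6⟩
    exact ⟨by simp [mul_def, h1, h4], by simp [mul_def, h2, h5], by simp [mul_def, h3, h6]⟩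
  one_mem' := ⟨rfl, rfl, rfl⟩
  inv_mem' := by
    rintro m ⟨h1, h2, h3⟩
    exact ⟨by simp [inv_def, h1], by simp [inv_def, h2], by simp [inv_def, h3]⟩

/-- The matrices whose only non-zero entry off the diagonal is the one in the corner. -/
def corner (R : Type*) [CommRing R] : Subgroup (Unitriangular R) where
  carrier := {m | ∃ r, m = ⟨0, 0, 0, 0, 0, r⟩}
  mul_mem' := by
    rintro _ _ ⟨r, rfl⟩ ⟨s, rfl⟩
    exact ⟨r + s, by simp [mul_def]⟩
  one_mem' := ⟨0, rfl⟩
  inv_mem' := by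
    rintro _ ⟨r, rfl⟩
    exact ⟨-r, by simp [inv_def]⟩

theorem corner_le_center : corner R ≤ Subgroup.center (Unitriangular R) := by
  rintro _ ⟨r, rfl⟩
  refine Subgroup.mem_center_iff.2 fun m => ?_
  simp [mul_def, add_comm]

theorem pow_three_of_mem_corner [CharP R 3] {m : Unitriangular R} (hm : m ∈ corner R) :
    m ^ 3 = 1 := by
  obtain ⟨r, rfl⟩ := hm
  have h3 : (3 : R) = 0 := by exact_mod_cast CharP.cast_eq_zero R 3
  ext <;> simp [pow_succ, mul_def, one_def]
  linear_combination r * h3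

theorem commutator_le_second : commutator (Unitriangular R) ≤ second R := by
  rw [commutator_def, Subgroup.commutator_le]
  intro m _ n _
  refine ⟨?_, ?_, ?_⟩ <;> simp only [commutatorElement_def, mul_def, inv_def] <;> ring

theorem pStep_commutator_le_corner [CharP R 3] :
    pStep 3 (commutator (Unitriangular R)) ≤ corner R := by
  have h3 : (3 : R) = 0 := by exact_mod_cast CharP.cast_eq_zero R 3
  refine (pStep_mono commutator_le_second).trans (pStep_le_iff.2 ⟨?_, ?_⟩)
  · rintro ⟨a, b, c, d, e, f⟩ ⟨h1, h2, h3⟩ n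
    dsimp only at h1 h2 h3
    subst h1 h2 h3
    refine ⟨d * n.c - n.a * e, ?_⟩
    ext <;> simp only [commutatorElement_def, mul_def, inv_def] <;> ring
  · rintro ⟨a, b, c, d, e, f⟩ ⟨h1, h2, h3⟩
    dsimp only at h1 h2 h3
    subst h1 h2 h3
    refine ⟨0, ?_⟩
    ext <;> simp [pow_succ, mul_def]
    · linear_combination d * h3
    · linear_combination e * h3
    · linear_combination f * h3

/-- The first generator: its entries next to the diagonal are `1, 1, 0` over the first factor and
`1, 0, 0` over the second one. -/
def genX : Unitriangular (ZMod 3 × ZMod 3) := ⟨(1, 1), (1, 0), 0, 0, 0, 0⟩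

/-- The second generator: its entries next to the diagonal are `0, 0, 1` over the first factor and
`0, 1, 1` over the second one. -/
def genY : Unitriangular (ZMod 3 × ZMod 3) := ⟨0, (0, 1), (1, 1), 0, 0, 0⟩

theorem genX_pow : genX ^ 3 = 1 := by
  ext1 <;> simp only [genX, pow_succ, pow_zero, mul_def, one_def] <;> decide

theorem genY_pow : genY ^ 3 = 1 := by
  ext1 <;> simp only [genY, pow_succ, pow_zero, mul_def, one_def] <;> decide

theorem commutator_genX : ⁅genX, ⁅genX, genY⁆⁆ = ⟨0, 0, 0, 0, 0, (1, 0)⟩ := by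
  ext1 <;> simp only [genX, genY, commutatorElement_def, mul_def, inv_def] <;> decide

theorem commutator_genY : ⁅genY, ⁅genX, genY⁆⁆ = ⟨0, 0, 0, 0, 0, (0, -1)⟩ := by
  ext1 <;> simp only [genX, genY, commutatorElement_def, mul_def, inv_def] <;> decide

theorem card_corner (R : Type*) [CommRing R] : Nat.card (corner R) = Nat.card R := by
  refine (Nat.card_congr (Equiv.ofBijective (fun r : R => (⟨⟨0, 0, 0, 0, 0, r⟩, r, rfl⟩ : corner R))
    ⟨fun r s h => ?_, ?_⟩)).symm
  · exact congr_arg (fun m => m.1.f) h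
  · rintro ⟨_, r, rfl⟩
    exact ⟨r, rfl⟩

theorem corner_le_closure : corner (ZMod 3 × ZMod 3) ≤
    Subgroup.closure {⁅genX, ⁅genX, genY⁆⁆, ⁅genY, ⁅genX, genY⁆⁆} := by
  have h : ∀ r s : ZMod 3 × ZMod 3, (⟨0, 0, 0, 0, 0, r⟩ * ⟨0, 0, 0, 0, 0, s⟩ : Unitriangular _) =
      ⟨0, 0, 0, 0, 0, r + s⟩ := fun r s => by simp [mul_def]
  have hpow : ∀ (r : ZMod 3 × ZMod 3) (n : ℕ), (⟨0, 0, 0, 0, 0, r⟩ : Unitriangular _) ^ n =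
      ⟨0, 0, 0, 0, 0, n • r⟩ := fun r n => by
    induction n with
    | zero => simp [one_def]
    | succ n ih => rw [pow_succ, ih, h, succ_nsmul]
  rintro _ ⟨⟨r, s⟩, rfl⟩
  have : (⟨0, 0, 0, 0, 0, (r, s)⟩ : Unitriangular (ZMod 3 × ZMod 3)) =
      ⁅genX, ⁅genX, genY⁆⁆ ^ r.val * ⁅genY, ⁅genX, genY⁆⁆ ^ (-s).val := by
    rw [commutator_genX, commutator_genY, hpow, hpow, h]
    simp
  rw [this]
  exact mul_mem (pow_mem (Subgroup.subset_closure (by simp)) _)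
    (pow_mem (Subgroup.subset_closure (by simp)) _)

end Unitriangular

/-! ### A lower bound for the second step of the commutator subgroup of a Schur group -/

section LowerBound

/-- Elements of a two-generator group in normal form modulo the commutator subgroup. -/
theorem exists_eq_pow_mul_pow_mul {G : Type*} [Group G] [Finite G] {x y : G}
    (hgen : Subgroup.closure {x, y} = ⊤) (g : G) :
    ∃ i j : ℕ, ∃ d ∈ commutator G, g = x ^ i * y ^ j * d := by
  have hs : Function.Surjective (Abelianization.of : G →* Abelianization G) :=
    QuotientGroup.mk_surjective
  have hg : Abelianization.of g ∈ Subgroup.closure {Abelianization.of x, Abelianization.of y} := by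
    have := Subgroup.mem_map_of_mem Abelianization.of (hgen ▸ Subgroup.mem_top g)
    rwa [MonoidHom.map_closure, Set.image_pair] at this
  obtain ⟨i, j, hij⟩ := Subgroup.mem_closure_pair.1 hg
  obtain ⟨i', -, hi'⟩ := exists_pow_eq_zpow Nat.card_pos
    (pow_card_eq_one' (x := Abelianization.of x)) i
  obtain ⟨j', -, hj'⟩ := exists_pow_eq_zpow Nat.card_pos
    (pow_card_eq_one' (x := Abelianization.of y)) j
  refine ⟨i', j', (x ^ i' * y ^ j')⁻¹ * g, ?_, by group⟩
  rw [← Abelianization.ker_of, MonoidHom.mem_ker, map_mul, map_inv, ← hij, map_mul, map_pow,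
    map_pow, hi', hj', inv_mul_cancel]

theorem pStep_commutator_prod_le {A H : Type*} [CommGroup A] [Group H] :
    pStep 3 (commutator (A × H)) ≤ (⊥ : Subgroup A).prod (pStep 3 (commutator H)) := by
  have hle : commutator (A × H) ≤ (⊥ : Subgroup A).prod (commutator H) := by
    rw [commutator_def, Subgroup.commutator_le]
    intro a _ b _
    exact ⟨commutatorElement_eq_one_iff_mul_comm.2 (mul_comm _ _),
      Subgroup.commutator_mem_commutator (Subgroup.mem_top _) (Subgroup.mem_top _)⟩
  refine pStep_le_iff.2 ⟨fun k hk g => ?_, fun k hk => ?_⟩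
  · exact ⟨commutatorElement_eq_one_iff_mul_comm.2 (mul_comm _ _),
      commutatorElement_mem_pStep (hle hk).2 _⟩
  · have h1 : k.1 = 1 := (hle hk).1
    exact ⟨by rw [Prod.pow_fst, h1, one_pow]; rfl, pow_mem_pStep (hle hk).2⟩

/-- If `f : Γ → D` and `q : Γ → E` are homomorphisms such that `q` kills `M^3 [M, Γ]` for the
preimage `M` of `N`, the order of `q(M)` is controlled by that of `q(ker f)` and by
`N / N^3 [N, D]`. -/
theorem card_map_comap_dvd {Γ D E : Type*} [Group Γ] [Group D] [Group E] {f : Γ →* D} (q : Γ →* E)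
    (hf : Function.Surjective f) {N : Subgroup D} (hN : N.Normal)
    (hq : pStep 3 (N.comap f) ≤ q.ker) :
    Nat.card ((N.comap f).map q) ∣ Nat.card (f.ker.map q) * (pStep 3 N).relIndex N := by
  set M := N.comap f with hM
  have hMn : M.Normal := hN.comap f
  have hfM : f.ker ≤ M := fun g hg => by
    rw [hM, Subgroup.mem_comap, (MonoidHom.mem_ker).1 hg]; exact one_mem _
  set H := q.ker ⊓ M with hH
  have h1 : H.relIndex M = Nat.card (M.map q) := by
    rw [hH, Subgroup.inf_relIndex_right, Subgroup.relIndex_ker]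
  have h2 : H.relIndex (H ⊔ f.ker) = Nat.card (f.ker.map q) := by
    have : H.relIndex (H ⊔ f.ker) = q.ker.relIndex (H ⊔ f.ker) := by
      rw [← Subgroup.inf_relIndex_right q.ker]
      rw [← Subgroup.inf_relIndex_right H]
      congr 1
      rw [hH, inf_assoc, inf_eq_right.2 (sup_le inf_le_right hfM)]
    rw [this, Subgroup.relIndex_ker, Subgroup.map_sup, (Subgroup.map_eq_bot_iff H).2 inf_le_left,
      bot_sup_eq]
  have h3 : (H ⊔ f.ker).relIndex M ∣ (pStep 3 N).relIndex N := by
    have e : pStep 3 M ⊔ f.ker = (pStep 3 N).comap f := by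
      rw [← Subgroup.comap_map_eq, map_pStep hf, hM, Subgroup.map_comap_eq_self_of_surjective hf]
    have e' : (pStep 3 N).relIndex N = (pStep 3 M ⊔ f.ker).relIndex M := by
      rw [e, Subgroup.relIndex_comap, hM, Subgroup.map_comap_eq_self_of_surjective hf]
    rw [e']
    exact Subgroup.relIndex_dvd_of_le_left M (sup_le_sup_right (le_inf hq (pStep_le_self hMn)) _)
  rw [← h1, ← h2, ← Subgroup.relIndex_mul_relIndex H (H ⊔ f.ker) M le_sup_left
    (sup_le inf_le_right hfM)]
  exact Nat.mul_dvd_mul_left _ h3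

variable {D : Type} [Group D] {e : ℕ} {x y : D}

theorem map_commutator_le {G H : Type*} [Group G] [Group H] (f : G →* H) :
    (commutator G).map f ≤ commutator H := by
  rw [commutator_def, Subgroup.map_commutator, commutator_def]
  exact Subgroup.commutator_mono le_top le_top

section

variable {Γ : Type*} [Group Γ] [Finite Γ] {f : Γ →* D} {ξ η : Γ}

/-- The kernel of a homomorphism between two-generator groups matching the generators consists of
non-generators. -/
theorem IsMarking.ker_le_pStep_top (he : 1 ≤ e) (hm : IsMarking e x y)
    (hΓ : Subgroup.closure {ξ, η} = ⊤) (hξ : f ξ = x) (hη : f η = y) : f.ker ≤ pStep 3 ⊤ := by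
  intro γ hγ
  obtain ⟨i, j, δ, hδ, rfl⟩ := exists_eq_pow_mul_pow_mul hΓ γ
  have hij : x ^ i * y ^ j ∈ commutator D := by
    rw [MonoidHom.mem_ker, map_mul, map_mul, map_pow, map_pow, hξ, hη] at hγ
    rw [mul_eq_one_iff_eq_inv.1 hγ]
    exact inv_mem (map_commutator_le f (Subgroup.mem_map_of_mem f hδ))
  obtain ⟨⟨i, rfl⟩, j, rfl⟩ := hm.dvd_of_mem hij
  obtain ⟨d, rfl⟩ := Nat.exists_eq_add_of_le' he
  refine mul_mem (mul_mem ?_ ?_) ?_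
  · rw [pow_succ', mul_assoc, pow_mul, ← pow_mul, mul_comm, pow_mul]
    exact pow_mem_pStep (Subgroup.mem_top _)
  · rw [mul_comm, pow_mul]
    exact pow_mem_pStep (Subgroup.mem_top _)
  · exact (le_sup_left : _ ≤ pStep 3 (⊤ : Subgroup Γ)) hδ

/-- If `N = D'^3 [D', D]` contains `x^(3^e)` and `y^3`, its preimage under a homomorphism matching
the generators is generated, modulo `Γ'^3 [Γ', Γ]`, by the same powers of the generators of `Γ`. -/
theorem IsMarking.comap_pStep_commutator_le (hm : IsMarking e x y)
    (hgen : Subgroup.closure {x, y} = ⊤) (hΓ : Subgroup.closure {ξ, η} = ⊤) (hξ : f ξ = x)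
    (hη : f η = y) (hx : x ^ 3 ^ e ∈ pStep 3 (commutator D)) (hy : y ^ 3 ∈ pStep 3 (commutator D))
    (hD : ¬ commutator D ≤ pStep 3 (commutator D)) :
    (pStep 3 (commutator D)).comap f ≤
      Subgroup.closure {ξ ^ 3 ^ e, η ^ 3} ⊔ pStep 3 (commutator Γ) := by
  have hn : (pStep 3 (commutator D)).Normal := pStep_normal inferInstance
  have hnΓ : (pStep 3 (commutator Γ)).Normal := pStep_normal inferInstance
  have hle : pStep 3 (commutator D) ≤ commutator D := pStep_le_self inferInstance
  have hc : ⁅x, y⁆ ∈ commutator D :=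
    Subgroup.commutator_mem_commutator (Subgroup.mem_top _) (Subgroup.mem_top _)
  have hζ : ⁅ξ, η⁆ ∈ commutator Γ :=
    Subgroup.commutator_mem_commutator (Subgroup.mem_top _) (Subgroup.mem_top _)
  -- the order of `[x, y]` modulo `D'^3 [D', D]` is three
  have h3 : ∀ k : ℕ, ⁅x, y⁆ ^ k ∈ pStep 3 (commutator D) → 3 ∣ k := by
    intro k hk
    by_contra hk3
    refine hD ((commutator_le_zpowers_sup_pStep hgen).trans (sup_le (Subgroup.zpowers_le.2 ?_) le_rfl))
    have h1 := pow_mem_pStep (p := 3) hc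
    rw [← QuotientGroup.eq_one_iff]
    rw [← QuotientGroup.eq_one_iff, QuotientGroup.mk_pow] at hk h1
    rw [← orderOf_dvd_iff_pow_eq_one] at hk h1
    have := Nat.dvd_gcd h1 hk
    rwa [(Nat.Prime.coprime_iff_not_dvd Nat.prime_three).2 hk3, Nat.dvd_one,
      orderOf_eq_one_iff] at this
  intro γ hγ
  obtain ⟨i, j, δ, hδ, rfl⟩ := exists_eq_pow_mul_pow_mul hΓ γ
  have := commutator_le_zpowers_sup_pStep (p := 3) hΓ hδ
  rw [← SetLike.mem_coe, Subgroup.mul_normal] at this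
  obtain ⟨_, ⟨k, rfl⟩, ν, hν, rfl⟩ := this
  obtain ⟨k, -, hk⟩ := exists_pow_eq_zpow Nat.card_pos (pow_card_eq_one' (x := ⁅ξ, η⁆)) k
  have hfν : f ν ∈ pStep 3 (commutator D) :=
    pStep_mono (map_commutator_le f) (map_pStep_le f _ (Subgroup.mem_map_of_mem f hν))
  dsimp only at hγ ⊢
  rw [← hk] at hγ ⊢
  rw [Subgroup.mem_comap, map_mul, map_mul, map_mul, map_pow, map_pow, map_pow,
    map_commutatorElement, hξ, hη, ← mul_assoc, Subgroup.mul_mem_cancel_right _ hfν] at hγ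
  have hij := hle hγ
  rw [Subgroup.mul_mem_cancel_right _ (pow_mem hc k)] at hij
  obtain ⟨⟨i, rfl⟩, j, rfl⟩ := hm.dvd_of_mem hij
  rw [pow_mul, pow_mul, Subgroup.mul_mem_cancel_left _
    (mul_mem (pow_mem hx i) (pow_mem hy j))] at hγ
  obtain ⟨k, rfl⟩ := h3 k hγ
  refine mul_mem (Subgroup.mem_sup_left (mul_mem ?_ ?_))
    (Subgroup.mem_sup_right (mul_mem ?_ hν))
  · rw [pow_mul]; exact pow_mem (Subgroup.subset_closure (by simp)) i
  · rw [pow_mul]; exact pow_mem (Subgroup.subset_closure (by simp)) j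
  · rw [pow_mul]; exact pow_mem (pow_mem_pStep hζ) k

end

/-- A Schur group `D` with `D' / N` of order three, where `N = D'^3 [D', D]`, and with `x^(3^e)` and
`y^3` in `N`, must have `N / N^3 [N, D]` of order at least nine. Otherwise there would be an
extension of `D` by too many non-generators, namely the subgroup generated by the pairs formed by
the generators of `D` and suitable generators of a subgroup of `C_{3^(e+1)} × C_9 × UT_4(𝔽_3)^2`. -/
theorem IsSchurGroup.nine_dvd_relIndex [Finite D] (hS : IsSchurGroup 3 D)
    (hp : IsPGroup 3 D) (he : 1 ≤ e) (hm : IsMarking e x y) (hgen : Subgroup.closure {x, y} = ⊤)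
    (hx : x ^ 3 ^ e ∈ pStep 3 (commutator D)) (hy : y ^ 3 ∈ pStep 3 (commutator D))
    (hD : ¬ commutator D ≤ pStep 3 (commutator D)) :
    9 ∣ (pStep 3 (pStep 3 (commutator D))).relIndex (pStep 3 (commutator D)) := by
  set N := pStep 3 (commutator D) with hN
  have hNn : N.Normal := pStep_normal inferInstance
  let U := Unitriangular (ZMod 3 × ZMod 3)
  let E := AbType (e + 1) (1 + 1) × U
  let X : E := (abGenX _ _, Unitriangular.genX)
  let Y : E := (abGenY _ _, Unitriangular.genY)
  let L : Subgroup (E × D) := Subgroup.closure {(X, x), (Y, y)}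
  let ξ : L := ⟨(X, x), Subgroup.subset_closure (by simp)⟩
  let η : L := ⟨(Y, y), Subgroup.subset_closure (by simp)⟩
  have hL : Subgroup.closure {ξ, η} = ⊤ := closure_pair_subtype rfl _ _
  let f : L →* D := (MonoidHom.snd E D).comp L.subtype
  let q : L →* E := (MonoidHom.fst E D).comp L.subtype
  have hfξ : f ξ = x := rfl
  have hfη : f η = y := rfl
  have hqξ : q ξ = X := rfl
  have hqη : q η = Y := rfl
  have hf : Function.Surjective f := surjective_of_closure_pair hgen f hfξ hfη
  have hLp : IsPGroup 3 L := by
    obtain ⟨n, hn⟩ := IsPGroup.iff_card.1 hp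
    refine IsPGroup.to_subgroup (IsPGroup.of_card (n := e + 1 + (1 + 1) + 2 * 6 + n) ?_) L
    rw [Nat.card_prod, Nat.card_prod, card_abType, hn, Unitriangular.nat_card, Nat.card_prod,
      Nat.card_zmod, show 3 * 3 = 3 ^ 2 by norm_num, ← pow_mul, ← pow_add, ← pow_add]
  have hker := hm.ker_le_pStep_top he hL hfξ hfη
  have hM := hm.comap_pStep_commutator_le hgen hL hfξ hfη hx hy hD
  let V : Subgroup E := (abProj e 1).ker.prod (Unitriangular.corner (ZMod 3 × ZMod 3))
  have hX3 : X ^ 3 ^ e = (abGenX (e + 1) (1 + 1) ^ 3 ^ e, 1) := by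
    obtain ⟨d, rfl⟩ := Nat.exists_eq_add_of_le' he
    exact Prod.ext rfl (by
      rw [Prod.pow_snd, pow_succ', pow_mul, Unitriangular.genX_pow, one_pow])
  have hY3 : Y ^ 3 = (abGenY (e + 1) (1 + 1) ^ 3 ^ 1, 1) := Prod.ext rfl Unitriangular.genY_pow
  have hMV : (N.comap f).map q ≤ V := by
    rw [Subgroup.map_le_iff_le_comap]
    refine hM.trans (sup_le ((Subgroup.closure_le _).2 ?_) ?_)
    · rintro s (rfl | rfl)
      · change q (ξ ^ 3 ^ e) ∈ V
        rw [map_pow, hqξ, hX3]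
        exact ⟨mem_ker_abProj_iff.2 ⟨1, 0, by rw [pow_one, pow_zero, mul_one]⟩, one_mem _⟩
      · change q (η ^ 3) ∈ V
        rw [map_pow, hqη, hY3]
        exact ⟨mem_ker_abProj_iff.2 ⟨0, 1, by
          rw [pow_zero, one_mul]; exact (pow_one _).symm⟩, one_mem _⟩
    · rw [← Subgroup.map_le_iff_le_comap]
      refine (map_pStep_le q _).trans ((pStep_mono (map_commutator_le q)).trans ?_)
      exact pStep_commutator_prod_le.trans (Subgroup.prod_mono bot_le
        Unitriangular.pStep_commutator_le_corner)
  have hVM : V ≤ (N.comap f).map q := by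
    have hmem : ∀ γ, f γ ∈ N → q γ ∈ (N.comap f).map q := fun γ hγ => Subgroup.mem_map_of_mem q hγ
    have hu : ∀ g, f ⁅g, ⁅ξ, η⁆⁆ ∈ N := fun g => by
      rw [map_commutatorElement, map_commutatorElement, ← commutatorElement_inv]
      exact inv_mem (commutatorElement_mem_pStep (Subgroup.commutator_mem_commutator
        (Subgroup.mem_top _) (Subgroup.mem_top _)) _)
    have hcor : Unitriangular.corner (ZMod 3 × ZMod 3) ≤
        ((N.comap f).map q).comap (MonoidHom.inr (AbType (e + 1) (1 + 1)) U) := by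
      refine Unitriangular.corner_le_closure.trans ((Subgroup.closure_le _).2 ?_)
      rintro s (rfl | rfl)
      · have h := hmem _ (hu ξ)
        rw [map_commutatorElement, map_commutatorElement, hqξ, hqη] at h
        have h1 : ((1, ⁅Unitriangular.genX, ⁅Unitriangular.genX, Unitriangular.genY⁆⁆) : E) =
            ⁅X, ⁅X, Y⁆⁆ :=
          Prod.ext (commutatorElement_eq_one_iff_mul_comm.2 (mul_comm _ _)).symm rfl
        rw [← h1] at h
        exact h
      · have h := hmem _ (hu η)
        rw [map_commutatorElement, map_commutatorElement, hqξ, hqη] at h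
        have h1 : ((1, ⁅Unitriangular.genY, ⁅Unitriangular.genX, Unitriangular.genY⁆⁆) : E) =
            ⁅Y, ⁅X, Y⁆⁆ :=
          Prod.ext (commutatorElement_eq_one_iff_mul_comm.2 (mul_comm _ _)).symm rfl
        rw [← h1] at h
        exact h
    rintro ⟨s, t⟩ ⟨hs, ht⟩
    obtain ⟨i, j, hij⟩ := mem_ker_abProj_iff.1 hs
    have h1 := hmem (ξ ^ 3 ^ e) (by rwa [map_pow, hfξ])
    have h2 := hmem (η ^ 3) (by rwa [map_pow, hfη])
    rw [map_pow, hqξ, hX3] at h1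
    rw [map_pow, hqη, hY3] at h2
    convert mul_mem (mul_mem (pow_mem h1 i) (pow_mem h2 j)) (hcor ht) using 1
    refine Prod.ext ?_ ?_
    · exact hij.trans (mul_one _).symm
    · change t = 1 ^ i * 1 ^ j * t
      rw [one_pow, one_pow, one_mul, one_mul]
  -- `V` is central of exponent three
  have hVpStep : pStep 3 V = ⊥ := by
    refine pStep_eq_bot_iff.2 ⟨?_, ?_⟩
    · rintro ⟨s, t⟩ ⟨-, ht⟩
      refine Subgroup.mem_center_iff.2 fun g => Prod.ext (mul_comm _ _)
        (Subgroup.mem_center_iff.1 (Unitriangular.corner_le_center ht) _)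
    · rintro ⟨s, t⟩ ⟨hs, ht⟩
      exact Prod.ext (pow_three_of_mem_ker_abProj hs) (Unitriangular.pow_three_of_mem_corner ht)
  have hq : pStep 3 (N.comap f) ≤ q.ker := by
    rw [← Subgroup.map_eq_bot_iff, eq_bot_iff, ← hVpStep]
    exact (map_pStep_le q _).trans (pStep_mono hMV)
  have hcard : Nat.card ((N.comap f).map q) = 9 * 9 := by
    rw [le_antisymm hMV hVM, Nat.card_congr (Subgroup.prodEquiv _ _).toEquiv, Nat.card_prod,
      card_ker_abProj, Unitriangular.card_corner, Nat.card_prod, Nat.card_zmod]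
  have h9 : Nat.card (f.ker.map q) ∣ 9 := by
    have h := hS.relIndex_ker_dvd hLp hf hker
    rw [rank_eq_two hgen fun hab => hD ?_] at h
    · rw [← Subgroup.relIndex_ker]
      refine (Subgroup.relIndex_dvd_of_le_left _ ((pStep_mono fun g hg => ?_).trans hq)).trans h
      rw [Subgroup.mem_comap, (MonoidHom.mem_ker).1 hg]; exact one_mem _
    · rw [commutator_def, Subgroup.commutator_le]
      intro a _ b _
      rw [commutatorElement_eq_one_iff_mul_comm.2 (hab a b)]
      exact one_mem _
  have h := card_map_comap_dvd q hf hNn hq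
  rw [hcard] at h
  exact Nat.dvd_of_mul_dvd_mul_left (by norm_num) (h.trans (Nat.mul_dvd_mul_right h9 _))

end LowerBound

/-! ### The meaning of the transfer kernels -/

section TransferKernels

variable {D : Type} [Group D] [Finite D] {H : Subgroup D}

theorem abelianization_of_eq_one_iff {G : Type*} [Group G] {H : Subgroup G} (h : H) :
    Abelianization.of h = 1 ↔ (h : G) ∈ ⁅H, H⁆ := by
  rw [← MonoidHom.mem_ker, Abelianization.ker_of, ← Subgroup.map_subtype_commutator]
  exact (Subgroup.mem_map_iff_mem H.subtype_injective).symm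

/-- The meaning of the transfer kernel for an element outside the maximal subgroup. -/
theorem pow_three_mem_of_mem_ker_artinTransfer (hn : H.Normal) (hi : H.index = 3) {g : D}
    (hg : g ∉ H) (hk : g ∈ (artinTransfer H).ker) : g ^ 3 ∈ ⁅H, H⁆ := by
  rw [MonoidHom.mem_ker, artinTransfer, transfer_of_notMem _ hn hi hg,
    abelianization_of_eq_one_iff] at hk
  exact hk

/-- The meaning of the transfer kernel for an element of the maximal subgroup. -/
theorem mul_conj_mul_conj_mem_of_mem_ker_artinTransfer (hn : H.Normal) (hi : H.index = 3) {g t : D}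
    (ht : t ∉ H) (hg : g ∈ H) (hk : g ∈ (artinTransfer H).ker) :
    g * (t * g * t⁻¹) * (t ^ 2 * g * (t ^ 2)⁻¹) ∈ ⁅H, H⁆ := by
  have ht' : t⁻¹ ∉ H := fun h => ht (by simpa using inv_mem h)
  rw [MonoidHom.mem_ker, artinTransfer, transfer_of_mem _ hn hi ht' hg, ← map_mul, ← map_mul,
    abelianization_of_eq_one_iff] at hk
  simpa using hk

end TransferKernels

/-! ### An upper bound from the transfer kernels -/

section ClassThree

variable {G : Type*} [Group G] {x y : G}

/-- If `D'` is generated by `c` and central elements, the commutator subgroup of `⟨S, D'⟩` is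
controlled by the commutators between `c` and the elements of `S`. -/
theorem commutator_sup_commutator_le {S : Set G} {c : G}
    (hD : commutator G ≤ Subgroup.zpowers c ⊔ Subgroup.center G) {M : Subgroup G} (hM : M.Normal)
    (h : ∀ s ∈ S, ⁅s, c⁆ ∈ M ∧ ∀ t ∈ S, ⁅s, t⁆ ∈ M) :
    ⁅Subgroup.closure S ⊔ commutator G, Subgroup.closure S ⊔ commutator G⁆ ≤ M := by
  have hle : Subgroup.closure S ⊔ commutator G ≤
      Subgroup.closure (S ∪ {c} ∪ Subgroup.center G) := by
    refine sup_le (Subgroup.closure_mono fun s hs => Or.inl (Or.inl hs))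
      (hD.trans (sup_le ?_ fun s hs => Subgroup.subset_closure (Or.inr hs)))
    exact Subgroup.zpowers_le.2 (Subgroup.subset_closure (Or.inl (Or.inr rfl)))
  refine (Subgroup.commutator_mono hle hle).trans (commutator_closure_le hM ?_)
  rintro s hs t ht
  rcases ht with ht | ht
  · rcases hs with hs | hs
    · rcases hs with hs | rfl <;> rcases ht with ht | rfl
      · exact (h s hs).2 t ht
      · exact (h s hs).1
      · rw [← commutatorElement_inv]
        exact inv_mem (h t ht).1
      · simp
    · rw [commutatorElement_eq_one_iff_mul_comm.2 (Subgroup.mem_center_iff.1 hs t).symm]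
      exact one_mem _
  · rw [commutatorElement_eq_one_iff_mul_comm.2 (Subgroup.mem_center_iff.1 ht s)]
    exact one_mem _

/-- If `x` and `y` generate `G` and `N = G'^3 [G', G]` is central, then `N` is generated by
`[x, c]` and `[y, c]` as soon as `c = [x, y]` satisfies `c^3 = 1`. -/
theorem pStep_commutator_le_closure (hgen : Subgroup.closure {x, y} = ⊤)
    (hN : pStep 3 (commutator G) ≤ Subgroup.center G) (hN3 : ∀ g ∈ pStep 3 (commutator G), g ^ 3 = 1)
    (hc : ⁅x, y⁆ ^ 3 = 1) :
    pStep 3 (commutator G) ≤ Subgroup.closure {⁅x, ⁅x, y⁆⁆, ⁅y, ⁅x, y⁆⁆} := by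
  set c := ⁅x, y⁆ with hcdef
  set M := Subgroup.closure {⁅x, c⁆, ⁅y, c⁆} with hM
  have hcG : c ∈ commutator G :=
    Subgroup.commutator_mem_commutator (Subgroup.mem_top _) (Subgroup.mem_top _)
  have hMc : M ≤ Subgroup.center G := by
    rw [hM, Subgroup.closure_le]
    rintro s (rfl | rfl)
    all_goals
      rw [← commutatorElement_inv]
      exact inv_mem (hN (commutatorElement_mem_pStep hcG _))
  have hMn : M.Normal := by
    rw [← Subgroup.commutator_top_right_le_iff,
      Subgroup.commutator_top_right_eq_bot_iff_le_center.2 hMc]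
    exact bot_le
  let q := QuotientGroup.mk' M
  have hcq : ∀ g, q g * q c = q c * q g := by
    have htop : (⊤ : Subgroup G) ≤ (Subgroup.centralizer {q c}).comap q := by
      rw [← hgen, Subgroup.closure_le]
      have key : ∀ g, ⁅g, c⁆ ∈ M → g ∈ (Subgroup.centralizer {q c}).comap q := fun g hg => by
        rw [Subgroup.mem_comap, Subgroup.mem_centralizer_singleton_iff]
        rw [← QuotientGroup.eq_one_iff, ← QuotientGroup.mk'_apply, map_commutatorElement,
          commutatorElement_eq_one_iff_mul_comm] at hg
        exact hg
      rintro g (rfl | rfl)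
      exacts [key _ (Subgroup.subset_closure (by simp)), key _ (Subgroup.subset_closure (by simp))]
    intro g
    exact Subgroup.mem_centralizer_singleton_iff.1 (htop (Subgroup.mem_top g))
  have hcomm : ∀ g ∈ commutator G, ∃ i : ℤ, ∃ n ∈ pStep 3 (commutator G), g = c ^ i * n := by
    intro g hg
    have hn : (pStep 3 (commutator G)).Normal := pStep_normal inferInstance
    have := commutator_le_zpowers_sup_pStep (p := 3) hgen hg
    rw [← SetLike.mem_coe, Subgroup.mul_normal] at this
    obtain ⟨_, ⟨i, rfl⟩, n, hn, rfl⟩ := this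
    exact ⟨i, n, hn, rfl⟩
  refine pStep_le_iff.2 ⟨fun k hk g => ?_, fun k hk => ?_⟩
  · obtain ⟨i, n, hn, rfl⟩ := hcomm k hk
    rw [← QuotientGroup.eq_one_iff, ← QuotientGroup.mk'_apply, map_commutatorElement,
      commutatorElement_eq_one_iff_commute, map_mul, map_zpow]
    refine Commute.mul_left (Commute.zpow_left (hcq g).symm i) ?_
    have := congr_arg q (Subgroup.mem_center_iff.1 (hN hn) g)
    rw [map_mul, map_mul] at this
    exact this.symm
  · obtain ⟨i, n, hn, rfl⟩ := hcomm k hk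
    have h1 : Commute (c ^ i) n := Subgroup.mem_center_iff.1 (hN hn) _
    rw [h1.mul_pow, hN3 n hn, mul_one, ← zpow_natCast, ← zpow_mul, mul_comm, zpow_mul,
      zpow_natCast, hc, one_zpow]
    exact one_mem _

theorem mem_zpowers_of_zpow_mem_zpowers {a b : G} (ha : a ^ 3 = 1) {j : ℤ} (hj : ¬ (3 : ℤ) ∣ j)
    (h : a ^ j ∈ Subgroup.zpowers b) : a ∈ Subgroup.zpowers b := by
  have h3 : ∀ m : ℤ, a ^ (3 * m) = 1 := fun m => by
    rw [zpow_mul, show a ^ (3 : ℤ) = 1 by exact_mod_cast ha, one_zpow]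
  rcases (show j % 3 = 1 ∨ j % 3 = 2 by omega) with h1 | h1
  · have : a ^ j = a := by
      rw [show j = 3 * (j / 3) + 1 by omega, zpow_add, h3, one_mul, zpow_one]
    rwa [this] at h
  · have : (a ^ j)⁻¹ = a := by
      rw [← zpow_neg, show -j = 3 * (-(j / 3) - 1) + 1 by omega, zpow_add, h3, one_mul, zpow_one]
    rw [← this]
    exact inv_mem h

theorem card_le_three_of_le_zpowers {a : G} (ha : a ^ 3 = 1) {N : Subgroup G}
    (h : N ≤ Subgroup.zpowers a) : Nat.card N ≤ 3 := by
  have hfin : IsOfFinOrder a := isOfFinOrder_iff_pow_eq_one.2 ⟨3, by norm_num, ha⟩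
  have : Finite (Subgroup.zpowers a) := finite_zpowers.2 hfin
  calc Nat.card N ≤ Nat.card (Subgroup.zpowers a) := Subgroup.card_le_of_le h
    _ = orderOf a := Nat.card_zpowers a
    _ ≤ 3 := orderOf_le_of_pow_eq_one (by norm_num) ha

/-- The conditions on `y` to lie in the kernels of three of the transfers are incompatible with
`G'^3 [G', G]` being of order greater than three, if `y^3` lies in that subgroup. The first two
conditions yield `y^3 = 1`, and then the third one says that `[x, c]` is a power of `[y, c]`. -/
theorem card_pStep_commutator_le_three (hgen : Subgroup.closure {x, y} = ⊤)
    (hN : pStep 3 (pStep 3 (commutator G)) = ⊥) (hy : y ^ 3 ∈ pStep 3 (commutator G))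
    (h0 : y ^ 3 ∈ ⁅Subgroup.closure {x} ⊔ commutator G, Subgroup.closure {x} ⊔ commutator G⁆)
    (h1 : y ^ 3 ∈
      ⁅Subgroup.closure {x * y} ⊔ commutator G, Subgroup.closure {x * y} ⊔ commutator G⁆)
    (h3 : y * (x * y * x⁻¹) * (x ^ 2 * y * (x ^ 2)⁻¹) ∈
      ⁅Subgroup.closure {x ^ 3, y} ⊔ commutator G, Subgroup.closure {x ^ 3, y} ⊔ commutator G⁆) :
    Nat.card (pStep 3 (commutator G)) ≤ 3 := by
  obtain ⟨hNc, hN3⟩ := pStep_eq_bot_iff.1 hN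
  set c := ⁅x, y⁆ with hcdef
  set d := ⁅x, c⁆ with hddef
  set d' := ⁅y, c⁆ with hddef'
  have hcG : c ∈ commutator G :=
    Subgroup.commutator_mem_commutator (Subgroup.mem_top _) (Subgroup.mem_top _)
  have hmem : ∀ g, ⁅g, c⁆ ∈ pStep 3 (commutator G) := fun g => by
    rw [← commutatorElement_inv]
    exact inv_mem (commutatorElement_mem_pStep hcG _)
  have hcen : ∀ {g}, g ∈ pStep 3 (commutator G) → ∀ r, g * r = r * g := fun hg r =>
    (Subgroup.mem_center_iff.1 (hNc hg) r).symm
  have hd : ∀ r, d * r = r * d := hcen (hmem x)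
  have hd' : ∀ r, d' * r = r * d' := hcen (hmem y)
  have hd3 : d ^ 3 = 1 := hN3 _ (hmem x)
  have hd3' : d' ^ 3 = 1 := hN3 _ (hmem y)
  have hyc : y * c = c * (y * d') := by
    rw [← hd' y, ← mul_assoc, ← hd' c, hddef', commutatorElement_def]; simp
  have hyc' : ∀ r, y * (c * r) = c * (y * (d' * r)) := fun r => by
    rw [← mul_assoc, hyc]; simp only [mul_assoc]
  have hxy : x * y * x⁻¹ = c * y := by rw [hcdef, commutatorElement_def]; group
  -- conjugation by `x`
  obtain ⟨γ, hγ⟩ : ∃ γ : G →* G, ∀ g, γ g = x * g * x⁻¹ := ⟨(MulAut.conj x).toMonoidHom, fun _ => rfl⟩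
  have hγy : γ y = c * y := by rw [hγ, hxy]
  have hγc : γ c = d * c := by rw [hγ, hddef, commutatorElement_def]; group
  have hγd : γ d = d := by rw [hγ, ← hd, mul_inv_cancel_right]
  have hl : ∀ {g : G}, (∀ r, g * r = r * g) → ∀ r s, g * (r * s) = r * (g * s) := fun hg r s => by
    rw [← mul_assoc, hg, mul_assoc]
  -- `c y` is a conjugate of `y`, and `y^3` is central
  have hc3 : c ^ 3 = 1 := by
    have e1 : (c * y) ^ 3 = y ^ 3 := by
      rw [← hxy, conj_pow, ← hcen hy, mul_assoc, mul_inv_cancel, mul_one]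
    have e2 : (c * y) ^ 3 = c ^ 3 * (y ^ 3 * d' ^ 3) := by
      simp only [pow_succ, pow_zero, one_mul, mul_assoc, hyc', hd' y, hl hd' y, hl hd' c]
    rw [hd3', mul_one] at e2
    exact mul_eq_right.1 (e2.symm.trans e1)
  have hx2 : x ^ 2 * y * (x ^ 2)⁻¹ = d * c * (c * y) := by
    rw [← hγc, ← hγy, ← map_mul, ← hγy, hγ, hγ]
    simp only [pow_two, mul_inv_rev, mul_assoc]
  have hx3 : ∀ g, γ (γ (γ g)) = g → ⁅x ^ 3, g⁆ = 1 := fun g hg => by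
    have : x ^ 3 * g * (x ^ 3)⁻¹ = γ (γ (γ g)) := by
      simp only [hγ, pow_succ, pow_zero, one_mul, mul_inv_rev, mul_assoc]
    rw [commutatorElement_def, this, hg, mul_inv_cancel]
  have hx3c : ⁅x ^ 3, c⁆ = 1 := hx3 c <| by
    rw [hγc, map_mul, hγd, hγc, map_mul, map_mul, hγd, hγc]
    calc d * (d * (d * c)) = d ^ 3 * c := by simp only [pow_succ, pow_zero, one_mul, mul_assoc]
      _ = c := by rw [hd3, one_mul]
  have hx3y : ⁅x ^ 3, y⁆ = 1 := hx3 y <| by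
    rw [hγy, map_mul, hγc, hγy, map_mul, map_mul, map_mul, hγd, hγc, hγy]
    calc d * (d * c) * (d * c * (c * y)) = d ^ 3 * c ^ 3 * y := by
          simp only [pow_succ, pow_zero, one_mul, mul_assoc, hd c, hl hd c, hd y, hl hd y]
      _ = y := by rw [hd3, hc3, one_mul, one_mul]
  have hD : commutator G ≤ Subgroup.zpowers c ⊔ Subgroup.center G :=
    (commutator_le_zpowers_sup_pStep hgen).trans (sup_le_sup_left hNc _)
  have hzn : ∀ {g}, g ∈ pStep 3 (commutator G) → (Subgroup.zpowers g).Normal := fun hg => by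
    rw [← Subgroup.commutator_top_right_le_iff,
      Subgroup.commutator_top_right_eq_bot_iff_le_center.2 (Subgroup.zpowers_le.2 (hNc hg))]
    exact bot_le
  have hxyc : ⁅x * y, c⁆ = d' * d := by
    have : ⁅x * y, c⁆ = x * d' * x⁻¹ * d := by
      rw [hddef, hddef']; simp only [commutatorElement_def]; group
    rw [this, ← hd', mul_inv_cancel_right]
  have h0' : y ^ 3 ∈ Subgroup.zpowers d := by
    refine commutator_sup_commutator_le hD (hzn (hmem x)) ?_ h0
    rintro s rfl
    refine ⟨Subgroup.mem_zpowers _, ?_⟩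
    rintro t rfl
    simp
  have h1' : y ^ 3 ∈ Subgroup.zpowers (d' * d) := by
    rw [← hxyc]
    refine commutator_sup_commutator_le hD (hzn (hmem (x * y))) ?_ h1
    rintro s rfl
    refine ⟨Subgroup.mem_zpowers _, ?_⟩
    rintro t rfl
    simp
  have h3' : d * (d' ^ 5 * y ^ 3) ∈ Subgroup.zpowers d' := by
    have e : y * (x * y * x⁻¹) * (x ^ 2 * y * (x ^ 2)⁻¹) = c ^ 3 * (y ^ 3 * (d * d' ^ 5)) := by
      rw [hxy, hx2]
      simp only [pow_succ, pow_zero, one_mul, mul_assoc, hyc', hd' y, hl hd' y, hl hd' c,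
        hd y, hd c, hl hd c, hd' d, hl hd' d]
    have e' : d * (d' ^ 5 * y ^ 3) = y * (x * y * x⁻¹) * (x ^ 2 * y * (x ^ 2)⁻¹) := by
      rw [e, hc3, one_mul, hcen hy, mul_assoc]
    rw [e']
    refine commutator_sup_commutator_le hD (hzn (hmem y)) ?_ h3
    rintro s (rfl | rfl)
    · rw [hx3c]
      refine ⟨one_mem _, ?_⟩
      rintro t (rfl | rfl)
      · simp
      · rw [hx3y]; exact one_mem _
    · refine ⟨Subgroup.mem_zpowers _, ?_⟩
      rintro t (rfl | rfl)
      · rw [← commutatorElement_inv (x ^ 3), hx3y, inv_one]; exact one_mem _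
      · simp
  have hcl := pStep_commutator_le_closure hgen hNc hN3 hc3
  by_cases hA : d ∈ Subgroup.zpowers d'
  · refine card_le_three_of_le_zpowers hd3' (hcl.trans ((Subgroup.closure_le _).2 ?_))
    rintro s (rfl | rfl)
    exacts [hA, Subgroup.mem_zpowers _]
  by_cases hB : d' ∈ Subgroup.zpowers d
  · refine card_le_three_of_le_zpowers hd3 (hcl.trans ((Subgroup.closure_le _).2 ?_))
    rintro s (rfl | rfl)
    exacts [Subgroup.mem_zpowers _, hB]
  exfalso
  have hy1 : y ^ 3 = 1 := by
    obtain ⟨j, hj⟩ := Subgroup.mem_zpowers_iff.1 h1'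
    have hdd : Commute d' d := hd' d
    by_cases h3j : (3 : ℤ) ∣ j
    · obtain ⟨m, rfl⟩ := h3j
      rw [← hj, zpow_mul, show (d' * d) ^ (3 : ℤ) = (d' * d) ^ 3 by norm_cast, hdd.mul_pow, hd3,
        hd3', one_mul, one_zpow]
    · refine absurd (mem_zpowers_of_zpow_mem_zpowers hd3' h3j ?_) hB
      rw [hdd.mul_zpow] at hj
      rw [← hj] at h0'
      exact (Subgroup.mul_mem_cancel_right _ (Subgroup.zpow_mem_zpowers _ _)).1 h0'
  rw [hy1, mul_one, Subgroup.mul_mem_cancel_right _ (Subgroup.npow_mem_zpowers _ _)] at h3'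
  exact hA h3'

end ClassThree

/-! ### Uniqueness of the modular group -/

section Uniqueness

theorem map_commutator_of_surjective {G H : Type*} [Group G] [Group H] {f : G →* H}
    (hf : Function.Surjective f) : (commutator G).map f = commutator H := by
  rw [commutator_def, Subgroup.map_commutator, Subgroup.map_top_of_surjective f hf, commutator_def]

theorem map_commutator_closure_sup {G H : Type*} [Group G] [Group H] {f : G →* H}
    (hf : Function.Surjective f) (S : Set G) :
    (⁅Subgroup.closure S ⊔ commutator G, Subgroup.closure S ⊔ commutator G⁆).map f =
      ⁅Subgroup.closure (f '' S) ⊔ commutator H, Subgroup.closure (f '' S) ⊔ commutator H⁆ := by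
  rw [Subgroup.map_commutator, Subgroup.map_sup, MonoidHom.map_closure,
    map_commutator_of_surjective hf]

theorem commutator_closure_singleton_sup_le {G : Type*} [Group G] (x : G) :
    ⁅Subgroup.closure {x} ⊔ commutator G, Subgroup.closure {x} ⊔ commutator G⁆ ≤
      pStep 3 (commutator G) := by
  rw [← Subgroup.closure_eq (commutator G), ← Subgroup.closure_union, Subgroup.closure_eq]
  apply commutator_closure_le (pStep_normal inferInstance)
  rintro s hs t (rfl | ht)
  · rcases hs with rfl | hs
    · simp
    · exact commutatorElement_mem_pStep hs _
  · rw [← commutatorElement_inv]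
    exact inv_mem (commutatorElement_mem_pStep ht _)

variable {D : Type} [Group D] {e : ℕ} {x y : D}

theorem IsMarking.index_commutator (hm : IsMarking e x y) :
    (commutator D).index = 3 ^ (e + 1) := by
  rw [← card_abType e 1]
  exact Nat.card_congr hm.1.some.toEquiv

/-- If `x^(3^e)` is not in `D'^3 [D', D]` but `y^3` is, then `D'` is generated by `x^(3^e)`: modulo
the next step of the series, `D` satisfies the relation that defines the modular group. -/
theorem IsMarking.exists_standardPair [Finite D] (hm : IsMarking e x y) (he : 1 ≤ e)
    (hp : IsPGroup 3 D) (hgen : Subgroup.closure {x, y} = ⊤) (hx : x ^ 3 ^ e ∉ pStep 3 (commutator D))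
    (hy : y ^ 3 ∈ pStep 3 (commutator D)) : ∃ y', StandardPair e 1 x y' := by
  set N := pStep 3 (commutator D) with hN
  have hNn : N.Normal := pStep_normal inferInstance
  have hK : (pStep 3 N).Normal := pStep_normal hNn
  set c := ⁅y, x⁆ with hc
  have hcD : c ∈ commutator D :=
    Subgroup.commutator_mem_commutator (Subgroup.mem_top _) (Subgroup.mem_top _)
  have hc3 : c ^ 3 ∈ N := pow_mem_pStep hcD
  have hc3' : ∀ m : ℤ, c ^ (3 * m) ∈ N := fun m => by
    rw [zpow_mul]; exact zpow_mem (by exact_mod_cast hc3) m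
  have hle : commutator D ≤ Subgroup.zpowers c ⊔ N :=
    commutator_le_zpowers_sup_pStep (by rwa [Set.pair_comm])
  obtain ⟨i, n, hn, hz⟩ : ∃ i : ℤ, ∃ n ∈ N, x ^ 3 ^ e = c ^ i * n := by
    have := hle hm.2.1
    rw [← SetLike.mem_coe, Subgroup.mul_normal] at this
    obtain ⟨_, ⟨i, rfl⟩, n, hn, h⟩ := this
    exact ⟨i, n, hn, h.symm⟩
  have hi : ¬ (3 : ℤ) ∣ i := by
    rintro ⟨m, rfl⟩
    rw [hz] at hx
    exact hx (mul_mem (hc3' m) hn)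
  -- since `i` is its own inverse modulo three, `c` is the `i`-th power of `x^(3^e)` modulo `N`
  have hw : c * ((x ^ 3 ^ e) ^ i)⁻¹ ∈ N := by
    rw [← QuotientGroup.eq_one_iff, QuotientGroup.mk_mul, QuotientGroup.mk_inv,
      QuotientGroup.mk_zpow, hz, QuotientGroup.mk_mul, (QuotientGroup.eq_one_iff n).2 hn, mul_one,
      QuotientGroup.mk_zpow, ← zpow_mul, ← zpow_neg, ← zpow_one_add, ← QuotientGroup.mk_zpow,
      QuotientGroup.eq_one_iff]
    obtain ⟨m, hm⟩ : (3 : ℤ) ∣ 1 + -(i * i) := by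
      rcases (show i % 3 = 1 ∨ i % 3 = 2 by omega) with h | h
      · obtain ⟨t, rfl⟩ : ∃ t, i = 3 * t + 1 := ⟨i / 3, by omega⟩
        exact ⟨-(3 * t * t + 2 * t), by ring⟩
      · obtain ⟨t, rfl⟩ : ∃ t, i = 3 * t + 2 := ⟨i / 3, by omega⟩
        exact ⟨-(3 * t * t + 4 * t + 1), by ring⟩
    rw [hm]
    exact hc3' m
  -- modulo `N^3 [N, D]` the element `c` agrees with this power up to a central factor
  have hN0 : N = ⊥ := by
    refine eq_bot_of_le_pStep hp ?_
    let q := QuotientGroup.mk' (pStep 3 N)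
    have hq : Function.Surjective q := QuotientGroup.mk'_surjective _
    obtain ⟨hcen, h3⟩ := pStep_eq_bot_iff.1 (show pStep 3 (N.map q) = ⊥ by
      rw [← map_pStep hq, Subgroup.map_eq_bot_iff, QuotientGroup.ker_mk'])
    have hqw := Subgroup.mem_map_of_mem q hw
    obtain ⟨m, hm⟩ := hp x
    have hgen' : Subgroup.closure {q x, q y} = ⊤ := by
      have := congr_arg (Subgroup.map q) hgen
      rwa [MonoidHom.map_closure, Set.image_pair, Subgroup.map_top_of_surjective _ hq] at this
    have hD := (pStep_commutator_of_conj_eq he hgen' (k := i) (l := 0) hi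
      (by rw [← map_pow, hm, map_one]) (hcen hqw) (h3 _ hqw)
      (hcen (Subgroup.mem_map_of_mem q hy)) (by
        have h1 : y * x * y⁻¹ = c * ((x ^ 3 ^ e) ^ i)⁻¹ * x ^ (1 + 3 ^ e * i) := by
          rw [add_comm, zpow_add_one, zpow_mul, ← mul_assoc,
            show x ^ (3 ^ e : ℤ) = x ^ 3 ^ e by exact_mod_cast zpow_natCast x (3 ^ e),
            inv_mul_cancel_right, hc, commutatorElement_def, inv_mul_cancel_right]
        rw [Subgroup.mem_center_iff.1 (hcen hqw), ← map_zpow,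
          ← map_mul q (c * ((x ^ 3 ^ e) ^ i)⁻¹), ← h1, map_mul, map_mul, map_inv])
      (by rw [mul_zero, zpow_zero, one_mul, map_pow])).2
    rwa [← map_commutator_of_surjective hq, ← map_pStep hq, Subgroup.map_eq_bot_iff,
      QuotientGroup.ker_mk'] at hD
  rw [hN0, Subgroup.mem_bot] at hx hy hn hc3
  rw [hn, mul_one] at hz
  have hz3 : (x ^ 3 ^ e) ^ 3 = 1 := by
    rw [← Subgroup.mem_bot, ← hN0]; exact pow_mem_pStep hm.2.1
  have hDz : commutator D ≤ Subgroup.zpowers (x ^ 3 ^ e) := by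
    refine hle.trans ?_
    rw [hN0, sup_bot_eq, Subgroup.zpowers_le]
    exact mem_zpowers_of_zpow_mem_zpowers hc3 hi (hz ▸ Subgroup.mem_zpowers _)
  have hcard : Nat.card D = 3 ^ (e + 2) := by
    rw [← Subgroup.card_mul_index (commutator D), hm.index_commutator,
      le_antisymm hDz (Subgroup.zpowers_le.2 hm.2.1), Nat.card_zpowers,
      orderOf_eq_prime hz3 hx]
    ring
  obtain ⟨y', h | h⟩ := _root_.exists_standardPair he hgen hN0
    (by rw [pow_succ, pow_mul, hz3]) hDz (by rw [hy]; exact one_mem _) hcard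
  · have h1 := hm.2.1
    rw [h.commutator_eq_zpowers he, pow_zero, Subgroup.zpowers_one_eq_bot, Subgroup.mem_bot] at h1
    exact absurd h1 hx
  · exact ⟨y', h⟩

/-- If `D` were abelian, `x^(3^(e-1))` would lie in all the transfer kernels. -/
theorem commutator_not_le_pStep [Finite D] (he : 1 ≤ e) (hp : IsPGroup 3 D) (hm : IsMarking e x y)
    (hker : ∀ i, (artinTransfer (maxSub x y i)).ker = kernelSub e x y 1) :
    ¬ commutator D ≤ pStep 3 (commutator D) := by
  intro hD
  have hbot := eq_bot_of_le_pStep hp hD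
  obtain ⟨d, rfl⟩ := Nat.exists_eq_add_of_le' he
  have hab : ∀ a b : D, a * b = b * a := fun a b => by
    rw [← commutatorElement_eq_one_iff_mul_comm, ← Subgroup.mem_bot, ← hbot]
    exact Subgroup.commutator_mem_commutator (Subgroup.mem_top _) (Subgroup.mem_top _)
  have hx : x ^ 3 ^ (d + 1) = 1 := by
    rw [← Subgroup.mem_bot, ← hbot]; exact hm.2.1
  have hy : y ^ 3 = 1 := by
    rw [← Subgroup.mem_bot, ← hbot]; exact hm.2.2.1
  have h1 : x ^ 3 ^ d ∈ (artinTransfer (maxSub x y 0)).ker := by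
    rw [mem_ker_artinTransfer_iff (maxSub_normal x y 0) (hm.index_maxSub he 0)
      (le_bot_iff.1 ((pStep_le_self inferInstance).trans hbot.le))
      (fun a b => Subtype.ext (hab a b)), ← pow_mul, ← pow_succ, hx]
  have h2 : x ^ 3 ^ d ∈ Subgroup.closure {y} ⊔ commutator D := by
    rw [hker 0] at h1; exact h1
  rw [hbot, sup_bot_eq, ← Subgroup.zpowers_eq_closure] at h2
  obtain ⟨j, hj⟩ := Subgroup.mem_zpowers_iff.1 h2
  obtain ⟨j, -, hj'⟩ := exists_pow_eq_zpow (by norm_num) hy j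
  have h3 : x ^ 3 ^ d * y ^ (2 * j) ∈ commutator D := by
    rw [← hj, ← hj', ← pow_add, show j + 2 * j = 3 * j by ring, pow_mul, hy, one_pow]
    exact one_mem _
  have h4 := (hm.dvd_of_mem h3).1
  rw [Nat.pow_dvd_pow_iff_le_right (by norm_num)] at h4
  omega

/-- The uniqueness of the modular group: a Schur group all of whose transfers to maximal subgroups
have the kernel `⟨y, G'⟩` is modular. -/
theorem exists_standardPair_of_kernels [Finite D] (he : 1 ≤ e) (hp : IsPGroup 3 D)
    (hS : IsSchurGroup 3 D) (hm : IsMarking e x y)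
    (hker : ∀ i, (artinTransfer (maxSub x y i)).ker = kernelSub e x y 1) :
    ∃ y', StandardPair e 1 x y' := by
  have hgen : Subgroup.closure {x, y} = ⊤ :=
    eq_top_of_sup_pStep_top (p := 3) hp (top_le_iff.1 (hm.2.2.2.ge.trans (sup_le_sup_left
      (show commutator D ≤ pStep 3 ⊤ from le_sup_left) _)))
  have hyker : ∀ i, y ∈ (artinTransfer (maxSub x y i)).ker := fun i => by
    rw [hker]
    exact Subgroup.mem_sup_left (Subgroup.subset_closure rfl)
  obtain ⟨hy0, hy1, hx3⟩ := hm.notMem_maxSub he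
  have h0 : y ^ 3 ∈ ⁅Subgroup.closure {x} ⊔ commutator D, Subgroup.closure {x} ⊔ commutator D⁆ :=
    pow_three_mem_of_mem_ker_artinTransfer (maxSub_normal x y 0) (hm.index_maxSub he 0) hy0 (hyker 0)
  have h1 : y ^ 3 ∈ ⁅Subgroup.closure {x * y} ⊔ commutator D,
      Subgroup.closure {x * y} ⊔ commutator D⁆ :=
    pow_three_mem_of_mem_ker_artinTransfer (maxSub_normal x y 1) (hm.index_maxSub he 1) hy1 (hyker 1)
  have h3 : y * (x * y * x⁻¹) * (x ^ 2 * y * (x ^ 2)⁻¹) ∈ ⁅Subgroup.closure {x ^ 3, y} ⊔ commutator D,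
      Subgroup.closure {x ^ 3, y} ⊔ commutator D⁆ :=
    mul_conj_mul_conj_mem_of_mem_ker_artinTransfer (maxSub_normal x y 3) (hm.index_maxSub he 3) hx3
      (Subgroup.mem_sup_left (Subgroup.subset_closure (by simp))) (hyker 3)
  have hy : y ^ 3 ∈ pStep 3 (commutator D) := commutator_closure_singleton_sup_le x h0
  by_cases hx : x ^ 3 ^ e ∈ pStep 3 (commutator D)
  · exfalso
    have h9 := hS.nine_dvd_relIndex hp he hm hgen hx hy (commutator_not_le_pStep he hp hm hker)
    set N := pStep 3 (commutator D) with hN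
    have hK : (pStep 3 N).Normal := pStep_normal (pStep_normal inferInstance)
    let q := QuotientGroup.mk' (pStep 3 N)
    have hqk : q.ker = pStep 3 N := QuotientGroup.ker_mk' _
    have hq : Function.Surjective q := QuotientGroup.mk'_surjective _
    have hNq : N.map q = pStep 3 (commutator (D ⧸ pStep 3 N)) :=
      (map_pStep hq _).trans (congr_arg (pStep 3) (map_commutator_of_surjective hq))
    have hgen' : Subgroup.closure {q x, q y} = ⊤ := by
      have := congr_arg (Subgroup.map q) hgen
      rwa [MonoidHom.map_closure, Set.image_pair, Subgroup.map_top_of_surjective _ hq] at this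
    have hcard : Nat.card (N.map q) ≤ 3 := by
      rw [hNq]
      refine card_pStep_commutator_le_three hgen' ?_ ?_ ?_ ?_ ?_
      · rw [← hNq, ← map_pStep hq, Subgroup.map_eq_bot_iff, hqk]
      · rw [← hNq, ← map_pow]
        exact Subgroup.mem_map_of_mem q hy
      · have := Subgroup.mem_map_of_mem q h0
        rwa [map_commutator_closure_sup hq, Set.image_singleton, map_pow] at this
      · have := Subgroup.mem_map_of_mem q h1
        rwa [map_commutator_closure_sup hq, Set.image_singleton, map_pow, map_mul] at this
      · have := Subgroup.mem_map_of_mem q h3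
        rw [map_commutator_closure_sup hq, Set.image_pair] at this
        simpa only [map_mul, map_inv, map_pow] using this
    rw [← hqk, Subgroup.relIndex_ker] at h9
    have := Nat.le_of_dvd Nat.card_pos h9
    omega
  · exact hm.exists_standardPair he hp hgen hx hy

end Uniqueness

/-! ### The trunk and the twigs of the tree -/

theorem StandardPair.isMetabelian {D : Type} [Group D] {e : ℕ} {x y : D} (h : StandardPair e 1 x y)
    (he : 1 ≤ e) : IsMetabelian D := by
  have h1 := (pStep_eq_bot_iff.1 (h.pStep_commutator he)).1
  rw [IsMetabelian, derivedSeries_succ, derivedSeries_one,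
    Subgroup.commutator_eq_bot_iff_le_centralizer]
  exact h1.trans (Subgroup.center_le_centralizer _)

theorem mainTheorem12 (e : ℕ) (he : 2 ≤ e) :
    -- the trunk vertex: the abelian group of type `(3^e, 3)`, and its invariants
    (∀ (T : Type) [Group T], Nonempty (T ≃* AbType e 1) ↔ IsTrunkVertex (e - 2) T) ∧
    Nat.card (AbType e 1) = 3 ^ (1 + e) ∧
    HasPTKT e ![0, 0, 0, 0] (AbType e 1) ∧
    HasAQI e ![(e, 0), (e, 0), (e, 0), (e - 1, 1)] (AbType e 1) ∧
    -- the twig vertex `G_e`, the only non-trunk child of `T_e`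
    ∃ (G : Type) (_ : Group G) (_ : Finite G),
      (∀ (D : Type) [Group D], IsTwigVertex (e - 2) D ↔ Nonempty (D ≃* G)) ∧
      -- the descendant tree: exactly two children of `T_e`, both of step size one,
      -- the next trunk vertex and the leaf `G_e`
      (∀ (D : Type) [Group D] (s : ℕ), IsImmediateDescendant 3 s (AbType e 1) D ↔
        s = 1 ∧ (Nonempty (D ≃* AbType (e + 1) 1) ∨ Nonempty (D ≃* G))) ∧
      (¬ ∃ (D : Type) (_ : Group D) (s : ℕ), Finite D ∧ IsImmediateDescendant 3 s G D) ∧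
      -- `G_e` is the unique metabelian Schur group of type `(3^e, 3)` with TKT A.1
      (∀ (D : Type) [Group D] [Finite D],
        (IsPGroup 3 D ∧ IsMetabelian D ∧ IsSchurGroup 3 D ∧ HasAbelianization e D ∧
          HasPTKT e ![1, 1, 1, 1] D) ↔ Nonempty (D ≃* G)) ∧
      -- further invariants of `G_e`
      HasAQI e ![(e + 1, 0), (e + 1, 0), (e + 1, 0), (e, 1)] G ∧
      Nat.card G = 3 ^ (2 + e) ∧
      ¬ IsSigmaGroup G := by
  obtain ⟨n, rfl⟩ := Nat.exists_eq_add_of_le' he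
  rw [Nat.add_sub_cancel]
  have hT : StandardPair (n + 1) 0 (abGenX (n + 2) 1) (abGenY (n + 2) 1) :=
    StandardPair.abType (n + 1)
  refine ⟨fun T _ => (isTrunkVertex_iff n T).symm, by rw [card_abType, add_comm],
    hT.hasPTKT_abelian (by omega), hT.hasAQI (by omega) (by omega) (hT.isMarking_abelian (by omega)), ?_⟩
  obtain ⟨G, _, x, y, hG⟩ := StandardPair.exists_modular (e := n + 2) (by omega)
  have := hG.finite
  -- a group is isomorphic to `G` if and only if it has a standard pair of generators
  have hiff : ∀ (D : Type) [Group D], Nonempty (D ≃* G) ↔ ∃ u v : D, StandardPair (n + 2) 1 u v :=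
    fun D _ => ⟨fun ⟨f⟩ => ⟨_, _, hG.map f.symm⟩, fun ⟨u, v, h⟩ => h.nonempty_mulEquiv hG⟩
  refine ⟨G, inferInstance, hG.finite, fun D _ => by rw [hiff, isTwigVertex_iff], fun D _ s => ?_,
    fun ⟨D, _, s, _, h⟩ => hG.not_isImmediateDescendant (by omega) h, fun D _ _ => ?_,
    hG.hasAQI (by omega) (by omega) (hG.isMarking_modular (by omega)), by rw [hG.card, add_comm],
    hG.not_isSigmaGroup (by omega)⟩
  · rw [hiff, StandardPair.nonempty_mulEquiv_abType_iff]
    constructor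
    · intro h
      obtain ⟨hs, u, v, huv | huv⟩ := h.exists_standardPair (by omega)
      exacts [⟨hs, Or.inl ⟨u, v, huv⟩⟩, ⟨hs, Or.inr ⟨u, v, huv⟩⟩]
    · rintro ⟨rfl, ⟨u, v, h⟩ | ⟨u, v, h⟩⟩
      exacts [h.isImmediateDescendant (by omega), h.isImmediateDescendant (by omega)]
  · rw [hiff]
    constructor
    · rintro ⟨hp, -, hS, -, u, v, hm, hker⟩
      obtain ⟨v', h⟩ := exists_standardPair_of_kernels (by omega) hp hS hm
        fun i => (hker i).trans (by fin_cases i <;> rfl)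
      exact ⟨u, v', h⟩
    · rintro ⟨u, v, h⟩
      exact ⟨IsPGroup.of_card h.card, h.isMetabelian (by omega), h.isSchurGroup (by omega),
        (h.isMarking_modular (by omega)).1, h.hasPTKT_modular (by omega)⟩
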